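/- Let $H$ be a real Hilbert space and $A:D(A)\to H$ a self-adjoint positive linear operator with compact inverse, with orthonormal eigenbasis $\{e_n\}_{n\ge1}$, $Ae_n=\lambda_ne_n$, $0<\lambda_1\le\lambda_2\le\dots$. For $s\in\mathbb R$ put $\|u\|_{H^s}^2=\sum_n\lambda_n^s(u,e_n)^2$ (for $s<0$, $H^s$ is the completion of $H$ in this norm). Fix $N\ge1$, let $P_N$ be the orthoprojector onto $H_+:=\mathrm{span}\{e_1,\dots,e_N\}$, $Q_N=\mathrm{Id}-P_N$, $H_-:=Q_NH$, and let $V(\xi)=\|Q_N\xi\|^2_{H^{-1}}-\|P_N\xi\|^2_{H^{-1}}$ for $\xi\in H^{-1}$. Let $F:H\to H$ be globally bounded and Gateaux differentiable with $F'(u)\in\mathcal L(H,H)$, $\|F'(u)\|_{\mathcal L(H,H)}\le L$ and $$F(u_1)-F(u_2)=\int_0^1F'(su_1+(1-s)u_2)(u_1-u_2)\,ds\qquad(u_1,u_2\in H).$$ Consider the equation $$\partial_tu+A^2u+AF(u)=0 \tag{1}$$ with solution semigroup $S(t)$ on $H^{-1}$ (solutions are taken in $C([0,T];H^{-1})\cap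 L^2(0,T;H^1)$ for all $T>0$), and its equation of variations along a trajectory $u$, $$\partial_tv+A(Av+F'(u(t))v)=0. \tag{2}$$ Assume the strong cone condition: there are $\mu>0$ and a Borel function $\alpha:H\to\mathbb R$ with $0<\alpha_-\le\alpha(u)\le\alpha_+<\infty$ such that for every trajectory $u(t)\in H$, $t\in[0,T]$, of (1) and every solution $v$ of (2), $$\frac d{dt}V(v(t))+\alpha(u(t))V(v(t))\le-\mu\|v(t)\|_H^2 .$$ Assume also that for some $\delta>0$ and $C_F$ $$\|F(u_1)-F(u_2)-F'(u_1)(u_1-u_2)\|_H\le C_F\|u_1-u_2\|_H^{1+\delta}\qquad(u_1,u_2\in H).$$ Then (1) has an inertial manifold over $H_+$, that is, there is a Lipschitz map $\Phi:H_+\to H_-$ whose graph $\mathcal M=\{p+\Phi(p):p\in H_+\}$ satisfies $S(t)\mathcal M=\mathcal M$ for $t\ge0$ and has the exponential tracking property: there are $C,\kappa>0$ such that for every $\xi\in H^{-1}$ there is $\eta\in\mathcal M$ with $\|S(t)\xi-S(t)\eta\|_{H^{-1}}\le Ce^{-\kappa t}\|\xi-\eta\|_{H^{-1}}$ for all $t\ge0$.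 Moreover, for every such $\Phi$: 1. $\Phi$ is Fréchet differentiable at every point of $H_+$ (as a map $H_+\to H_-\subset H$), with derivative $\Phi'(p)\in\mathcal L(H_+,H_-)$. 2. $\Phi$ is $C^{1+\varepsilon}$-smooth: there are $\varepsilon>0$ and $C$ such that for all $u^1_+,u^2_+\in H_+$ $$\|\Phi(u^1_+)-\Phi(u^2_+)-\Phi'(u^1_+)(u^1_+-u^2_+)\|_{H^{-1}}\le C\|u^1_+-u^2_+\|_H^{1+\varepsilon}.$$ 3. For every $p\in H_+$ there is a trajectory $u(t)\in\mathcal M$, $t\le0$, of (1) with $u(0)=p+\Phi(p)$; and for every such trajectory and every $w_+\in H_+$ the problem $$\partial_tw+A^2w+AF'(u(t))w=0,\quad t\in[-T,0],\qquad P_Nw(0)=w_+,\quad Q_Nw(-T)=0$$ has a solution for every $T>0$, and for any choice of solutions $w_T$, $\Phi'(p)w_+=\lim_{T\to\infty}Q_Nw_T(0)$ in $H^{-1}$. -/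

import Mathlib

open Set Filter Topology MeasureTheory
open scoped InnerProductSpace

namespace CahnHilliard

variable {H : Type*} [NormedAddCommGroup H] [InnerProductSpace ℝ H]

/-- `A : D(A) → H` is a (densely defined) self-adjoint, positive linear operator with compact
inverse. -/
structure IsPositiveWithCompactInverse [CompleteSpace H] (A : H →ₗ.[ℝ] H) : Prop where
  dense_domain : Dense (A.domain : Set H)
  selfAdjoint : IsSelfAdjoint A
  positive : ∀ x : A.domain, x ≠ 0 → 0 < ⟪A x, (x : H)⟫_ℝ
  compact_inverse : ∃ R : H →L[ℝ] H, IsCompactOperator R ∧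
    (∀ x : A.domain, R (A x) = x) ∧ ∀ y : H, ∃ h : R y ∈ A.domain, A ⟨R y, h⟩ = y

/-- The orthonormal basis `e` consists of eigenvectors of `A`, numbered so that the eigenvalues
`lam 0 ≤ lam 1 ≤ …` are non-decreasing (the numbering starts at `0`). -/
structure IsEigenbasis (A : H →ₗ.[ℝ] H) (e : HilbertBasis ℕ ℝ H) (lam : ℕ → ℝ) : Prop where
  mono : Monotone lam
  eigen : ∀ n, ∃ h : e n ∈ A.domain, A ⟨e n, h⟩ = lam n • e n

/- The scale `H^s`, `s ∈ ℝ`.  An element is given by its Fourier coefficients `ξ : ℕ → ℝ` with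
respect to the eigenbasis: `H^s` is the space of all `ξ` with `∑ lam n ^ s * ξ n ^ 2 < ∞`.
For `s = 0` this is `H`, and for `s < 0` it is the completion of `H` in the `H^s` norm. -/

/-- Membership in `H^s`. -/
def MemHs (lam : ℕ → ℝ) (s : ℝ) (ξ : ℕ → ℝ) : Prop :=
  Summable fun n => lam n ^ s * ξ n ^ 2

/-- The norm of `H^s`. -/
noncomputable def normHs (lam : ℕ → ℝ) (s : ℝ) (ξ : ℕ → ℝ) : ℝ :=
  √(∑' n, lam n ^ s * ξ n ^ 2)

/-- The Fourier coefficients of `x ∈ H`. -/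
noncomputable def coeff (e : HilbertBasis ℕ ℝ H) (x : H) : ℕ → ℝ := fun n => ⟪e n, x⟫_ℝ

/-- The element `∑ ξ n • e n` of `H` with square-summable Fourier coefficients `ξ`. -/
noncomputable def toH (e : HilbertBasis ℕ ℝ H) (ξ : ℕ → ℝ) : H := ∑' n, ξ n • e n

theorem toH_coeff (e : HilbertBasis ℕ ℝ H) (x : H) : toH e (coeff e x) = x := by
  have h := (e.hasSum_repr x).tsum_eq
  simpa [toH, coeff, HilbertBasis.repr_apply_apply] using h

/-- `H₊ = P_N H`, the span of the first `N` eigenvectors. -/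
noncomputable def Hplus (e : HilbertBasis ℕ ℝ H) (N : ℕ) : Submodule ℝ H :=
  Submodule.span ℝ {x | ∃ n < N, x = e n}

/-- `H₋ = Q_N H`, the orthogonal complement of `H₊`. -/
noncomputable def Hminus (e : HilbertBasis ℕ ℝ H) (N : ℕ) : Submodule ℝ H := (Hplus e N)ᗮ

/-- The projector `P_N` to the first `N` modes, on Fourier coefficients. -/
def projP (N : ℕ) (ξ : ℕ → ℝ) : ℕ → ℝ := fun n => if n < N then ξ n else 0

/-- The projector `Q_N = Id - P_N`, on Fourier coefficients. -/
def projQ (N : ℕ) (ξ : ℕ → ℝ) : ℕ → ℝ := fun n => if n < N then 0 else ξ n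

/-- The quadratic form `V(ξ) = ‖Q_N ξ‖² - ‖P_N ξ‖²` (norms of `H^{-1}`). -/
noncomputable def coneForm (lam : ℕ → ℝ) (N : ℕ) (ξ : ℕ → ℝ) : ℝ :=
  normHs lam (-1) (projQ N ξ) ^ 2 - normHs lam (-1) (projP N ξ) ^ 2

/-- `u ∈ C([a,b]; H^{-1}) ∩ L²(a,b; H¹)` is a solution of `∂ₜ u + A² u + A g(t) = 0` on `[a,b]`.
The equation is tested with every eigenvector and integrated in time. -/
structure IsEnergySolution (lam : ℕ → ℝ) (u g : ℝ → ℕ → ℝ) (a b : ℝ) : Prop where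
  mem : ∀ t ∈ Icc a b, MemHs lam (-1) (u t)
  cont : ∀ t ∈ Icc a b,
    Tendsto (fun s => normHs lam (-1) (u s - u t)) (𝓝[Icc a b] t) (𝓝 0)
  mem_one : ∀ᵐ t ∂(volume.restrict (Icc a b)), MemHs lam 1 (u t)
  sq_integrable : IntegrableOn (fun t => normHs lam 1 (u t) ^ 2) (Icc a b)
  forcing_integrable : ∀ n, IntegrableOn (fun t => g t n) (Icc a b)
  equation : ∀ n, ∀ t ∈ Icc a b,
    u t n - u a n + ∫ r in a..t, (lam n ^ 2 * u r n + lam n * g r n) = 0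

/-- `u` solves `∂ₜ u + A² u + A F(u) = 0` on `[a,b]`. -/
def IsSolution (e : HilbertBasis ℕ ℝ H) (lam : ℕ → ℝ) (F : H → H)
    (u : ℝ → ℕ → ℝ) (a b : ℝ) : Prop :=
  IsEnergySolution lam u (fun t => coeff e (F (toH e (u t)))) a b

/-- `v` solves the equation of variations `∂ₜ v + A (A v + F'(u(t)) v) = 0` on `[a,b]`. -/
def IsVariationSolution (e : HilbertBasis ℕ ℝ H) (lam : ℕ → ℝ) (F' : H → H →L[ℝ] H)
    (u : ℝ → H) (v : ℝ → ℕ → ℝ) (a b : ℝ) : Prop :=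
  IsEnergySolution lam v (fun t => coeff e (F' (u t) (toH e (v t)))) a b

open Classical in
/-- The solution semigroup `S(t)` on `H^{-1}`: the value at time `t` of the solution on `[0,∞)`
that starts at `ξ`. -/
noncomputable def solutionMap (e : HilbertBasis ℕ ℝ H) (lam : ℕ → ℝ) (F : H → H)
    (t : ℝ) (ξ : ℕ → ℝ) : ℕ → ℝ :=
  if h : ∃ u : ℝ → ℕ → ℝ, u 0 = ξ ∧ ∀ T > 0, IsSolution e lam F u 0 T then h.choose t else 0

/-- `F : H → H` is globally bounded, `F'(u) ∈ L(H,H)` is its Gateaux derivative, with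
`‖F'(u)‖ ≤ L`, and the integral mean value theorem
`F(u₁) - F(u₂) = ∫₀¹ F'(s u₁ + (1-s) u₂) (u₁ - u₂) ds` holds. -/
structure IsAdmissible (F : H → H) (F' : H → H →L[ℝ] H) (L : ℝ) : Prop where
  bounded : ∃ C : ℝ, ∀ u, ‖F u‖ ≤ C
  gateaux : ∀ u h, HasLineDerivAt ℝ F (F' u h) u h
  deriv_bound : ∀ u, ‖F' u‖ ≤ L
  integrable : ∀ u₁ u₂ : H, IntervalIntegrable
    (fun s : ℝ => F' (s • u₁ + (1 - s) • u₂) (u₁ - u₂)) volume 0 1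
  mean_value : ∀ u₁ u₂ : H,
    F u₁ - F u₂ = ∫ s in (0 : ℝ)..1, F' (s • u₁ + (1 - s) • u₂) (u₁ - u₂)

/-- The strong cone condition in the differential form: along every trajectory `u(t) ∈ H`,
`t ∈ [0,T]`, and for every solution `v` of the equation of variations,
`d/dt V(v(t)) + α(u(t)) V(v(t)) ≤ -μ ‖v(t)‖²_H`.
At the end points of `[0,T]` the derivative is one-sided. -/
def StrongCone [MeasurableSpace H] (e : HilbertBasis ℕ ℝ H) (lam : ℕ → ℝ) (N : ℕ)
    (F : H → H) (F' : H → H →L[ℝ] H) : Prop :=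
  ∃ μ : ℝ, 0 < μ ∧ ∃ α : H → ℝ, Measurable α ∧
    (∃ αm αp : ℝ, 0 < αm ∧ ∀ u, αm ≤ α u ∧ α u ≤ αp) ∧
    ∀ T > 0, ∀ u : ℝ → H, ContinuousOn u (Icc 0 T) →
      IsSolution e lam F (fun t => coeff e (u t)) 0 T →
      ∀ v : ℝ → ℕ → ℝ, IsVariationSolution e lam F' u v 0 T →
      ∀ t ∈ Icc 0 T, MemHs lam 0 (v t) →
      ∀ D : ℝ, HasDerivWithinAt (fun s => coneForm lam N (v s)) D (Icc 0 T) t →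
        D + α (u t) * coneForm lam N (v t) ≤ -μ * normHs lam 0 (v t) ^ 2

/-- The graph `M = {p + Φ(p) : p ∈ H₊}`, as a set of Fourier coefficients. -/
def graphSet (e : HilbertBasis ℕ ℝ H) (N : ℕ) (Φ : Hplus e N → Hminus e N) : Set (ℕ → ℝ) :=
  range fun p : Hplus e N => coeff e ((p : H) + (Φ p : H))

/-- The graph of `Φ : H₊ → H₋` is an inertial manifold. -/
structure IsInertialManifold (e : HilbertBasis ℕ ℝ H) (lam : ℕ → ℝ) (F : H → H) (N : ℕ)
    (Φ : Hplus e N → Hminus e N) : Prop where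
  invariant : ∀ t, 0 ≤ t → solutionMap e lam F t '' graphSet e N Φ = graphSet e N Φ
  lipschitz : ∃ K, LipschitzWith K Φ
  tracking : ∃ C κ : ℝ, 0 < C ∧ 0 < κ ∧ ∀ ξ, MemHs lam (-1) ξ →
    ∃ η ∈ graphSet e N Φ, ∀ t, 0 ≤ t →
      normHs lam (-1) (solutionMap e lam F t ξ - solutionMap e lam F t η)
        ≤ C * Real.exp (-κ * t) * normHs lam (-1) (ξ - η)

/-- `u(t)`, `t ≤ 0`, is a trajectory on the graph of `Φ` with `P_N u(0) = p`. -/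
structure IsBackwardTrajectory (e : HilbertBasis ℕ ℝ H) (lam : ℕ → ℝ) (F : H → H) (N : ℕ)
    (Φ : Hplus e N → Hminus e N) (p : Hplus e N) (u : ℝ → H) : Prop where
  solution : ∀ T > 0, IsSolution e lam F (fun t => coeff e (u t)) (-T) 0
  on_graph : ∀ t ≤ 0, coeff e (u t) ∈ graphSet e N Φ
  endpoint : u 0 = (p : H) + (Φ p : H)

/-- `w` solves `∂ₜ w + A² w + A F'(u(t)) w = 0` on `[-T,0]` with `P_N w(0) = w₊` and
`Q_N w(-T) = 0`. -/
structure SolvesVariationBVP (e : HilbertBasis ℕ ℝ H) (lam : ℕ → ℝ) (F' : H → H →L[ℝ] H)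
    (N : ℕ) (u : ℝ → H) (wp : Hplus e N) (T : ℝ) (w : ℝ → ℕ → ℝ) : Prop where
  solution : IsVariationSolution e lam F' u w (-T) 0
  plus_end : projP N (w 0) = coeff e (wp : H)
  minus_start : projQ N (w (-T)) = 0

end CahnHilliard

/-! Everything rests on the cone inequality for V, read in two directions. It is first made
pointwise. If x has finitely many modes, then along the solution of (2) starting at x the form V is
differentiable at t = 0, because the part produced by the forcing contributes only O(t^{3/2}).
Density of such x gives the inequality for every u in H and x in H^1 (`cone_of_finite`,
`cone_of_summable`). Averaging over the segment between two states carries it over to differences of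
solutions of (1), with αV weakened to min(α₋V, α₊V) (`cone_diff_of_cone`).

Gronwall's inequality now has two consequences for such differences. The cone {V ≤ 0} is forward
invariant, and inside it the whole past is controlled by the low modes at the final time
(`ConeOrbit.integral_le_of_nonpos`). The set {V ≥ 0} is backward invariant, and V decays
exponentially there (`ConeOrbit.squeeze`). Time integrals of the H norm, which the term with μ
provides, become pointwise bounds through parabolic smoothing.

The manifold consists of the end points of trajectories on (-∞, 0] with bounded high modes. Two of
them differ by an element of the cone, so the low modes determine the point and depend on it in a
Lipschitz way. A point over p is found by starting in H₊ at time -kτ so as to reach the low modes p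
at time 0 (`exists_isCover_flow`). The solutions for different k agree in the low modes at 0, hence
lie outside the cone with respect to each other, and squeezing makes them converge. For tracking,
points of the manifold that share the low modes of S(k)ξ at time k are traced back to time 0, and a
subsequence converges. Conversely, boundedness of F and μ > 0 force a gap between `lam (N - 1)` and
`lam N`. Along a backward trajectory on a Lipschitz invariant graph the low modes then grow too
slowly to feed unbounded high modes, so every admissible graph is this same manifold
(`graph_eq_manifold`).

For smoothness the rate α(u(t)) is kept as it is. The weight θ(s) = exp(∫₀ˢ α(u)) serves both inside
and outside the cone, so α₋ and α₊ need not be compared. The term with μ buys an extra exponent ε =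
`ConeParams.rate`. Inside the cone the integral of θ e^{-εs} ‖v‖² is bounded by the low modes at 0
(`ConeParams.weighted_integral_le`). A solution with zero low modes at 0 is e^{-εT} times such an
integral, up to forcing errors (`ConeParams.exists_endpoint_bound`). Hence the boundary value
problems converge exponentially as T → ∞ and their limits define a linear operator D. For two
trajectories on the manifold with low-mode difference r at time 0, T is taken logarithmic in 1/‖r‖,
so that they stay close enough on [-T, 0] for μ to absorb the Taylor remainder of F. The error of
the linearization and the truncation error are then both O(‖r‖^{1+σ}) with σ = min(δ, ε/α₊)
(`exists_near_estimate`, `exists_holder_estimate`). Differentiability, the Hölder bound and the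
limit formula follow from this one estimate and the definition of D. -/

namespace CahnHilliard

/-! ### Absolutely continuous functions and Gronwall's inequality. -/

/-- `f` is a primitive of the integrable function `f'` on `[a,b]`. -/
structure IsPrimitive (f f' : ℝ → ℝ) (a b : ℝ) : Prop where
  intervalIntegrable : IntervalIntegrable f' volume a b
  eq : ∀ t ∈ Icc a b, f t = f a + ∫ r in a..t, f' r

namespace IsPrimitive

variable {f f' g g' : ℝ → ℝ} {a b c d : ℝ}

/-- The fundamental theorem of calculus for absolutely continuous functions; products and
exponentials of primitives are obtained through it. -/
theorem of_absolutelyContinuous (hab : a ≤ b) (hf : AbsolutelyContinuousOnInterval f a b)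
    (hd : ∀ᵐ t, t ∈ uIcc a b → HasDerivAt f (f' t) t) : IsPrimitive f f' a b := by
  have key : ∀ᵐ t, t ∈ uIoc a b → deriv f t = f' t := by
    filter_upwards [hd] with t ht h using (ht (uIoc_subset_uIcc h)).deriv
  refine ⟨(hf.intervalIntegrable_deriv).congr_ae ?_, fun t ht => ?_⟩
  · exact (ae_restrict_iff' measurableSet_uIoc).2 key
  · have hsub : uIcc a t ⊆ uIcc a b := by
      rw [uIcc_of_le ht.1, uIcc_of_le hab]; exact Icc_subset_Icc le_rfl ht.2
    have h1 := (hf.mono hsub).integral_deriv_eq_sub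
    have h2 : ∫ r in a..t, deriv f r = ∫ r in a..t, f' r := by
      apply intervalIntegral.integral_congr_ae
      filter_upwards [key] with r hr h
      refine hr ?_
      rw [uIoc_of_le ht.1] at h
      rw [uIoc_of_le hab]
      exact ⟨h.1, h.2.trans ht.2⟩
    linarith

theorem absolutelyContinuous (h : IsPrimitive f f' a b) :
    AbsolutelyContinuousOnInterval (fun t => f a + ∫ r in a..t, f' r) a b := by
  have h1 := h.intervalIntegrable.absolutelyContinuousOnInterval_intervalIntegral
    (c := a) left_mem_uIcc
  have h2 : AbsolutelyContinuousOnInterval (fun _ : ℝ => f a) a b :=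
    (LipschitzWith.const (f a)).lipschitzOnWith.absolutelyContinuousOnInterval
  exact h2.add h1

/-- The integral representative is differentiated rather than f, whose values outside [a,b] are
arbitrary. -/
theorem ae_hasDerivAt (h : IsPrimitive f f' a b) :
    ∀ᵐ t, t ∈ uIcc a b → HasDerivAt (fun t => f a + ∫ r in a..t, f' r) (f' t) t := by
  filter_upwards [h.intervalIntegrable.ae_hasDerivAt_integral] with t ht h1
  exact (ht h1 a left_mem_uIcc).const_add _

theorem congr (h : IsPrimitive f f' a b) (hab : a ≤ b) (hfg : ∀ t ∈ Icc a b, f t = g t) :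
    IsPrimitive g f' a b :=
  ⟨h.1, fun t ht => by rw [← hfg t ht, ← hfg a (left_mem_Icc.2 hab), h.2 t ht]⟩

theorem congr_deriv (h : IsPrimitive f f' a b) (hab : a ≤ b)
    (hfg : ∀ t ∈ Icc a b, f' t = g' t) : IsPrimitive f g' a b := by
  refine ⟨h.1.congr fun t ht => ?_, fun t ht => ?_⟩
  · rw [uIoc_of_le hab] at ht; exact hfg t ⟨ht.1.le, ht.2⟩
  · rw [h.2 t ht]
    congr 1
    apply intervalIntegral.integral_congr
    rw [uIcc_of_le ht.1]
    exact fun r hr => hfg r ⟨hr.1, hr.2.trans ht.2⟩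

theorem mono (h : IsPrimitive f f' a b) (hac : a ≤ c) (hcd : c ≤ d) (hdb : d ≤ b) :
    IsPrimitive f f' c d := by
  have h1 : IntervalIntegrable f' volume a c := h.1.mono_set (by
    rw [uIcc_of_le hac, uIcc_of_le (hac.trans (hcd.trans hdb))]
    exact Icc_subset_Icc le_rfl (hcd.trans hdb))
  have h2 : ∀ t ∈ Icc c d, IntervalIntegrable f' volume c t := fun t ht => h.1.mono_set (by
    rw [uIcc_of_le ht.1, uIcc_of_le (hac.trans (hcd.trans hdb))]
    exact Icc_subset_Icc hac (ht.2.trans hdb))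
  refine ⟨h2 d (right_mem_Icc.2 hcd), fun t ht => ?_⟩
  rw [h.2 t ⟨hac.trans ht.1, ht.2.trans hdb⟩, h.2 c ⟨hac, hcd.trans hdb⟩, add_assoc,
    intervalIntegral.integral_add_adjacent_intervals h1 (h2 t ht)]

theorem continuousOn (h : IsPrimitive f f' a b) (hab : a ≤ b) : ContinuousOn f (Icc a b) := by
  have := h.absolutelyContinuous.continuousOn
  rw [uIcc_of_le hab] at this
  exact this.congr h.2

theorem sub_eq (h : IsPrimitive f f' a b) (hab : a ≤ b) : f b - f a = ∫ r in a..b, f' r := by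
  rw [h.2 b (right_mem_Icc.2 hab)]; ring

theorem mul (hf : IsPrimitive f f' a b) (hg : IsPrimitive g g' a b) (hab : a ≤ b) :
    IsPrimitive (fun t => f t * g t) (fun t => f' t * g t + f t * g' t) a b := by
  have key := of_absolutelyContinuous (f' := fun t => f' t * (g a + ∫ r in a..t, g' r) +
    (f a + ∫ r in a..t, f' r) * g' t) hab (hf.absolutelyContinuous.mul hg.absolutelyContinuous) (by
    filter_upwards [hf.ae_hasDerivAt, hg.ae_hasDerivAt] with t h1 h2 ht
    exact (h1 ht).mul (h2 ht))
  refine (key.congr hab (fun t ht => ?_)).congr_deriv hab (fun t ht => ?_)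
  · simp only [Pi.mul_apply]; rw [← hf.2 t ht, ← hg.2 t ht]
  · rw [← hf.2 t ht, ← hg.2 t ht]

theorem const_mul (hf : IsPrimitive f f' a b) (k : ℝ) :
    IsPrimitive (fun t => k * f t) (fun t => k * f' t) a b := by
  refine ⟨hf.1.const_mul k, fun t ht => ?_⟩
  rw [hf.2 t ht, intervalIntegral.integral_const_mul]; ring

theorem sq (hf : IsPrimitive f f' a b) (hab : a ≤ b) :
    IsPrimitive (fun t => f t ^ 2) (fun t => 2 * f t * f' t) a b :=
  ((hf.mul hf hab).congr hab (fun t _ => by ring)).congr_deriv hab (fun t _ => by ring)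

theorem of_hasDerivAt (hf : ∀ t, HasDerivAt f (f' t) t) (hc : Continuous f') :
    IsPrimitive f f' a b := by
  refine ⟨hc.intervalIntegrable _ _, fun t _ => ?_⟩
  rw [intervalIntegral.integral_eq_sub_of_hasDerivAt (fun r _ => hf r) (hc.intervalIntegrable _ _)]
  ring

theorem exp (hf : IsPrimitive f f' a b) (hab : a ≤ b) :
    IsPrimitive (fun t => Real.exp (f t)) (fun t => f' t * Real.exp (f t)) a b := by
  set F : ℝ → ℝ := fun t => f a + ∫ r in a..t, f' r with hF
  have hac := hf.absolutelyContinuous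
  obtain ⟨R, hR⟩ := hac.exists_bound
  have hlip : ∀ x ∈ Icc (-R) R, ∀ y ∈ Icc (-R) R,
      |Real.exp x - Real.exp y| ≤ Real.exp R * |x - y| := by
    intro x hx y hy
    have := Convex.norm_image_sub_le_of_norm_hasDerivWithin_le (f := Real.exp) (f' := Real.exp)
      (s := Icc (-R) R) (C := Real.exp R) (x := y) (y := x)
      (fun z _ => (Real.hasDerivAt_exp z).hasDerivWithinAt)
      (fun z hz => by rw [Real.norm_eq_abs, abs_of_pos (Real.exp_pos _)]
                      exact Real.exp_le_exp.2 hz.2) (convex_Icc _ _) hy hx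
    simpa [Real.norm_eq_abs] using this
  have hmem : ∀ t ∈ uIcc a b, F t ∈ Icc (-R) R := fun t ht => abs_le.1 (hR t ht)
  -- The exponential is Lipschitz on the bounded range of F and so preserves absolute continuity.
  have hac' : AbsolutelyContinuousOnInterval (fun t => Real.exp (F t)) a b := by
    rw [absolutelyContinuousOnInterval_iff] at hac ⊢
    intro ε hε
    obtain ⟨δ, hδ, h⟩ := hac (ε / Real.exp R) (by positivity)
    refine ⟨δ, hδ, fun E hE hE' => ?_⟩
    have h1 := h E hE hE'
    rw [lt_div_iff₀ (Real.exp_pos R), mul_comm, Finset.mul_sum] at h1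
    refine lt_of_le_of_lt (Finset.sum_le_sum fun i hi => ?_) h1
    exact hlip _ (hmem _ (hE.1 i hi).1) _ (hmem _ (hE.1 i hi).2)
  have key := of_absolutelyContinuous (f' := fun t => f' t * Real.exp (F t)) hab hac' (by
    filter_upwards [hf.ae_hasDerivAt] with t h1 ht
    have := (h1 ht).exp
    rwa [mul_comm] at this)
  refine (key.congr hab (fun t ht => ?_)).congr_deriv hab (fun t ht => ?_)
  · simp only [hF]; rw [← hf.2 t ht]
  · simp only [hF]; rw [← hf.2 t ht]

theorem of_intervalIntegral (hab : a ≤ b) (h : IntervalIntegrable f' volume a b)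
    (hc : c ∈ Icc a b) : IsPrimitive (fun t => ∫ r in c..t, f' r) f' a b := by
  have hs : ∀ x ∈ Icc a b, ∀ y ∈ Icc a b, IntervalIntegrable f' volume x y := fun x hx y hy =>
    h.mono_set (by rw [uIcc_of_le hab]; exact ordConnected_Icc.uIcc_subset hx hy)
  refine ⟨h, fun t ht => ?_⟩
  rw [intervalIntegral.integral_add_adjacent_intervals (hs _ hc _ (left_mem_Icc.2 hab))
    (hs _ (left_mem_Icc.2 hab) _ ht)]

/-- Gronwall's inequality for a primitive, with an integrable rate. -/
theorem gronwall {X k β R : ℝ → ℝ} (hX : IsPrimitive X k a b) (hab : a ≤ b)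
    (hβ : IntervalIntegrable β volume a b) (hR : IntervalIntegrable R volume a b)
    (h : ∀ᵐ t, t ∈ Ioc a b → k t + β t * X t ≤ R t) :
    X b ≤ Real.exp (∫ s in b..a, β s) * X a +
      ∫ r in a..b, Real.exp (∫ s in b..r, β s) * R r := by
  -- The integrating factor is normalized to 1 at the right end, so the value there is X b itself.
  have hE := (of_intervalIntegral hab hβ (right_mem_Icc.2 hab)).exp hab
  have hp := (hE.mul hX hab)
  have h1 := hp.sub_eq hab
  have h2 : IntervalIntegrable (fun r => Real.exp (∫ s in b..r, β s) * R r) volume a b := by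
    apply hR.continuousOn_mul
    rw [uIcc_of_le hab]; exact hE.continuousOn hab
  have h3 : ∫ r in a..b, (β r * Real.exp (∫ s in b..r, β s) * X r +
      Real.exp (∫ s in b..r, β s) * k r) ≤ ∫ r in a..b, Real.exp (∫ s in b..r, β s) * R r := by
    apply intervalIntegral.integral_mono_ae_restrict hab hp.1 h2
    refine (ae_restrict_iff' measurableSet_Icc).2 ?_
    filter_upwards [h, (compl_mem_ae_iff.2 (measure_singleton a) : {a}ᶜ ∈ ae volume)]
      with r hr hra hr'
    have := hr ⟨lt_of_le_of_ne hr'.1 (Ne.symm hra), hr'.2⟩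
    have := mul_le_mul_of_nonneg_left this (Real.exp_pos (∫ s in b..r, β s)).le
    nlinarith
  simp only [intervalIntegral.integral_same, Real.exp_zero, one_mul] at h1
  linarith

end IsPrimitive

/-! ### Subintervals and termwise integration of series. -/

theorem intervalIntegrable_subinterval {E : Type*} [NormedAddCommGroup E] {f : ℝ → E}
    {a b c d : ℝ} (h : IntervalIntegrable f volume a b) (hac : a ≤ c) (hcd : c ≤ d) (hdb : d ≤ b) :
    IntervalIntegrable f volume c d :=
  h.mono_set (by
    rw [uIcc_of_le hcd, uIcc_of_le (hac.trans (hcd.trans hdb))]; exact Icc_subset_Icc hac hdb)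

theorem integral_mono_of_ae_Ioc {f g : ℝ → ℝ} {a b : ℝ} (hab : a ≤ b)
    (hf : IntervalIntegrable f volume a b) (hg : IntervalIntegrable g volume a b)
    (h : ∀ᵐ t, t ∈ Ioc a b → f t ≤ g t) : ∫ t in a..b, f t ≤ ∫ t in a..b, g t := by
  rw [intervalIntegral.integral_of_le hab, intervalIntegral.integral_of_le hab]
  exact integral_mono_ae hf.1 hg.1 ((ae_restrict_iff' measurableSet_Ioc).2 h)

theorem integral_mono_subinterval {f : ℝ → ℝ} {a b c d : ℝ} (hac : a ≤ c) (hcd : c ≤ d)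
    (hdb : d ≤ b) (hf : IntervalIntegrable f volume a b)
    (h : ∀ᵐ t, t ∈ Ioc a b → 0 ≤ f t) : ∫ t in c..d, f t ≤ ∫ t in a..b, f t := by
  apply intervalIntegral.integral_mono_interval hac hcd hdb _ hf
  exact (ae_restrict_iff' measurableSet_Ioc).2 h

/-- The series `∑ f t n` converges absolutely in `L¹(a,b)`. -/
structure SumInt (f : ℝ → ℕ → ℝ) (a b : ℝ) : Prop where
  integrable : ∀ n, IntervalIntegrable (fun t => f t n) volume a b
  summable : Summable fun n => ∫ t in a..b, |f t n|

namespace SumInt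

variable {f g : ℝ → ℕ → ℝ} {a b c d : ℝ}

theorem mono (h : SumInt f a b) (hac : a ≤ c) (hcd : c ≤ d) (hdb : d ≤ b) : SumInt f c d := by
  refine ⟨fun n => intervalIntegrable_subinterval (h.1 n) hac hcd hdb, ?_⟩
  refine Summable.of_nonneg_of_le (fun n => ?_) (fun n => ?_) h.2
  · exact intervalIntegral.integral_nonneg hcd fun _ _ => abs_nonneg _
  · exact integral_mono_subinterval hac hcd hdb (h.1 n).abs (ae_of_all _ fun _ _ => abs_nonneg _)

/-- Tonelli's theorem: sum and integral of the absolute values may be exchanged. -/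
theorem lintegral_ne_top (h : SumInt f a b) (hab : a ≤ b) :
    ∫⁻ t in Ioc a b, ∑' n, ‖f t n‖ₑ ≠ ⊤ := by
  rw [lintegral_tsum fun n => (h.1 n).1.1.enorm]
  have hi : ∀ n, ∫⁻ t in Ioc a b, ‖f t n‖ₑ = ENNReal.ofReal (∫ t in a..b, |f t n|) := by
    intro n
    rw [intervalIntegral.integral_of_le hab]
    exact (ofReal_integral_norm_eq_lintegral_enorm (h.1 n).1).symm
  simp_rw [hi]
  exact h.2.tsum_ofReal_ne_top

theorem ae_summable (h : SumInt f a b) (hab : a ≤ b) :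
    ∀ᵐ t, t ∈ Ioc a b → Summable (f t) := by
  have h1 := ae_lt_top' (AEMeasurable.tsum fun n => (h.1 n).1.1.enorm)
    (h.lintegral_ne_top hab)
  rw [ae_restrict_iff' measurableSet_Ioc] at h1
  filter_upwards [h1] with t ht hm
  have := ENNReal.tsum_coe_ne_top_iff_summable.1 (ht hm).ne
  exact Summable.of_nnnorm this

theorem intervalIntegrable_tsum (h : SumInt f a b) (hab : a ≤ b) :
    IntervalIntegrable (fun t => ∑' n, f t n) volume a b := by
  rw [intervalIntegrable_iff_integrableOn_Ioc_of_le hab]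
  have hs := (ae_restrict_iff' measurableSet_Ioc).2 (h.ae_summable hab)
  refine ⟨?_, ?_⟩
  · refine aestronglyMeasurable_of_tendsto_ae atTop
      (f := fun (m : ℕ) t => ∑ n ∈ Finset.range m, f t n) (fun m => ?_) ?_
    · exact Finset.aestronglyMeasurable_fun_sum _ fun n _ => (h.1 n).1.1
    · filter_upwards [hs] with t ht using ht.hasSum.tendsto_sum_nat
  · refine lt_of_le_of_lt (lintegral_mono fun t => ?_)
      (lt_top_iff_ne_top.2 (h.lintegral_ne_top hab))
    exact enorm_tsum_le_tsum_enorm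

theorem hasSum (h : SumInt f a b) (hab : a ≤ b) :
    HasSum (fun n => ∫ t in a..b, f t n) (∫ t in a..b, ∑' n, f t n) := by
  simp only [intervalIntegral.integral_of_le hab]
  refine hasSum_integral_of_summable_integral_norm (fun n => (h.1 n).1) ?_
  simpa only [intervalIntegral.integral_of_le hab, Real.norm_eq_abs] using h.2

theorem of_le (hf : ∀ n, AEStronglyMeasurable (fun t => f t n) (volume.restrict (Ioc a b)))
    (hg : SumInt g a b) (hab : a ≤ b)
    (h : ∀ n, ∀ᵐ t, t ∈ Ioc a b → |f t n| ≤ |g t n|) : SumInt f a b := by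
  have hi : ∀ n, IntervalIntegrable (fun t => f t n) volume a b := fun n => by
    rw [intervalIntegrable_iff_integrableOn_Ioc_of_le hab]
    exact Integrable.mono (hg.1 n).1 (hf n) ((ae_restrict_iff' measurableSet_Ioc).2 (h n))
  refine ⟨hi, Summable.of_nonneg_of_le (fun n => ?_) (fun n => ?_) hg.2⟩
  · exact intervalIntegral.integral_nonneg hab fun _ _ => abs_nonneg _
  · exact integral_mono_of_ae_Ioc hab (hi n).abs (hg.1 n).abs (h n)

theorem add (hf : SumInt f a b) (hg : SumInt g a b) (hab : a ≤ b) :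
    SumInt (fun t n => f t n + g t n) a b := by
  have hi := fun n => (hf.1 n).add (hg.1 n)
  refine ⟨hi, Summable.of_nonneg_of_le (fun n => ?_) (fun n => ?_) (hf.2.add hg.2)⟩
  · exact intervalIntegral.integral_nonneg hab fun _ _ => abs_nonneg _
  · rw [← intervalIntegral.integral_add (hf.1 n).abs (hg.1 n).abs]
    exact intervalIntegral.integral_mono_on hab (hi n).abs ((hf.1 n).abs.add (hg.1 n).abs)
      fun t _ => abs_add_le _ _

theorem const_mul (hf : SumInt f a b) (k : ℝ) : SumInt (fun t n => k * f t n) a b := by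
  refine ⟨fun n => (hf.1 n).const_mul k, ?_⟩
  simp only [abs_mul, intervalIntegral.integral_const_mul]
  exact hf.2.mul_left _

theorem of_ae_bound {G : ℝ → ℝ} (hab : a ≤ b)
    (hf : ∀ n, AEStronglyMeasurable (fun t => f t n) (volume.restrict (Ioc a b)))
    (hG : IntervalIntegrable G volume a b)
    (hs : ∀ᵐ t, t ∈ Ioc a b → Summable (fun n => |f t n|) ∧ ∑' n, |f t n| ≤ G t) :
    SumInt f a b := by
  have hi : ∀ n, IntervalIntegrable (fun t => f t n) volume a b := fun n => by
    rw [intervalIntegrable_iff_integrableOn_Ioc_of_le hab]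
    refine Integrable.mono' hG.1 (hf n) ((ae_restrict_iff' measurableSet_Ioc).2 ?_)
    filter_upwards [hs] with t ht hm
    exact ((ht hm).1.le_tsum n fun _ _ => abs_nonneg _).trans (ht hm).2
  refine ⟨hi, summable_of_sum_le (c := ∫ t in a..b, G t) (fun n => ?_) (fun u => ?_)⟩
  · exact intervalIntegral.integral_nonneg hab fun _ _ => abs_nonneg _
  · rw [← intervalIntegral.integral_finsetSum fun n _ => (hi n).abs]
    refine integral_mono_of_ae_Ioc hab ?_ hG ?_
    · simpa only [Finset.sum_fn] using IntervalIntegrable.sum u fun n _ => (hi n).abs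
    filter_upwards [hs] with t ht hm
    exact ((ht hm).1.sum_le_tsum u fun _ _ => abs_nonneg _).trans (ht hm).2

end SumInt

/-! ### Solutions of the linear equation, mode by mode. -/

/-- The eigenvalues are positive and non-decreasing. -/
structure IsSpectrum (lam : ℕ → ℝ) : Prop where
  zero_pos : 0 < lam 0
  mono : Monotone lam

namespace IsSpectrum
variable {lam : ℕ → ℝ}
theorem pos (h : IsSpectrum lam) (n : ℕ) : 0 < lam n := h.zero_pos.trans_le (h.mono n.zero_le)
theorem le (h : IsSpectrum lam) (n : ℕ) : lam 0 ≤ lam n := h.mono n.zero_le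
theorem inv_le (h : IsSpectrum lam) (n : ℕ) : (lam n)⁻¹ ≤ (lam 0)⁻¹ :=
  inv_anti₀ h.zero_pos (h.le n)
end IsSpectrum

/-- The square of the norm of `H^{-1}`. -/
noncomputable def negSq (lam : ℕ → ℝ) (ξ : ℕ → ℝ) : ℝ := ∑' n, (lam n)⁻¹ * ξ n ^ 2

/-- The square of the norm of `H`. -/
noncomputable def zeroSq (ξ : ℕ → ℝ) : ℝ := ∑' n, ξ n ^ 2

/-- The square of the norm of `H^1`. -/
noncomputable def oneSq (lam : ℕ → ℝ) (ξ : ℕ → ℝ) : ℝ := ∑' n, lam n * ξ n ^ 2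

/-- The diagonal quadratic form on `H^{-1}` with weights `c`. -/
noncomputable def wForm (lam c : ℕ → ℝ) (ξ : ℕ → ℝ) : ℝ := ∑' n, c n * ((lam n)⁻¹ * ξ n ^ 2)

/-- The time derivative of `wForm lam c` at the state `ξ` under the forcing `γ`. -/
noncomputable def wRate (lam c : ℕ → ℝ) (ξ γ : ℕ → ℝ) : ℝ :=
  ∑' n, c n * (-2 * (lam n * ξ n ^ 2) - 2 * (γ n * ξ n))

theorem negSq_nonneg {lam : ℕ → ℝ} (hl : IsSpectrum lam) (ξ : ℕ → ℝ) : 0 ≤ negSq lam ξ :=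
  tsum_nonneg fun n => mul_nonneg (inv_nonneg.2 (hl.pos n).le) (sq_nonneg _)

theorem zeroSq_nonneg (ξ : ℕ → ℝ) : 0 ≤ zeroSq ξ := tsum_nonneg fun _ => sq_nonneg _

theorem oneSq_nonneg {lam : ℕ → ℝ} (hl : IsSpectrum lam) (ξ : ℕ → ℝ) : 0 ≤ oneSq lam ξ :=
  tsum_nonneg fun n => mul_nonneg (hl.pos n).le (sq_nonneg _)

/-- A solution, mode by mode, of `∂ₜ v + A² v + A g = 0` on `[a,b]` with `g ∈ L²(a,b;H)` and
`v(a) ∈ H^{-1}`. -/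
structure Orbit (lam : ℕ → ℝ) (v g : ℝ → ℕ → ℝ) (a b : ℝ) : Prop where
  le : a ≤ b
  mode : ∀ n, IsPrimitive (fun t => v t n) (fun t => -(lam n ^ 2 * v t n + lam n * g t n)) a b
  forcing : ∀ n, IntervalIntegrable (fun t => g t n) volume a b
  sq_forcing : SumInt (fun t n => g t n ^ 2) a b
  init : Summable fun n => (lam n)⁻¹ * v a n ^ 2

namespace Orbit

variable {lam c : ℕ → ℝ} {v g v' g' : ℝ → ℕ → ℝ} {a b s t : ℝ}

theorem continuousOn (h : Orbit lam v g a b) (n : ℕ) : ContinuousOn (fun t => v t n) (Icc a b) :=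
  (h.mode n).continuousOn h.le

theorem intervalIntegrable_sq (h : Orbit lam v g a b) (n : ℕ) :
    IntervalIntegrable (fun t => v t n ^ 2) volume a b := by
  apply ContinuousOn.intervalIntegrable
  rw [uIcc_of_le h.le]; exact (h.continuousOn n).pow 2

theorem intervalIntegrable_mul (h : Orbit lam v g a b) (n : ℕ) :
    IntervalIntegrable (fun t => g t n * v t n) volume a b := by
  apply (h.forcing n).mul_continuousOn
  rw [uIcc_of_le h.le]; exact h.continuousOn n

theorem mode_sq (h : Orbit lam v g a b) (n : ℕ) (k : ℝ) :
    IsPrimitive (fun t => k * v t n ^ 2)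
      (fun t => k * (-2 * (lam n ^ 2 * v t n ^ 2) - 2 * (lam n * (g t n * v t n)))) a b :=
  ((((h.mode n).sq h.le).const_mul k)).congr_deriv h.le fun t _ => by ring

/-- Completing the square: the derivative of λ⁻¹v² equals λ⁻¹g² - λv² - λ⁻¹(λv + g)². Being an
estimate for a single mode, it shows that the sums over modes converge before any energy identity is
available. -/
theorem neg_mode_le (hl : IsSpectrum lam) (h : Orbit lam v g a b) (n : ℕ) (hs : a ≤ s)
    (hst : s ≤ t) (ht : t ≤ b) :
    (lam n)⁻¹ * v t n ^ 2 + ∫ r in s..t, lam n * v r n ^ 2 ≤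
      (lam n)⁻¹ * v s n ^ 2 + ∫ r in s..t, (lam n)⁻¹ * g r n ^ 2 := by
  have hp := hl.pos n
  have h1 := ((h.mode_sq n (lam n)⁻¹).mono hs hst ht)
  have i1 : IntervalIntegrable (fun r => lam n * v r n ^ 2) volume s t :=
    (intervalIntegrable_subinterval (h.intervalIntegrable_sq n) hs hst ht).const_mul _
  have i2 : IntervalIntegrable (fun r => (lam n)⁻¹ * g r n ^ 2) volume s t :=
    (intervalIntegrable_subinterval (h.sq_forcing.1 n) hs hst ht).const_mul _
  have h2 := intervalIntegral.integral_mono_on hst h1.1 (i2.sub i1) (fun r _ => by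
    have e : (lam n)⁻¹ * (-2 * (lam n ^ 2 * v r n ^ 2) - 2 * (lam n * (g r n * v r n))) =
      (lam n)⁻¹ * g r n ^ 2 - lam n * v r n ^ 2 - (lam n)⁻¹ * (lam n * v r n + g r n) ^ 2 := by
      field_simp; ring
    rw [e]
    have : 0 ≤ (lam n)⁻¹ * (lam n * v r n + g r n) ^ 2 := by positivity
    linarith)
  rw [intervalIntegral.integral_sub i2 i1, ← h1.sub_eq hst] at h2
  linarith

/-- The dissipation absorbs the cross term, -2λ²v² - 2λgv ≤ g²/2, with a bound that does not depend
on λ. -/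
theorem zero_mode_le (h : Orbit lam v g a b) (n : ℕ) (hs : a ≤ s)
    (hst : s ≤ t) (ht : t ≤ b) :
    v t n ^ 2 ≤ v s n ^ 2 + ∫ r in s..t, 2⁻¹ * g r n ^ 2 := by
  have h1 := ((h.mode_sq n 1).mono hs hst ht)
  have i2 : IntervalIntegrable (fun r => 2⁻¹ * g r n ^ 2) volume s t :=
    (intervalIntegrable_subinterval (h.sq_forcing.1 n) hs hst ht).const_mul _
  have h2 := intervalIntegral.integral_mono_on hst h1.1 i2 (fun r _ => by
    nlinarith [sq_nonneg (2 * (lam n * v r n) + g r n)])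
  rw [← h1.sub_eq hst] at h2
  linarith

theorem sumInt_one (hl : IsSpectrum lam) (h : Orbit lam v g a b) :
    SumInt (fun t n => lam n * v t n ^ 2) a b := by
  refine ⟨fun n => (h.intervalIntegrable_sq n).const_mul _, ?_⟩
  have hb : Summable fun n => (lam n)⁻¹ * v a n ^ 2 + (lam 0)⁻¹ * ∫ r in a..b, |g r n ^ 2| :=
    h.init.add (h.sq_forcing.2.mul_left _)
  refine Summable.of_nonneg_of_le (fun n => ?_) (fun n => ?_) hb
  · exact intervalIntegral.integral_nonneg h.le fun _ _ => abs_nonneg _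
  · have h1 := h.neg_mode_le hl n le_rfl h.le le_rfl
    have hp := hl.pos n
    have h2 : ∀ r, |lam n * v r n ^ 2| = lam n * v r n ^ 2 := fun r =>
      abs_of_nonneg (mul_nonneg hp.le (sq_nonneg _))
    simp only [h2, abs_sq]
    rw [intervalIntegral.integral_const_mul (lam n)⁻¹] at h1
    have h3 : 0 ≤ (lam n)⁻¹ * v b n ^ 2 := mul_nonneg (inv_nonneg.2 hp.le) (sq_nonneg _)
    have h4 : (lam n)⁻¹ * ∫ r in a..b, g r n ^ 2 ≤ (lam 0)⁻¹ * ∫ r in a..b, g r n ^ 2 :=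
      mul_le_mul_of_nonneg_right (hl.inv_le n)
        (intervalIntegral.integral_nonneg h.le fun _ _ => sq_nonneg _)
    linarith

/-- A summable majorant of `(lam n)⁻¹ * v t n ^ 2`, uniform in `t`. -/
theorem exists_summable_bound (hl : IsSpectrum lam) (h : Orbit lam v g a b) :
    ∃ B : ℕ → ℝ, Summable B ∧ ∀ t ∈ Icc a b, ∀ n, (lam n)⁻¹ * v t n ^ 2 ≤ B n := by
  refine ⟨fun n => (lam n)⁻¹ * v a n ^ 2 + (lam 0)⁻¹ * ∫ r in a..b, |g r n ^ 2|,
    h.init.add (h.sq_forcing.2.mul_left _), fun t ht n => ?_⟩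
  have h1 := h.neg_mode_le hl n le_rfl ht.1 ht.2
  have hp := hl.pos n
  rw [intervalIntegral.integral_const_mul (lam n)⁻¹] at h1
  have h3 : 0 ≤ ∫ r in a..t, lam n * v r n ^ 2 :=
    intervalIntegral.integral_nonneg ht.1 fun _ _ => mul_nonneg hp.le (sq_nonneg _)
  have h5 : ∫ r in a..t, g r n ^ 2 ≤ ∫ r in a..b, g r n ^ 2 :=
    integral_mono_subinterval le_rfl ht.1 ht.2 (h.sq_forcing.1 n)
      (ae_of_all _ fun _ _ => sq_nonneg _)
  have h4 : (lam n)⁻¹ * ∫ r in a..t, g r n ^ 2 ≤ (lam 0)⁻¹ * ∫ r in a..b, g r n ^ 2 :=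
    mul_le_mul (hl.inv_le n) h5
      (intervalIntegral.integral_nonneg ht.1 fun _ _ => sq_nonneg _) (inv_nonneg.2 hl.zero_pos.le)
  simp only [abs_sq]
  linarith

theorem mem_neg (hl : IsSpectrum lam) (h : Orbit lam v g a b) (ht : t ∈ Icc a b) :
    Summable fun n => (lam n)⁻¹ * v t n ^ 2 := by
  obtain ⟨B, hB, hb⟩ := h.exists_summable_bound hl
  exact Summable.of_nonneg_of_le
    (fun n => mul_nonneg (inv_nonneg.2 (hl.pos n).le) (sq_nonneg _)) (hb t ht) hB

theorem tendsto_negSq (hl : IsSpectrum lam) (h : Orbit lam v g a b) (ht : t ∈ Icc a b) :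
    Tendsto (fun s => negSq lam (v s - v t)) (𝓝[Icc a b] t) (𝓝 0) := by
  obtain ⟨B, hB, hb⟩ := h.exists_summable_bound hl
  have : (0 : ℝ) = ∑' _ : ℕ, (0 : ℝ) := by simp
  rw [this]
  refine tendsto_tsum_of_dominated_convergence (hB.mul_left 4) (fun n => ?_) ?_
  · have h1 : ContinuousWithinAt (fun s => (lam n)⁻¹ * (v s n - v t n) ^ 2) (Icc a b) t :=
      (((h.continuousOn n t ht).sub continuousWithinAt_const).pow 2).const_mul _
    have h2 := h1.tendsto
    simpa using h2
  · filter_upwards [self_mem_nhdsWithin] with s hs n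
    have hp := inv_pos.2 (hl.pos n)
    rw [Real.norm_eq_abs, abs_of_nonneg (mul_nonneg hp.le (sq_nonneg _))]
    have h1 := hb s hs n
    have h2 := hb t ht n
    simp only [Pi.sub_apply]
    have h3 : (v s n - v t n) ^ 2 ≤ 2 * v s n ^ 2 + 2 * v t n ^ 2 := by
      nlinarith [sq_nonneg (v s n + v t n)]
    have h4 := mul_le_mul_of_nonneg_left h3 hp.le
    have h5 : 0 ≤ (lam n)⁻¹ * v t n ^ 2 := mul_nonneg hp.le (sq_nonneg _)
    linarith

theorem mono (hl : IsSpectrum lam) (h : Orbit lam v g a b) (hs : a ≤ s) (hst : s ≤ t)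
    (ht : t ≤ b) : Orbit lam v g s t :=
  ⟨hst, fun n => (h.mode n).mono hs hst ht,
    fun n => intervalIntegrable_subinterval (h.forcing n) hs hst ht, h.sq_forcing.mono hs hst ht,
    h.mem_neg hl ⟨hs, hst.trans ht⟩⟩

/-- Young's inequality with weights λ and λ⁻¹ bounds each term by 3λv² + λ₀⁻¹g², whose sum is
integrable. -/
theorem sumInt_rate (hl : IsSpectrum lam) (h : Orbit lam v g a b) (hc : ∀ n, |c n| ≤ 1) :
    SumInt (fun t n => c n * (-2 * (lam n * v t n ^ 2) - 2 * (g t n * v t n))) a b := by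
  have h1 := ((h.sumInt_one hl).const_mul 3).add (h.sq_forcing.const_mul (lam 0)⁻¹) h.le
  refine SumInt.of_le (fun n => ?_) h1 h.le fun n => ae_of_all _ fun t _ => ?_
  · exact (((((h.intervalIntegrable_sq n).const_mul (lam n)).const_mul (-2)).sub
      ((h.intervalIntegrable_mul n).const_mul 2)).const_mul (c n)).1.1
  · have hp := hl.pos n
    have e1 : (lam n)⁻¹ * g t n ^ 2 ≤ (lam 0)⁻¹ * g t n ^ 2 :=
      mul_le_mul_of_nonneg_right (hl.inv_le n) (sq_nonneg _)
    have e2 : 2 * |g t n * v t n| ≤ lam n * v t n ^ 2 + (lam n)⁻¹ * g t n ^ 2 := by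
      rw [abs_mul]
      have : lam n * v t n ^ 2 + (lam n)⁻¹ * g t n ^ 2 - 2 * (|g t n| * |v t n|) =
        (lam n)⁻¹ * (lam n * |v t n| - |g t n|) ^ 2 := by
        field_simp; rw [← sq_abs (v t n), ← sq_abs (g t n)]; ring
      have : 0 ≤ (lam n)⁻¹ * (lam n * |v t n| - |g t n|) ^ 2 := by positivity
      linarith
    have e3 : 0 ≤ lam n * v t n ^ 2 := by positivity
    have e4 : 0 ≤ (lam n)⁻¹ * g t n ^ 2 := by positivity
    rw [abs_mul, abs_of_nonneg (a := 3 * (lam n * v t n ^ 2) + (lam 0)⁻¹ * g t n ^ 2) (by linarith)]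
    have e5 : |(-2 * (lam n * v t n ^ 2) - 2 * (g t n * v t n))| ≤
        2 * (lam n * v t n ^ 2) + 2 * |g t n * v t n| := by
      refine (abs_sub _ _).trans ?_
      rw [abs_mul (-2), abs_of_nonneg e3, abs_mul 2]; norm_num
    calc _ ≤ 1 * |(-2 * (lam n * v t n ^ 2) - 2 * (g t n * v t n))| :=
          mul_le_mul_of_nonneg_right (hc n) (abs_nonneg _)
      _ ≤ _ := by linarith

/-- The energy identity. -/
theorem isPrimitive_wForm (hl : IsSpectrum lam) (h : Orbit lam v g a b) (hc : ∀ n, |c n| ≤ 1) :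
    IsPrimitive (fun t => wForm lam c (v t)) (fun t => wRate lam c (v t) (g t)) a b := by
  have hs := h.sumInt_rate hl hc
  refine ⟨hs.intervalIntegrable_tsum h.le, fun t ht => ?_⟩
  have hsum : ∀ r ∈ Icc a b, Summable fun n => c n * ((lam n)⁻¹ * v r n ^ 2) := fun r hr => by
    refine Summable.of_norm_bounded (h.mem_neg hl hr) fun n => ?_
    have : 0 ≤ (lam n)⁻¹ * v r n ^ 2 := mul_nonneg (inv_nonneg.2 (hl.pos n).le) (sq_nonneg _)
    rw [Real.norm_eq_abs, abs_mul, abs_of_nonneg this]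
    exact mul_le_of_le_one_left this (hc n)
  have h1 := ((hs.mono le_rfl ht.1 ht.2).hasSum ht.1)
  have h2 : ∀ n, ∫ r in a..t, c n * (-2 * (lam n * v r n ^ 2) - 2 * (g r n * v r n)) =
      c n * ((lam n)⁻¹ * v t n ^ 2) - c n * ((lam n)⁻¹ * v a n ^ 2) := fun n => by
    have h3 := ((h.mode_sq n (c n * (lam n)⁻¹)).mono le_rfl ht.1 ht.2).sub_eq ht.1
    have hp := (hl.pos n).ne'
    have h4 : ∀ r, c n * (lam n)⁻¹ * (-2 * (lam n ^ 2 * v r n ^ 2) -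
        2 * (lam n * (g r n * v r n))) =
        c n * (-2 * (lam n * v r n ^ 2) - 2 * (g r n * v r n)) := fun r => by
      field_simp
    simp only [h4] at h3
    rw [← h3]; ring
  simp only [h2] at h1
  have h5 := h1.unique ((hsum t ht).hasSum.sub (hsum a (left_mem_Icc.2 h.le)).hasSum)
  simp only [wRate, wForm]
  rw [h5]; ring

/-- The estimate starts at any time s at which the state lies in H, since the initial state is only
known to lie in H^{-1}. -/
theorem zeroSq_le (h : Orbit lam v g a b) (hs : Summable fun n => v s n ^ 2)
    (has : a ≤ s) (hst : s ≤ t) (htb : t ≤ b) :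
    (Summable fun n => v t n ^ 2) ∧
      zeroSq (v t) ≤ zeroSq (v s) + 2⁻¹ * ∫ r in s..t, zeroSq (g r) := by
  have h1 := ((h.sq_forcing.mono has hst htb).hasSum hst).mul_left (2⁻¹ : ℝ)
  have h2 : ∀ n, v t n ^ 2 ≤ v s n ^ 2 + 2⁻¹ * ∫ r in s..t, g r n ^ 2 := fun n => by
    rw [← intervalIntegral.integral_const_mul]; exact h.zero_mode_le n has hst htb
  have h3 := Summable.of_nonneg_of_le (fun n => sq_nonneg _) h2 (hs.add h1.summable)
  refine ⟨h3, ?_⟩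
  exact hasSum_le h2 h3.hasSum (hs.hasSum.add h1)

theorem ae_summable_one (hl : IsSpectrum lam) (h : Orbit lam v g a b) :
    ∀ᵐ t, t ∈ Ioc a b → Summable fun n => lam n * v t n ^ 2 :=
  (h.sumInt_one hl).ae_summable h.le

theorem ae_summable_forcing (h : Orbit lam v g a b) :
    ∀ᵐ t, t ∈ Ioc a b → Summable fun n => g t n ^ 2 :=
  h.sq_forcing.ae_summable h.le

theorem sumInt_zero (hl : IsSpectrum lam) (h : Orbit lam v g a b) :
    SumInt (fun t n => v t n ^ 2) a b := by
  refine SumInt.of_le (fun n => (h.intervalIntegrable_sq n).1.1)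
    ((h.sumInt_one hl).const_mul (lam 0)⁻¹) h.le fun n => ae_of_all _ fun t _ => ?_
  have hp := hl.zero_pos
  rw [abs_of_nonneg (sq_nonneg _), abs_of_nonneg (mul_nonneg (inv_nonneg.2 hp.le)
    (mul_nonneg (hl.pos n).le (sq_nonneg _))), inv_mul_eq_div, le_div_iff₀ hp, mul_comm]
  exact mul_le_mul_of_nonneg_right (hl.le n) (sq_nonneg _)

theorem intervalIntegrable_zeroSq (hl : IsSpectrum lam) (h : Orbit lam v g a b) :
    IntervalIntegrable (fun t => zeroSq (v t)) volume a b :=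
  (h.sumInt_zero hl).intervalIntegrable_tsum h.le

theorem intervalIntegrable_oneSq (hl : IsSpectrum lam) (h : Orbit lam v g a b) :
    IntervalIntegrable (fun t => oneSq lam (v t)) volume a b :=
  (h.sumInt_one hl).intervalIntegrable_tsum h.le

theorem intervalIntegrable_forcing (h : Orbit lam v g a b) :
    IntervalIntegrable (fun t => zeroSq (g t)) volume a b :=
  h.sq_forcing.intervalIntegrable_tsum h.le

end Orbit

/-! ### Translations and combinations of orbits, and smoothing from H^{-1} to H. -/

namespace IsPrimitive
variable {f f' g g' : ℝ → ℝ} {a b : ℝ}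

theorem comp_add_right (h : IsPrimitive f f' a b) (τ : ℝ) :
    IsPrimitive (fun t => f (t + τ)) (fun t => f' (t + τ)) (a - τ) (b - τ) := by
  refine ⟨?_, fun t ht => ?_⟩
  · simpa using h.1.comp_add_right τ
  · rw [intervalIntegral.integral_comp_add_right (fun r => f' r), sub_add_cancel]
    exact h.2 (t + τ) ⟨by linarith [ht.1], by linarith [ht.2]⟩

theorem add (hf : IsPrimitive f f' a b) (hg : IsPrimitive g g' a b) :
    IsPrimitive (fun t => f t + g t) (fun t => f' t + g' t) a b := by
  refine ⟨hf.1.add hg.1, fun t ht => ?_⟩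
  have hab : a ≤ b := ht.1.trans ht.2
  rw [intervalIntegral.integral_add (intervalIntegrable_subinterval hf.1 le_rfl ht.1 ht.2)
    (intervalIntegrable_subinterval hg.1 le_rfl ht.1 ht.2), hf.2 t ht, hg.2 t ht]
  ring

theorem congr_deriv_ae (h : IsPrimitive f f' a b) (hab : a ≤ b)
    (hfg : ∀ᵐ t, t ∈ Ioc a b → f' t = g' t) : IsPrimitive f g' a b := by
  refine ⟨h.1.congr_ae ?_, fun t ht => ?_⟩
  · rw [uIoc_of_le hab]; exact (ae_restrict_iff' measurableSet_Ioc).2 hfg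
  · rw [h.2 t ht]
    congr 1
    apply intervalIntegral.integral_congr_ae
    rw [uIoc_of_le ht.1]
    filter_upwards [hfg] with r hr h1 using hr ⟨h1.1, h1.2.trans ht.2⟩

theorem gronwall_const {X k R : ℝ → ℝ} {β : ℝ} (hX : IsPrimitive X k a b) (hab : a ≤ b)
    (hR : IntervalIntegrable R volume a b)
    (h : ∀ᵐ t, t ∈ Ioc a b → k t + β * X t ≤ R t) :
    X b ≤ Real.exp (-(β * (b - a))) * X a + ∫ r in a..b, Real.exp (-(β * (b - r))) * R r := by
  have := hX.gronwall (β := fun _ => β) hab intervalIntegrable_const hR h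
  simp only [intervalIntegral.integral_const, smul_eq_mul] at this
  convert this using 4
  · ring_nf
  · congr 1; ring_nf

end IsPrimitive

theorem sq_lin_le (x y p q : ℝ) :
    (x * p + y * q) ^ 2 ≤ 2 * x ^ 2 * p ^ 2 + 2 * y ^ 2 * q ^ 2 := by
  nlinarith [sq_nonneg (x * p - y * q)]

namespace Orbit

variable {lam c : ℕ → ℝ} {v g v' g' : ℝ → ℕ → ℝ} {a b s t : ℝ}

theorem congr_forcing (h : Orbit lam v g a b)
    (hg : ∀ n, ∀ᵐ t, t ∈ Ioc a b → g t n = g' t n) : Orbit lam v g' a b := by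
  have hi : ∀ n, IntervalIntegrable (fun t => g' t n) volume a b := fun n => by
    refine (h.forcing n).congr_ae ?_
    rw [uIoc_of_le h.le]; exact (ae_restrict_iff' measurableSet_Ioc).2 (hg n)
  refine ⟨h.le, fun n => (h.mode n).congr_deriv_ae h.le ?_, hi, ?_, h.init⟩
  · filter_upwards [hg n] with t ht h1
    rw [ht h1]
  · refine SumInt.of_le (fun n => (hi n).1.1.pow 2) h.sq_forcing h.le fun n => ?_
    filter_upwards [hg n] with t ht h1
    rw [ht h1]

theorem congr (h : Orbit lam v g a b) (hv : ∀ t ∈ Icc a b, v t = v' t) : Orbit lam v' g a b :=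
  ⟨h.le, fun n => ((h.mode n).congr h.le fun t ht => by rw [hv t ht]).congr_deriv h.le
    fun t ht => by rw [hv t ht], h.forcing, h.sq_forcing, by
      rw [← hv a (left_mem_Icc.2 h.le)]; exact h.init⟩

theorem lin (hl : IsSpectrum lam) (h : Orbit lam v g a b) (h' : Orbit lam v' g' a b) (x y : ℝ) :
    Orbit lam (fun t n => x * v t n + y * v' t n) (fun t n => x * g t n + y * g' t n) a b := by
  have hi := fun n => ((h.forcing n).const_mul x).add ((h'.forcing n).const_mul y)
  refine ⟨h.le, fun n => ?_, hi, ?_, ?_⟩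
  · exact (((h.mode n).const_mul x).add ((h'.mode n).const_mul y)).congr_deriv h.le
      fun t _ => by ring
  · refine SumInt.of_le (fun n => (hi n).1.1.pow 2) ((h.sq_forcing.const_mul (2 * x ^ 2)).add
      (h'.sq_forcing.const_mul (2 * y ^ 2)) h.le) h.le fun n => ae_of_all _ fun t _ => ?_
    rw [abs_of_nonneg (sq_nonneg _)]
    exact (sq_lin_le _ _ _ _).trans (le_abs_self _)
  · refine Summable.of_nonneg_of_le
      (fun n => mul_nonneg (inv_nonneg.2 (hl.pos n).le) (sq_nonneg _)) (fun n => ?_)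
      ((h.init.mul_left (2 * x ^ 2)).add (h'.init.mul_left (2 * y ^ 2)))
    have := mul_le_mul_of_nonneg_left (sq_lin_le x y (v a n) (v' a n)) (inv_nonneg.2 (hl.pos n).le)
    linarith

theorem sub (hl : IsSpectrum lam) (h : Orbit lam v g a b) (h' : Orbit lam v' g' a b) :
    Orbit lam (fun t => v t - v' t) (fun t => g t - g' t) a b := by
  have := h.lin hl h' 1 (-1)
  convert this using 3 <;> simp [sub_eq_add_neg]

theorem shift (h : Orbit lam v g a b) (τ : ℝ) :
    Orbit lam (fun t => v (t + τ)) (fun t => g (t + τ)) (a - τ) (b - τ) := by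
  have key : ∀ f : ℝ → ℝ, IntervalIntegrable f volume a b →
      IntervalIntegrable (fun t => f (t + τ)) volume (a - τ) (b - τ) := fun f hf => by
    simpa using hf.comp_add_right τ
  refine ⟨by linarith [h.le], fun n => (h.mode n).comp_add_right τ, fun n => key _ (h.forcing n),
    ⟨fun n => key _ (h.sq_forcing.1 n), ?_⟩, by simpa using h.init⟩
  refine h.sq_forcing.2.congr fun n => ?_
  rw [intervalIntegral.integral_comp_add_right (fun r => |g r n ^ 2|)]
  simp

/-- Averaged smoothing estimate. -/
theorem smoothing (hl : IsSpectrum lam) (h : Orbit lam v g a b) (hab : a < b) :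
    (Summable fun n => v b n ^ 2) ∧ (b - a) * zeroSq (v b) ≤
      (∫ r in a..b, zeroSq (v r)) + (b - a) * (2⁻¹ * ∫ r in a..b, zeroSq (g r)) := by
  have h0 := (h.sumInt_zero hl).ae_summable h.le
  -- Almost every s is an admissible starting time for the estimate in H. Integration over s will
  -- replace the value at s by the integral over [a,b].
  have key : ∀ᵐ s, s ∈ Ioc a b → (Summable fun n => v b n ^ 2) ∧
      zeroSq (v b) ≤ zeroSq (v s) + 2⁻¹ * ∫ r in a..b, zeroSq (g r) := by
    filter_upwards [h0] with s hs hm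
    have h1 := h.zeroSq_le (hs hm) hm.1.le hm.2 le_rfl
    refine ⟨h1.1, h1.2.trans ?_⟩
    have := integral_mono_subinterval hm.1.le hm.2 le_rfl h.intervalIntegrable_forcing
      (ae_of_all _ fun t _ => zeroSq_nonneg (g t))
    linarith
  -- A set of full measure meets an interval of positive length, which yields the summability at
  -- time b.
  have hne : ∃ s, s ∈ Ioc a b ∧ (Summable fun n => v b n ^ 2) := by
    by_contra hcon
    push Not at hcon
    have : ∀ᵐ s, s ∉ Ioc a b := by
      filter_upwards [key] with s hs hm using hcon s hm (hs hm).1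
    have h2 : volume (Ioc a b) = 0 := by
      rw [ae_iff] at this; simpa only [not_not, ofPred_mem_eq] using this
    rw [Real.volume_Ioc, ENNReal.ofReal_eq_zero] at h2
    linarith
  refine ⟨hne.choose_spec.2, ?_⟩
  have h3 := integral_mono_of_ae_Ioc hab.le (f := fun _ => zeroSq (v b))
    (g := fun s => zeroSq (v s) + 2⁻¹ * ∫ r in a..b, zeroSq (g r)) intervalIntegrable_const
    ((h.intervalIntegrable_zeroSq hl).add intervalIntegrable_const)
    (by filter_upwards [key] with s hs hm using (hs hm).2)
  rwa [intervalIntegral.integral_add (h.intervalIntegrable_zeroSq hl) intervalIntegrable_const,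
    intervalIntegral.integral_const, intervalIntegral.integral_const, smul_eq_mul, smul_eq_mul] at h3

end Orbit

/-! ### Diagonal quadratic forms and their rates of change. -/

section Forms

variable {lam : ℕ → ℝ} {ξ γ η : ℕ → ℝ}

/-- Signs of the cone form. -/
def sg (N n : ℕ) : ℝ := if n < N then -1 else 1
/-- Indicator of the modes below `N`. -/
def cP (N n : ℕ) : ℝ := if n < N then 1 else 0
/-- Indicator of the modes from `N` on. -/
def cQ (N n : ℕ) : ℝ := if n < N then 0 else 1

theorem abs_sg_le (N n : ℕ) : |sg N n| ≤ 1 := by unfold sg; split_ifs <;> simp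
theorem abs_cP_le (N n : ℕ) : |cP N n| ≤ 1 := by unfold cP; split_ifs <;> simp
theorem abs_cQ_le (N n : ℕ) : |cQ N n| ≤ 1 := by unfold cQ; split_ifs <;> simp

theorem wForm_one : wForm lam (fun _ => 1) ξ = negSq lam ξ := by simp [wForm, negSq]

theorem summable_wForm (hl : IsSpectrum lam) (hξ : Summable fun n => (lam n)⁻¹ * ξ n ^ 2)
    {c : ℕ → ℝ} (hc : ∀ n, |c n| ≤ 1) : Summable fun n => c n * ((lam n)⁻¹ * ξ n ^ 2) := by
  refine Summable.of_norm_bounded hξ fun n => ?_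
  have : 0 ≤ (lam n)⁻¹ * ξ n ^ 2 := mul_nonneg (inv_nonneg.2 (hl.pos n).le) (sq_nonneg _)
  rw [Real.norm_eq_abs, abs_mul, abs_of_nonneg this]
  exact mul_le_of_le_one_left this (hc n)

theorem abs_wForm_le (hl : IsSpectrum lam) (hξ : Summable fun n => (lam n)⁻¹ * ξ n ^ 2)
    {c : ℕ → ℝ} (hc : ∀ n, |c n| ≤ 1) : |wForm lam c ξ| ≤ negSq lam ξ := by
  have h1 := summable_wForm hl hξ hc
  refine (norm_tsum_le_tsum_norm h1.norm).trans (h1.norm.tsum_le_tsum (fun n => ?_) hξ)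
  have : 0 ≤ (lam n)⁻¹ * ξ n ^ 2 := mul_nonneg (inv_nonneg.2 (hl.pos n).le) (sq_nonneg _)
  rw [Real.norm_eq_abs, abs_mul, abs_of_nonneg this]
  exact mul_le_of_le_one_left this (hc n)

theorem wForm_sg (hl : IsSpectrum lam) (hξ : Summable fun n => (lam n)⁻¹ * ξ n ^ 2) (N : ℕ) :
    wForm lam (sg N) ξ = wForm lam (cQ N) ξ - wForm lam (cP N) ξ := by
  unfold wForm
  rw [← (summable_wForm hl hξ (abs_cQ_le N)).tsum_sub (summable_wForm hl hξ (abs_cP_le N))]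
  congr 1; ext n; unfold sg cP cQ; split_ifs <;> ring

theorem negSq_eq_add (hl : IsSpectrum lam) (hξ : Summable fun n => (lam n)⁻¹ * ξ n ^ 2) (N : ℕ) :
    negSq lam ξ = wForm lam (cQ N) ξ + wForm lam (cP N) ξ := by
  unfold wForm negSq
  rw [← (summable_wForm hl hξ (abs_cQ_le N)).tsum_add (summable_wForm hl hξ (abs_cP_le N))]
  congr 1; ext n; unfold cP cQ; split_ifs <;> ring

theorem wForm_nonneg (hl : IsSpectrum lam) {c : ℕ → ℝ} (hc : ∀ n, 0 ≤ c n) :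
    0 ≤ wForm lam c ξ :=
  tsum_nonneg fun n => mul_nonneg (hc n) (mul_nonneg (inv_nonneg.2 (hl.pos n).le) (sq_nonneg _))

theorem cP_nonneg (N n : ℕ) : 0 ≤ cP N n := by unfold cP; split_ifs <;> simp
theorem cQ_nonneg (N n : ℕ) : 0 ≤ cQ N n := by unfold cQ; split_ifs <;> simp

theorem summable_neg_of_zero (hl : IsSpectrum lam) (hξ : Summable fun n => ξ n ^ 2) :
    Summable fun n => (lam n)⁻¹ * ξ n ^ 2 :=
  Summable.of_nonneg_of_le (fun n => mul_nonneg (inv_nonneg.2 (hl.pos n).le) (sq_nonneg _))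
    (fun n => mul_le_mul_of_nonneg_right (hl.inv_le n) (sq_nonneg _)) (hξ.mul_left _)

theorem negSq_le_zeroSq (hl : IsSpectrum lam) (hξ : Summable fun n => ξ n ^ 2) :
    negSq lam ξ ≤ (lam 0)⁻¹ * zeroSq ξ := by
  unfold negSq zeroSq
  rw [← tsum_mul_left]
  exact (summable_neg_of_zero hl hξ).tsum_le_tsum
    (fun n => mul_le_mul_of_nonneg_right (hl.inv_le n) (sq_nonneg _)) (hξ.mul_left _)

theorem summable_zero_of_one (hl : IsSpectrum lam) (hξ : Summable fun n => lam n * ξ n ^ 2) :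
    Summable fun n => ξ n ^ 2 := by
  refine Summable.of_nonneg_of_le (fun n => sq_nonneg _) (fun n => ?_) (hξ.mul_left (lam 0)⁻¹)
  rw [inv_mul_eq_div, le_div_iff₀ hl.zero_pos, mul_comm]
  exact mul_le_mul_of_nonneg_right (hl.le n) (sq_nonneg _)

theorem zeroSq_le_oneSq (hl : IsSpectrum lam) (hξ : Summable fun n => lam n * ξ n ^ 2) :
    lam 0 * zeroSq ξ ≤ oneSq lam ξ := by
  unfold oneSq zeroSq
  rw [← tsum_mul_left]
  exact ((summable_zero_of_one hl hξ).mul_left _).tsum_le_tsum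
    (fun n => mul_le_mul_of_nonneg_right (hl.le n) (sq_nonneg _)) hξ

theorem summable_mul_of_sq (hξ : Summable fun n => ξ n ^ 2) (hγ : Summable fun n => γ n ^ 2) :
    Summable fun n => γ n * ξ n := by
  refine Summable.of_norm_bounded (hξ.add hγ) fun n => ?_
  rw [Real.norm_eq_abs, abs_mul]
  nlinarith [sq_nonneg (|γ n| - |ξ n|), sq_abs (γ n), sq_abs (ξ n), sq_nonneg (γ n),
    sq_nonneg (ξ n)]

theorem summable_wRate (hl : IsSpectrum lam) (hξ : Summable fun n => lam n * ξ n ^ 2)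
    (hγ : Summable fun n => γ n ^ 2) {c : ℕ → ℝ} (hc : ∀ n, |c n| ≤ 1) :
    Summable fun n => c n * (-2 * (lam n * ξ n ^ 2) - 2 * (γ n * ξ n)) := by
  have h1 := (hξ.mul_left (-2)).sub ((summable_mul_of_sq (summable_zero_of_one hl hξ) hγ).mul_left 2)
  refine Summable.of_norm_bounded h1.norm fun n => ?_
  rw [norm_mul]
  exact mul_le_of_le_one_left (norm_nonneg _) (hc n)

theorem zeroSq_add_le (hξ : Summable fun n => ξ n ^ 2) (hγ : Summable fun n => γ n ^ 2) :
    (Summable fun n => (ξ + γ) n ^ 2) ∧ zeroSq (ξ + γ) ≤ 2 * zeroSq ξ + 2 * zeroSq γ := by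
  have h : ∀ n, (ξ + γ) n ^ 2 ≤ 2 * ξ n ^ 2 + 2 * γ n ^ 2 := fun n => by
    simp only [Pi.add_apply]; nlinarith [sq_nonneg (ξ n - γ n)]
  have hs := (hξ.mul_left 2).add (hγ.mul_left 2)
  have h1 := Summable.of_nonneg_of_le (fun n => sq_nonneg _) h hs
  refine ⟨h1, hasSum_le h h1.hasSum ((hξ.hasSum.mul_left 2).add (hγ.hasSum.mul_left 2))⟩

theorem zeroSq_sub_le (hξ : Summable fun n => ξ n ^ 2) (hγ : Summable fun n => γ n ^ 2) :
    (Summable fun n => (ξ - γ) n ^ 2) ∧ zeroSq (ξ - γ) ≤ 2 * zeroSq ξ + 2 * zeroSq γ := by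
  have h := zeroSq_add_le (γ := -γ) hξ (by simpa using hγ)
  rw [← sub_eq_add_neg] at h
  simpa [zeroSq] using h

/-- Young's inequality twice: 2|⟨γ, ξ⟩| ≤ L⁻¹‖γ‖² + L‖ξ‖² ≤ 2L‖ξ‖², and then 2L‖ξ‖² is interpolated
between L²‖ξ‖² in H^{-1} and ‖ξ‖² in H^1. -/
theorem wRate_one_le (hl : IsSpectrum lam) (hξ : Summable fun n => lam n * ξ n ^ 2)
    (hγ : Summable fun n => γ n ^ 2) {L : ℝ} (hL : 0 < L) (h : zeroSq γ ≤ L ^ 2 * zeroSq ξ) :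
    wRate lam (fun _ => 1) ξ γ ≤ L ^ 2 * negSq lam ξ - oneSq lam ξ := by
  have h0 := summable_zero_of_one hl hξ
  have hn := summable_neg_of_zero hl h0
  have h1 : ∀ n, (1 : ℝ) * (-2 * (lam n * ξ n ^ 2) - 2 * (γ n * ξ n)) ≤
      L ^ 2 * ((lam n)⁻¹ * ξ n ^ 2) - lam n * ξ n ^ 2 + (L⁻¹ * γ n ^ 2 - L * ξ n ^ 2) := fun n => by
    have hp := hl.pos n
    have e1 : 0 ≤ (lam n)⁻¹ * ξ n ^ 2 * (L - lam n) ^ 2 := by positivity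
    have e2 : 0 ≤ L⁻¹ * (γ n + L * ξ n) ^ 2 := by positivity
    have e3 : (lam n)⁻¹ * ξ n ^ 2 * (L - lam n) ^ 2 =
      L ^ 2 * ((lam n)⁻¹ * ξ n ^ 2) - 2 * L * ξ n ^ 2 + lam n * ξ n ^ 2 := by
      field_simp; ring
    have e4 : L⁻¹ * (γ n + L * ξ n) ^ 2 = L⁻¹ * γ n ^ 2 + 2 * (γ n * ξ n) + L * ξ n ^ 2 := by
      field_simp; ring
    linarith
  have h2 := hasSum_le h1 (summable_wRate hl hξ hγ (c := fun _ => 1) (by simp)).hasSum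
    (((hn.hasSum.mul_left (L ^ 2)).sub hξ.hasSum).add
      ((hγ.hasSum.mul_left L⁻¹).sub (h0.hasSum.mul_left L)))
  have h3 : L⁻¹ * zeroSq γ ≤ L * zeroSq ξ := by
    rw [inv_mul_le_iff₀ hL]; linarith [h]
  unfold wRate negSq oneSq
  unfold zeroSq at h3
  linarith

end Forms

/-! ### Consequences of the cone inequality for a single orbit. -/

/-- The data of the strong cone condition, with bounds for its coefficients. -/
structure ConeParams where
  lam : ℕ → ℝ
  N : ℕ
  L : ℝ
  αm : ℝ
  αp : ℝ
  μ : ℝ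
  spec : IsSpectrum lam
  L_pos : 0 < L
  αm_pos : 0 < αm
  αm_le : αm ≤ αp
  μ_pos : 0 < μ

namespace ConeParams

/-- The cone form. -/
noncomputable def V (P : ConeParams) (ξ : ℕ → ℝ) : ℝ := wForm P.lam (sg P.N) ξ
/-- The part of the `H^{-1}` norm in the low modes. -/
noncomputable def plus (P : ConeParams) (ξ : ℕ → ℝ) : ℝ := wForm P.lam (cP P.N) ξ
/-- The part of the `H^{-1}` norm in the high modes. -/
noncomputable def minus (P : ConeParams) (ξ : ℕ → ℝ) : ℝ := wForm P.lam (cQ P.N) ξ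

variable (P : ConeParams) {ξ : ℕ → ℝ}

theorem αp_pos : 0 < P.αp := P.αm_pos.trans_le P.αm_le
theorem plus_nonneg : 0 ≤ P.plus ξ := wForm_nonneg P.spec (cP_nonneg _)
theorem minus_nonneg : 0 ≤ P.minus ξ := wForm_nonneg P.spec (cQ_nonneg _)
theorem V_eq (h : Summable fun n => (P.lam n)⁻¹ * ξ n ^ 2) : P.V ξ = P.minus ξ - P.plus ξ :=
  wForm_sg P.spec h P.N
theorem negSq_eq (h : Summable fun n => (P.lam n)⁻¹ * ξ n ^ 2) :
    negSq P.lam ξ = P.minus ξ + P.plus ξ := negSq_eq_add P.spec h P.N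
theorem abs_V_le (h : Summable fun n => (P.lam n)⁻¹ * ξ n ^ 2) : |P.V ξ| ≤ negSq P.lam ξ :=
  abs_wForm_le P.spec h (abs_sg_le P.N)

end ConeParams

/-- An orbit whose forcing is bounded by `L` times the state. -/
structure ControlledOrbit (P : ConeParams) (v g : ℝ → ℕ → ℝ) (a b : ℝ) : Prop
    extends Orbit P.lam v g a b where
  control : ∀ᵐ t, t ∈ Ioc a b → zeroSq (g t) ≤ P.L ^ 2 * zeroSq (v t)

namespace ControlledOrbit

variable {P : ConeParams} {v g : ℝ → ℕ → ℝ} {a b s t : ℝ}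

theorem mono' (h : ControlledOrbit P v g a b) (hs : a ≤ s) (hst : s ≤ t) (ht : t ≤ b) :
    ControlledOrbit P v g s t :=
  ⟨h.mono P.spec hs hst ht, by
    filter_upwards [h.control] with r hr hm using hr ⟨hs.trans_lt hm.1, hm.2.trans ht⟩⟩

/-- Gronwall with rate -L², keeping the H^1 term: its exponential weight is at least 1 and can be
dropped. -/
theorem growth (h : ControlledOrbit P v g a b) :
    negSq P.lam (v b) + ∫ r in a..b, oneSq P.lam (v r) ≤
      Real.exp (P.L ^ 2 * (b - a)) * negSq P.lam (v a) := by
  have hl := P.spec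
  have hX := h.isPrimitive_wForm hl (c := fun _ => 1) (by simp)
  simp only [wForm_one] at hX
  have hi := h.intervalIntegrable_oneSq hl
  have h1 := hX.gronwall_const (β := -P.L ^ 2) (R := fun r => -oneSq P.lam (v r)) h.le hi.neg (by
    filter_upwards [h.control, h.ae_summable_one hl, h.ae_summable_forcing] with t h1 h2 h3 hm
    have := wRate_one_le hl (h2 hm) (h3 hm) P.L_pos (h1 hm)
    linarith)
  have h2 : ∫ r in a..b, Real.exp (-(-P.L ^ 2 * (b - r))) * -oneSq P.lam (v r) ≤
      ∫ r in a..b, -oneSq P.lam (v r) := by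
    refine intervalIntegral.integral_mono_on h.le (hi.neg.continuousOn_mul (by fun_prop)) hi.neg ?_
    intro r hr
    have e1 : 1 ≤ Real.exp (-(-P.L ^ 2 * (b - r))) := by
      apply Real.one_le_exp
      have := mul_nonneg (sq_nonneg P.L) (sub_nonneg.2 hr.2)
      linarith
    have := oneSq_nonneg hl (v r)
    nlinarith
  rw [intervalIntegral.integral_neg] at h2
  have e : -(-P.L ^ 2 * (b - a)) = P.L ^ 2 * (b - a) := by ring
  rw [e] at h1
  linarith

theorem negSq_le (h : ControlledOrbit P v g a b) :
    negSq P.lam (v b) ≤ Real.exp (P.L ^ 2 * (b - a)) * negSq P.lam (v a) := by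
  have := h.growth
  have h1 : 0 ≤ ∫ r in a..b, oneSq P.lam (v r) :=
    intervalIntegral.integral_nonneg h.le fun r _ => oneSq_nonneg P.spec _
  linarith

theorem integral_forcing_le (h : ControlledOrbit P v g a b) :
    ∫ r in a..b, zeroSq (g r) ≤ P.L ^ 2 * ∫ r in a..b, zeroSq (v r) := by
  rw [← intervalIntegral.integral_const_mul]
  exact integral_mono_of_ae_Ioc h.le h.intervalIntegrable_forcing
    ((h.intervalIntegrable_zeroSq P.spec).const_mul _) h.control

theorem integral_zeroSq_le (h : ControlledOrbit P v g a b) :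
    ∫ r in a..b, zeroSq (v r) ≤
      (P.lam 0)⁻¹ * Real.exp (P.L ^ 2 * (b - a)) * negSq P.lam (v a) := by
  have h1 := h.growth
  have h2 := negSq_nonneg P.spec (v b)
  have h3 : P.lam 0 * ∫ r in a..b, zeroSq (v r) ≤ ∫ r in a..b, oneSq P.lam (v r) := by
    rw [← intervalIntegral.integral_const_mul]
    refine integral_mono_of_ae_Ioc h.le ((h.intervalIntegrable_zeroSq P.spec).const_mul _)
      (h.intervalIntegrable_oneSq P.spec) ?_
    filter_upwards [h.ae_summable_one P.spec] with t h2 hm using zeroSq_le_oneSq P.spec (h2 hm)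
  rw [mul_assoc, le_inv_mul_iff₀ P.spec.zero_pos]
  linarith

/-- Smoothing over the last unit of time turns the integral estimates supplied by the cone
inequality into pointwise estimates in H. -/
theorem zeroSq_le_integral (h : ControlledOrbit P v g a b) (hab : a + 1 ≤ b) :
    (Summable fun n => v b n ^ 2) ∧
      zeroSq (v b) ≤ (1 + P.L ^ 2) * ∫ r in (b - 1)..b, zeroSq (v r) := by
  have h1 := h.mono' (s := b - 1) (t := b) (by linarith) (by linarith) le_rfl
  have h2 := h1.smoothing P.spec (by linarith)
  have h3 := h1.integral_forcing_le
  refine ⟨h2.1, ?_⟩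
  have h4 := h2.2
  have : 0 ≤ ∫ r in (b-1)..b, zeroSq (v r) :=
    intervalIntegral.integral_nonneg (by linarith) fun r _ => zeroSq_nonneg _
  have e : b - (b - 1) = 1 := by ring
  rw [e] at h4
  nlinarith [mul_nonneg (sq_nonneg P.L) this]

theorem eq_zero (h : ControlledOrbit P v g a b) (ha : v a = 0) (ht : t ∈ Icc a b) : v t = 0 := by
  have h1 := (h.mono' le_rfl ht.1 ht.2).negSq_le
  have h2 : negSq P.lam (v a) = 0 := by simp [ha, negSq]
  rw [h2, mul_zero] at h1
  have h3 := h.mem_neg P.spec ht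
  have h4 : ∀ n, 0 ≤ (P.lam n)⁻¹ * v t n ^ 2 := fun n =>
    mul_nonneg (inv_nonneg.2 (P.spec.pos n).le) (sq_nonneg _)
  ext n
  have h5 := h3.le_tsum n fun m _ => h4 m
  have h6 : (P.lam n)⁻¹ * v t n ^ 2 = 0 := le_antisymm (h5.trans h1) (h4 n)
  have := (P.spec.pos n).ne'
  simpa [this] using h6

end ControlledOrbit

/-- A controlled orbit along which the cone inequality holds. -/
structure ConeOrbit (P : ConeParams) (v g : ℝ → ℕ → ℝ) (a b : ℝ) : Prop
    extends ControlledOrbit P v g a b where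
  cone : ∀ᵐ t, t ∈ Ioc a b → wRate P.lam (sg P.N) (v t) (g t) +
    min (P.αm * P.V (v t)) (P.αp * P.V (v t)) ≤ -P.μ * zeroSq (v t)

namespace ConeOrbit

variable {P : ConeParams} {v g : ℝ → ℕ → ℝ} {a b s t : ℝ}

theorem mono'' (h : ConeOrbit P v g a b) (hs : a ≤ s) (hst : s ≤ t) (ht : t ≤ b) :
    ConeOrbit P v g s t :=
  ⟨h.mono' hs hst ht, by
    filter_upwards [h.cone] with r hr hm using hr ⟨hs.trans_lt hm.1, hm.2.trans ht⟩⟩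

theorem isPrimitive_V (h : ConeOrbit P v g a b) :
    IsPrimitive (fun t => P.V (v t)) (fun t => wRate P.lam (sg P.N) (v t) (g t)) a b :=
  h.isPrimitive_wForm P.spec (abs_sg_le P.N)

/-- Inside the cone, the distance to the boundary of the cone cannot decay too fast. -/
theorem V_le_of_nonpos (h : ConeOrbit P v g a b) (ha : P.V (v a) ≤ 0) :
    P.V (v b) + P.μ * Real.exp (-(P.αp * (b - a))) * ∫ r in a..b, zeroSq (v r) ≤
      Real.exp (-(P.αp * (b - a))) * P.V (v a) := by
  -- The minimum of α₋V and α₊V equals φ(V)V, so the inequality becomes linear in V with a bounded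
  -- measurable rate and Gronwall applies before the sign of V is known.
  set φ : ℝ → ℝ := fun x => if 0 ≤ x then P.αm else P.αp with hφ
  set β : ℝ → ℝ := fun t => φ (P.V (v t)) with hβ
  have hφm : Measurable φ := Measurable.ite measurableSet_Ici measurable_const measurable_const
  have hφb : ∀ x, 0 ≤ φ x ∧ φ x ≤ P.αp := fun x => by
    have := P.αm_pos; have := P.αm_le
    simp only [hφ]; split_ifs <;> constructor <;> linarith
  have hβm : AEStronglyMeasurable β (volume.restrict (Ioc a b)) := by
    have h1 : AEMeasurable (fun t => P.V (v t)) (volume.restrict (Ioc a b)) :=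
      ((h.isPrimitive_V.continuousOn h.le).mono Ioc_subset_Icc_self).aemeasurable measurableSet_Ioc
    exact (hφm.comp_aemeasurable h1).aestronglyMeasurable
  have hβi : IntervalIntegrable β volume a b := by
    rw [intervalIntegrable_iff_integrableOn_Ioc_of_le h.le]
    refine Integrable.mono' (g := fun _ => P.αp) (by simp) hβm (ae_of_all _ fun t => ?_)
    rw [Real.norm_eq_abs, abs_of_nonneg (hφb _).1]; exact (hφb _).2
  have hi := (h.intervalIntegrable_zeroSq P.spec).const_mul (-P.μ)
  have h1 := h.isPrimitive_V.gronwall h.le hβi hi (by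
    filter_upwards [h.cone] with t ht hm
    refine le_trans (add_le_add_right (le_of_eq ?_) _) (ht hm)
    have := P.αm_le
    simp only [hβ, hφ]
    split_ifs with h0
    · rw [min_eq_left (mul_le_mul_of_nonneg_right this h0)]
    · rw [min_eq_right (mul_le_mul_of_nonpos_right this (not_le.1 h0).le)])
  have hexp : ∀ r ∈ Icc a b, Real.exp (-(P.αp * (b - a))) ≤ Real.exp (∫ s in b..r, β s) := by
    intro r hr
    apply Real.exp_le_exp.2
    rw [intervalIntegral.integral_symm, neg_le_neg_iff]
    have h2 := intervalIntegral.integral_mono_on hr.2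
      (intervalIntegrable_subinterval hβi hr.1 hr.2 le_rfl)
      (intervalIntegrable_const (c := P.αp)) fun s _ => (hφb (P.V (v s))).2
    rw [intervalIntegral.integral_const, smul_eq_mul] at h2
    have : (b - r) * P.αp ≤ P.αp * (b - a) := by nlinarith [P.αp_pos, hr.1]
    exact h2.trans this
  have h3 : ∫ r in a..b, Real.exp (∫ s in b..r, β s) * (-P.μ * zeroSq (v r)) ≤
      ∫ r in a..b, Real.exp (-(P.αp * (b - a))) * (-P.μ * zeroSq (v r)) := by
    refine intervalIntegral.integral_mono_on h.le ?_ (hi.const_mul _) fun r hr => ?_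
    · apply hi.continuousOn_mul
      rw [uIcc_of_le h.le]
      exact ((IsPrimitive.of_intervalIntegral h.le hβi (right_mem_Icc.2 h.le)).exp
        h.le).continuousOn h.le
    · have := mul_nonneg P.μ_pos.le (zeroSq_nonneg (v r))
      nlinarith [hexp r hr]
  rw [intervalIntegral.integral_const_mul, intervalIntegral.integral_const_mul] at h3
  have h4 := mul_le_mul_of_nonpos_right (hexp a (left_mem_Icc.2 h.le)) ha
  linarith

theorem V_nonpos (h : ConeOrbit P v g a b) (ha : P.V (v a) ≤ 0) (ht : t ∈ Icc a b) :
    P.V (v t) ≤ 0 := by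
  have h1 := (h.mono'' le_rfl ht.1 ht.2).V_le_of_nonpos ha
  have h2 : 0 ≤ ∫ r in a..t, zeroSq (v r) :=
    intervalIntegral.integral_nonneg ht.1 fun r _ => zeroSq_nonneg _
  have h3 := mul_nonneg (mul_nonneg P.μ_pos.le (Real.exp_pos (-(P.αp * (t - a)))).le) h2
  nlinarith [mul_nonneg (Real.exp_pos (-(P.αp * (t - a)))).le (neg_nonneg.2 ha)]

/-- At the end V is at least minus its low-mode part, so low modes at the final time pay for the
dissipation accumulated in the past. This is the backward control that makes the manifold Lipschitz.
-/
theorem integral_le_of_nonpos (h : ConeOrbit P v g a b) (ha : P.V (v a) ≤ 0) :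
    ∫ r in a..b, zeroSq (v r) ≤ P.μ⁻¹ * Real.exp (P.αp * (b - a)) * P.plus (v b) := by
  have h1 := h.V_le_of_nonpos ha
  have h2 := P.V_eq (h.mem_neg P.spec (right_mem_Icc.2 h.le))
  have h3 := P.minus_nonneg (ξ := v b)
  have h4 := mul_nonneg (Real.exp_pos (-(P.αp * (b - a)))).le (neg_nonneg.2 ha)
  have h5 : P.μ * Real.exp (-(P.αp * (b - a))) * ∫ r in a..b, zeroSq (v r) ≤ P.plus (v b) := by
    linarith
  rw [Real.exp_neg] at h5
  have h6 := P.μ_pos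
  have h7 := Real.exp_pos (P.αp * (b - a))
  calc ∫ r in a..b, zeroSq (v r) = P.μ⁻¹ * Real.exp (P.αp * (b - a)) *
        (P.μ * (Real.exp (P.αp * (b - a)))⁻¹ * ∫ r in a..b, zeroSq (v r)) := by field_simp
    _ ≤ _ := by gcongr

/-- Backward invariance of the complement of the cone. -/
theorem V_nonneg (h : ConeOrbit P v g a b) (hb : 0 ≤ P.V (v b)) (ht : t ∈ Icc a b) :
    0 ≤ P.V (v t) := by
  by_contra hneg
  push Not at hneg
  have h1 := (h.mono'' ht.1 ht.2 le_rfl).V_le_of_nonpos hneg.le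
  have h2 : 0 ≤ ∫ r in t..b, zeroSq (v r) :=
    intervalIntegral.integral_nonneg ht.2 fun r _ => zeroSq_nonneg _
  have h3 := mul_nonneg (mul_nonneg P.μ_pos.le (Real.exp_pos (-(P.αp * (b - t)))).le) h2
  nlinarith [mul_pos (Real.exp_pos (-(P.αp * (b - t)))) (neg_pos.2 hneg)]

/-- By backward invariance V is nonnegative throughout, and there the minimum in the cone inequality
is α₋V. -/
theorem squeeze (h : ConeOrbit P v g a b) (hb : 0 ≤ P.V (v b)) :
    P.V (v b) ≤ Real.exp (-(P.αm * (b - a))) * P.V (v a) := by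
  have h1 := h.isPrimitive_V.gronwall_const (β := P.αm) (R := fun _ => 0) h.le
    intervalIntegrable_const (by
    filter_upwards [h.cone] with t ht hm
    have h0 := h.V_nonneg hb ⟨hm.1.le, hm.2⟩
    have h1 := ht hm
    rw [min_eq_left (mul_le_mul_of_nonneg_right P.αm_le h0)] at h1
    nlinarith [mul_nonneg P.μ_pos.le (zeroSq_nonneg (v t))])
  simpa using h1

/-- Outside the cone the term α₋V has a favourable sign and is discarded; what remains is the
dissipation, paid for by V at the start. -/
theorem integral_le_of_nonneg (h : ConeOrbit P v g a b) (hb : 0 ≤ P.V (v b)) :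
    P.μ * ∫ r in a..b, zeroSq (v r) ≤ P.V (v a) := by
  have hi := (h.intervalIntegrable_zeroSq P.spec).const_mul (-P.μ)
  have h1 := h.isPrimitive_V.gronwall_const (β := 0) h.le hi (by
    filter_upwards [h.cone] with t ht hm
    have h0 := h.V_nonneg hb ⟨hm.1.le, hm.2⟩
    have h1 := ht hm
    rw [min_eq_left (mul_le_mul_of_nonneg_right P.αm_le h0)] at h1
    nlinarith [mul_nonneg P.αm_pos.le h0])
  simp only [zero_mul, neg_zero, Real.exp_zero, one_mul, intervalIntegral.integral_const_mul] at h1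
  linarith

end ConeOrbit

/-! ### Fourier coefficients and the scale of spaces. -/

section Coeff

variable {H : Type*} [NormedAddCommGroup H] [InnerProductSpace ℝ H] (e : HilbertBasis ℕ ℝ H)

theorem coeff_sub (x y : H) : coeff e (x - y) = coeff e x - coeff e y := by
  ext n; simp [coeff, inner_sub_right]

theorem coeff_add (x y : H) : coeff e (x + y) = coeff e x + coeff e y := by
  ext n; simp [coeff, inner_add_right]

theorem coeff_smul (k : ℝ) (x : H) : coeff e (k • x) = k • coeff e x := by
  ext n; simp [coeff, inner_smul_right]

theorem coeff_zero : coeff e (0 : H) = 0 := by ext n; simp [coeff]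

theorem hasSum_coeff_mul (x y : H) : HasSum (fun n => coeff e x n * coeff e y n) ⟪x, y⟫_ℝ := by
  have := e.hasSum_inner_mul_inner x y
  simpa only [coeff, real_inner_comm] using this

theorem hasSum_coeff_sq (x : H) : HasSum (fun n => coeff e x n ^ 2) (‖x‖ ^ 2) := by
  have := hasSum_coeff_mul e x x
  simpa only [← sq, real_inner_self_eq_norm_sq] using this

theorem summable_coeff_sq (x : H) : Summable fun n => coeff e x n ^ 2 := (hasSum_coeff_sq e x).summable

theorem zeroSq_coeff (x : H) : zeroSq (coeff e x) = ‖x‖ ^ 2 := (hasSum_coeff_sq e x).tsum_eq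

theorem coeff_injective : Function.Injective (coeff e) := fun x y h => by
  have h1 := zeroSq_coeff e (x - y)
  rw [coeff_sub, h, sub_self] at h1
  have : ‖x - y‖ ^ 2 = 0 := by rw [← h1]; simp [zeroSq]
  exact sub_eq_zero.1 (norm_eq_zero.1 (by simpa using this))

theorem continuous_coeff (n : ℕ) : Continuous fun x : H => coeff e x n := by
  unfold coeff; fun_prop

variable {e}

theorem coeff_toH {ξ : ℕ → ℝ} (hξ : Summable fun n => ξ n ^ 2) : coeff e (toH e ξ) = ξ := by
  have hm : Memℓp ξ 2 := by
    refine memℓp_gen ?_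
    simpa using hξ
  have h1 := e.hasSum_repr_symm ⟨ξ, hm⟩
  have h2 : toH e ξ = e.repr.symm ⟨ξ, hm⟩ := h1.tsum_eq
  ext n
  have h3 := e.repr_apply_apply (e.repr.symm ⟨ξ, hm⟩) n
  rw [LinearIsometryEquiv.apply_symm_apply] at h3
  rw [coeff, h2, ← h3]

theorem norm_toH_sq {ξ : ℕ → ℝ} (hξ : Summable fun n => ξ n ^ 2) : ‖toH e ξ‖ ^ 2 = zeroSq ξ := by
  rw [← zeroSq_coeff e, coeff_toH hξ]

theorem toH_sub {ξ γ : ℕ → ℝ} (hξ : Summable fun n => ξ n ^ 2) (hγ : Summable fun n => γ n ^ 2) :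
    toH e (ξ - γ) = toH e ξ - toH e γ := by
  apply coeff_injective e
  rw [coeff_sub, coeff_toH hξ, coeff_toH hγ, coeff_toH (zeroSq_sub_le hξ hγ).1]

end Coeff

section Scale

variable {lam : ℕ → ℝ} {ξ : ℕ → ℝ}

theorem memHs_neg_one : MemHs lam (-1) ξ ↔ Summable fun n => (lam n)⁻¹ * ξ n ^ 2 := by
  simp [MemHs, Real.rpow_neg_one]

theorem memHs_one : MemHs lam 1 ξ ↔ Summable fun n => lam n * ξ n ^ 2 := by simp [MemHs]

theorem memHs_zero : MemHs lam 0 ξ ↔ Summable fun n => ξ n ^ 2 := by simp [MemHs]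

theorem normHs_neg_one : normHs lam (-1) ξ = √(negSq lam ξ) := by
  simp [normHs, negSq, Real.rpow_neg_one]

theorem normHs_one : normHs lam 1 ξ = √(oneSq lam ξ) := by simp [normHs, oneSq]

theorem normHs_zero : normHs lam 0 ξ = √(zeroSq ξ) := by simp [normHs, zeroSq]

theorem normHs_neg_one_sq (hl : IsSpectrum lam) : normHs lam (-1) ξ ^ 2 = negSq lam ξ := by
  rw [normHs_neg_one, Real.sq_sqrt (negSq_nonneg hl ξ)]

theorem normHs_one_sq (hl : IsSpectrum lam) : normHs lam 1 ξ ^ 2 = oneSq lam ξ := by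
  rw [normHs_one, Real.sq_sqrt (oneSq_nonneg hl ξ)]

theorem normHs_zero_sq : normHs lam 0 ξ ^ 2 = zeroSq ξ := by
  rw [normHs_zero, Real.sq_sqrt (zeroSq_nonneg ξ)]

theorem coneForm_eq (hl : IsSpectrum lam) (hξ : Summable fun n => (lam n)⁻¹ * ξ n ^ 2) (N : ℕ) :
    coneForm lam N ξ = wForm lam (sg N) ξ := by
  rw [wForm_sg hl hξ, coneForm, normHs_neg_one_sq hl, normHs_neg_one_sq hl]
  congr 1
  · unfold negSq wForm projQ cQ; congr 1; ext n; split_ifs <;> simp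
  · unfold negSq wForm projP cP; congr 1; ext n; split_ifs <;> simp

theorem mode_sq_le_negSq (hl : IsSpectrum lam) (hξ : Summable fun n => (lam n)⁻¹ * ξ n ^ 2) (n : ℕ) :
    ξ n ^ 2 ≤ lam n * negSq lam ξ := by
  have h := hξ.le_tsum n fun m _ => mul_nonneg (inv_nonneg.2 (hl.pos m).le) (sq_nonneg (ξ m))
  rwa [inv_mul_le_iff₀ (hl.pos n)] at h

theorem summable_neg_sub (hl : IsSpectrum lam) {γ : ℕ → ℝ}
    (hξ : Summable fun n => (lam n)⁻¹ * ξ n ^ 2) (hγ : Summable fun n => (lam n)⁻¹ * γ n ^ 2) :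
    Summable fun n => (lam n)⁻¹ * (ξ - γ) n ^ 2 := by
  refine Summable.of_nonneg_of_le (fun n => mul_nonneg (inv_nonneg.2 (hl.pos n).le) (sq_nonneg _))
    (fun n => ?_) ((hξ.mul_left 2).add (hγ.mul_left 2))
  have h1 : (ξ - γ) n ^ 2 ≤ 2 * ξ n ^ 2 + 2 * γ n ^ 2 := by
    simp only [Pi.sub_apply]; nlinarith [sq_nonneg (ξ n + γ n)]
  have := mul_le_mul_of_nonneg_left h1 (inv_nonneg.2 (hl.pos n).le)
  linarith

end Scale

/-! ### Passage between energy solutions and orbits. -/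

section Interface

variable {lam : ℕ → ℝ} {v g : ℝ → ℕ → ℝ} {a b : ℝ}

theorem ae_Icc_iff_Ioc {p : ℝ → Prop} :
    (∀ᵐ t ∂(volume.restrict (Icc a b)), p t) ↔ ∀ᵐ t, t ∈ Ioc a b → p t := by
  rw [← Measure.restrict_congr_set (Ioc_ae_eq_Icc (μ := volume) (a := a) (b := b)),
    ae_restrict_iff' measurableSet_Ioc]

theorem Orbit.isEnergySolution (hl : IsSpectrum lam) (h : Orbit lam v g a b) :
    IsEnergySolution lam v g a b where
  mem t ht := memHs_neg_one.2 (h.mem_neg hl ht)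
  cont t ht := by
    simp only [normHs_neg_one]
    have := (Real.continuous_sqrt.tendsto 0).comp (h.tendsto_negSq hl ht)
    rwa [Real.sqrt_zero] at this
  mem_one := ae_Icc_iff_Ioc.2 (by
    filter_upwards [h.ae_summable_one hl] with t ht hm using memHs_one.2 (ht hm))
  sq_integrable := by
    simp only [normHs_one_sq hl]
    rw [integrableOn_Icc_iff_integrableOn_Ioc]
    exact (h.intervalIntegrable_oneSq hl).1
  forcing_integrable n := by
    rw [integrableOn_Icc_iff_integrableOn_Ioc]; exact (h.forcing n).1
  equation n t ht := by
    have := (h.mode n).2 t ht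
    rw [intervalIntegral.integral_neg] at this
    linarith

/-- Continuity in H^{-1} makes every coefficient continuous, hence integrable in time, so each
scalar equation may be read as a statement about primitives. -/
theorem IsEnergySolution.orbit (hl : IsSpectrum lam) (hab : a ≤ b)
    (h : IsEnergySolution lam v g a b) (hg : SumInt (fun t n => g t n ^ 2) a b) :
    Orbit lam v g a b := by
  have hc : ∀ n, ContinuousOn (fun t => v t n) (Icc a b) := fun n t ht => by
    have h1 := (h.cont t ht).const_mul (√(lam n))
    rw [mul_zero] at h1
    refine tendsto_iff_dist_tendsto_zero.2 (squeeze_zero' (Eventually.of_forall fun _ => dist_nonneg)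
      ?_ h1)
    filter_upwards [self_mem_nhdsWithin] with s hs
    rw [Real.dist_eq, normHs_neg_one, ← Real.sqrt_mul (hl.pos n).le]
    apply Real.abs_le_sqrt
    exact mode_sq_le_negSq hl (summable_neg_sub hl (memHs_neg_one.1 (h.mem s hs))
      (memHs_neg_one.1 (h.mem t ht))) n
  have hf : ∀ n, IntervalIntegrable (fun t => g t n) volume a b := fun n => by
    rw [intervalIntegrable_iff_integrableOn_Ioc_of_le hab, ← integrableOn_Icc_iff_integrableOn_Ioc]
    exact h.forcing_integrable n
  refine ⟨hab, fun n => ⟨?_, fun t ht => ?_⟩, hf, hg,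
    memHs_neg_one.1 (h.mem a (left_mem_Icc.2 hab))⟩
  · refine IntervalIntegrable.neg (IntervalIntegrable.add ?_ ((hf n).const_mul _))
    apply ContinuousOn.intervalIntegrable
    rw [uIcc_of_le hab]; exact (hc n).const_mul _
  · have := h.equation n t ht
    rw [intervalIntegral.integral_neg]
    linarith

variable {H : Type*} [NormedAddCommGroup H] [InnerProductSpace ℝ H] {e : HilbertBasis ℕ ℝ H}

theorem sumInt_coeff_sq {y : ℝ → H} {G : ℝ → ℝ} (hab : a ≤ b)
    (hm : ∀ n, AEStronglyMeasurable (fun t => coeff e (y t) n) (volume.restrict (Ioc a b)))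
    (hG : IntervalIntegrable G volume a b) (h : ∀ᵐ t, t ∈ Ioc a b → ‖y t‖ ^ 2 ≤ G t) :
    SumInt (fun t n => coeff e (y t) n ^ 2) a b := by
  refine SumInt.of_ae_bound hab (fun n => (hm n).pow 2) hG ?_
  filter_upwards [h] with t ht hmem
  simp only [abs_sq]
  exact ⟨summable_coeff_sq e _, (zeroSq_coeff e (y t)).le.trans (ht hmem)⟩

theorem IsSolution.orbit (hl : IsSpectrum lam) (hab : a ≤ b) {F : H → H} {u : ℝ → ℕ → ℝ} {C : ℝ}
    (hF : ∀ x, ‖F x‖ ≤ C) (h : IsSolution e lam F u a b) :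
    Orbit lam u (fun t => coeff e (F (toH e (u t)))) a b := by
  refine IsEnergySolution.orbit hl hab h (sumInt_coeff_sq hab (fun n => ?_)
    (intervalIntegrable_const (c := C ^ 2)) (ae_of_all _ fun t _ => ?_))
  · exact ((h.forcing_integrable n).mono_set Ioc_subset_Icc_self).1
  · exact pow_le_pow_left₀ (norm_nonneg _) (hF _) 2

/-- Square integrability in H^1 and the bound on F' make the forcing square integrable in H. -/
theorem IsVariationSolution.orbit (hl : IsSpectrum lam) (hab : a ≤ b) {F' : H → H →L[ℝ] H}
    {u : ℝ → H} {L : ℝ} (hF : ∀ x, ‖F' x‖ ≤ L) (h : IsVariationSolution e lam F' u v a b) :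
    Orbit lam v (fun t => coeff e (F' (u t) (toH e (v t)))) a b := by
  have hL : 0 ≤ L := (norm_nonneg _).trans (hF 0)
  refine IsEnergySolution.orbit hl hab h (sumInt_coeff_sq hab (fun n => ?_)
    (G := fun t => L ^ 2 * ((lam 0)⁻¹ * normHs lam 1 (v t) ^ 2)) ?_ ?_)
  · exact ((h.forcing_integrable n).mono_set Ioc_subset_Icc_self).1
  · refine IntervalIntegrable.const_mul (IntervalIntegrable.const_mul ?_ _) _
    rw [intervalIntegrable_iff_integrableOn_Ioc_of_le hab]
    exact h.sq_integrable.mono_set Ioc_subset_Icc_self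
  · filter_upwards [ae_Icc_iff_Ioc.1 h.mem_one] with t ht hm
    have h1 := memHs_one.1 (ht hm)
    have h2 := summable_zero_of_one hl h1
    have h3 := zeroSq_le_oneSq hl h1
    calc ‖F' (u t) (toH e (v t))‖ ^ 2 ≤ (L * ‖toH e (v t)‖) ^ 2 := by
          gcongr; exact (F' (u t)).le_of_opNorm_le (hF _) _
      _ = L ^ 2 * zeroSq (v t) := by rw [mul_pow, norm_toH_sq h2]
      _ ≤ _ := by
        rw [normHs_one_sq hl]
        gcongr
        rw [inv_mul_eq_div, le_div_iff₀ hl.zero_pos]; linarith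

theorem Orbit.continuousOn_toH (h : Orbit lam v g a b)
    (ha : Summable fun n => v a n ^ 2) : ContinuousOn (fun t => toH e (v t)) (Icc a b) := by
  have hs : ∀ t ∈ Icc a b, Summable fun n => v t n ^ 2 := fun t ht =>
    (h.zeroSq_le ha le_rfl ht.1 ht.2).1
  have hbd : ∀ t ∈ Icc a b, ∀ n, v t n ^ 2 ≤ v a n ^ 2 + ∫ r in a..b, |g r n ^ 2| := by
    intro t ht n
    have h1 := h.zero_mode_le n le_rfl ht.1 ht.2
    rw [intervalIntegral.integral_const_mul] at h1
    have h5 : ∫ r in a..t, g r n ^ 2 ≤ ∫ r in a..b, g r n ^ 2 :=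
      integral_mono_subinterval le_rfl ht.1 ht.2 (h.sq_forcing.1 n)
        (ae_of_all _ fun _ _ => sq_nonneg _)
    have h6 : 0 ≤ ∫ r in a..t, g r n ^ 2 :=
      intervalIntegral.integral_nonneg ht.1 fun _ _ => sq_nonneg _
    simp only [abs_sq]; linarith
  intro t ht
  have hlim : Tendsto (fun s => zeroSq (v s - v t)) (𝓝[Icc a b] t) (𝓝 0) := by
    have : (0 : ℝ) = ∑' _ : ℕ, (0 : ℝ) := by simp
    rw [this]
    refine tendsto_tsum_of_dominated_convergence ((ha.add h.sq_forcing.2).mul_left 4)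
      (fun n => ?_) ?_
    · have h1 : ContinuousWithinAt (fun s => (v s n - v t n) ^ 2) (Icc a b) t :=
        ((h.continuousOn n t ht).sub continuousWithinAt_const).pow 2
      simpa using h1.tendsto
    · filter_upwards [self_mem_nhdsWithin] with s hs n
      rw [Real.norm_eq_abs, abs_of_nonneg (sq_nonneg _)]
      have h1 := hbd s hs n
      have h2 := hbd t ht n
      simp only [Pi.sub_apply]
      nlinarith [sq_nonneg (v s n + v t n)]
  have h2 := (Real.continuous_sqrt.tendsto 0).comp hlim
  rw [Real.sqrt_zero] at h2
  refine tendsto_iff_norm_sub_tendsto_zero.2 (h2.congr' ?_)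
  filter_upwards [self_mem_nhdsWithin] with s hsm
  rw [Function.comp, ← norm_toH_sq (e := e) (zeroSq_sub_le (hs s hsm) (hs t ht)).1,
    Real.sqrt_sq (norm_nonneg _), toH_sub (hs s hsm) (hs t ht)]

end Interface

/-! ### Existence of solutions by Duhamel's formula and contraction. -/

/-- The solution of `y' + l² y + l g = 0`, `y(0) = x`. -/
noncomputable def duhamel (l x : ℝ) (g : ℝ → ℝ) (t : ℝ) : ℝ :=
  Real.exp (-(l ^ 2 * t)) * (x - ∫ s in (0 : ℝ)..t, l * Real.exp (l ^ 2 * s) * g s)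

theorem isPrimitive_duhamel (l x : ℝ) {g : ℝ → ℝ} {T : ℝ} (hT : 0 ≤ T)
    (hg : IntervalIntegrable g volume 0 T) :
    IsPrimitive (duhamel l x g) (fun t => -(l ^ 2 * duhamel l x g t + l * g t)) 0 T := by
  have h1 : IsPrimitive (fun t => Real.exp (-(l ^ 2 * t)))
      (fun t => Real.exp (-(l ^ 2 * t)) * -(l ^ 2)) 0 T := by
    refine IsPrimitive.of_hasDerivAt (fun t => ?_) (by fun_prop)
    have := (((hasDerivAt_id t).const_mul (l ^ 2)).neg).exp
    simpa using this
  have h2 : IntervalIntegrable (fun s => l * Real.exp (l ^ 2 * s) * g s) volume 0 T :=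
    hg.continuousOn_mul (by fun_prop)
  have h3 := (IsPrimitive.of_intervalIntegral hT h2 (left_mem_Icc.2 hT)).const_mul (-1)
  have h4 : IsPrimitive (fun _ : ℝ => x) (fun _ => 0) 0 T :=
    IsPrimitive.of_hasDerivAt (fun t => hasDerivAt_const t x) continuous_const
  refine ((h1.mul (h4.add h3) hT).congr hT fun t _ => ?_).congr_deriv hT fun t _ => ?_
  · simp only [duhamel]; ring
  · simp only [duhamel]
    have : Real.exp (-(l ^ 2 * t)) * Real.exp (l ^ 2 * t) = 1 := by
      rw [← Real.exp_add]; simp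
    linear_combination (-l * g t) * this

theorem duhamel_zero (l x : ℝ) (g : ℝ → ℝ) : duhamel l x g 0 = x := by simp [duhamel]

theorem orbit_duhamel {lam : ℕ → ℝ} {g : ℝ → ℕ → ℝ} {ξ : ℕ → ℝ} {T : ℝ} (hT : 0 ≤ T)
    (hg : ∀ n, IntervalIntegrable (fun t => g t n) volume 0 T)
    (hs : SumInt (fun t n => g t n ^ 2) 0 T) (hξ : Summable fun n => (lam n)⁻¹ * ξ n ^ 2) :
    Orbit lam (fun t n => duhamel (lam n) (ξ n) (fun s => g s n) t) g 0 T :=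
  ⟨hT, fun n => isPrimitive_duhamel _ _ hT (hg n), hg, hs, by simpa [duhamel_zero] using hξ⟩

theorem integral_exp_le {k t : ℝ} (hk : 0 < k) :
    ∫ s in (0 : ℝ)..t, Real.exp (2 * k * s) ≤ Real.exp (2 * k * t) / (2 * k) := by
  have h : ∀ s : ℝ, HasDerivAt (fun s => Real.exp (2 * k * s) / (2 * k)) (Real.exp (2 * k * s)) s := by
    intro s
    have := (((hasDerivAt_id s).const_mul (2 * k)).exp).div_const (2 * k)
    convert! this using 1
    simp only [id]; field_simp
  rw [intervalIntegral.integral_eq_sub_of_hasDerivAt (fun s _ => h s)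
    ((by fun_prop : Continuous fun s => Real.exp (2 * k * s)).intervalIntegrable _ _)]
  have : 0 < Real.exp (2 * k * 0) / (2 * k) := by positivity
  linarith

/-- The gain 1/(4k) is what turns the fixed-point map into a contraction in an exponentially
weighted norm. -/
theorem Orbit.zeroSq_le_exp {lam : ℕ → ℝ} {v g : ℝ → ℕ → ℝ} {B k t : ℝ} (hk : 0 < k)
    (h : Orbit lam v g 0 t) (h0 : v 0 = 0)
    (hb : ∀ s, 0 < s → zeroSq (g s) ≤ B * Real.exp (2 * k * s)) (hB : 0 ≤ B) :
    (Summable fun n => v t n ^ 2) ∧ zeroSq (v t) ≤ B / (4 * k) * Real.exp (2 * k * t) := by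
  have h1 := h.zeroSq_le (s := 0) (t := t) (by simp [h0, summable_zero]) le_rfl h.le le_rfl
  refine ⟨h1.1, ?_⟩
  have h2 : zeroSq (v 0) = 0 := by simp [h0, zeroSq]
  have h3 : ∫ r in (0 : ℝ)..t, zeroSq (g r) ≤ ∫ r in (0 : ℝ)..t, B * Real.exp (2 * k * r) :=
    integral_mono_of_ae_Ioc h.le h.intervalIntegrable_forcing
      ((by fun_prop : Continuous fun r => B * Real.exp (2 * k * r)).intervalIntegrable _ _)
      (ae_of_all _ fun r hr => hb r hr.1)
  rw [intervalIntegral.integral_const_mul] at h3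
  have h4 := mul_le_mul_of_nonneg_left (integral_exp_le (t := t) hk) hB
  calc _ ≤ 2⁻¹ * (B * (Real.exp (2 * k * t) / (2 * k))) := by linarith [h1.2]
    _ = _ := by field_simp; ring

section Mild

variable {H : Type*} [NormedAddCommGroup H] [InnerProductSpace ℝ H]
  {e : HilbertBasis ℕ ℝ H} {lam : ℕ → ℝ}

/-- Solution of the linear equation with zero initial value and forcing `f`. -/
noncomputable def duhamelH (e : HilbertBasis ℕ ℝ H) (lam : ℕ → ℝ) (f : ℝ → H) (t : ℝ) : H :=
  toH e fun n => duhamel (lam n) 0 (fun s => coeff e (f s) n) t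

theorem orbit_duhamelH {f : ℝ → H} {B k : ℝ}
    (hm : AEStronglyMeasurable f (volume.restrict (Ioi 0)))
    (hb : ∀ s, 0 < s → ‖f s‖ ^ 2 ≤ B * Real.exp (2 * k * s)) {T : ℝ} (hT : 0 ≤ T) :
    Orbit lam (fun t n => duhamel (lam n) 0 (fun s => coeff e (f s) n) t)
      (fun t => coeff e (f t)) 0 T := by
  have hm' : ∀ n, AEStronglyMeasurable (fun t => coeff e (f t) n) (volume.restrict (Ioc 0 T)) :=
    fun n => (continuous_coeff e n).comp_aestronglyMeasurable
      (hm.mono_measure (Measure.restrict_mono Ioc_subset_Ioi_self le_rfl))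
  have hs := sumInt_coeff_sq (e := e) (y := f) (G := fun s => B * Real.exp (2 * k * s)) hT hm'
    ((by fun_prop : Continuous fun r => B * Real.exp (2 * k * r)).intervalIntegrable _ _)
    (ae_of_all _ fun s hs => hb s hs.1)
  refine orbit_duhamel (ξ := 0) hT (fun n => ?_) hs (by simp [summable_zero])
  rw [intervalIntegrable_iff_integrableOn_Ioc_of_le hT]
  have h1 : Integrable (fun t => 1 + coeff e (f t) n ^ 2) (volume.restrict (Ioc 0 T)) :=
    (by simp : Integrable (fun _ : ℝ => (1 : ℝ)) (volume.restrict (Ioc 0 T))).add (hs.1 n).1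
  refine h1.mono' (hm' n) (ae_of_all _ fun t => ?_)
  rw [Real.norm_eq_abs]
  nlinarith [sq_nonneg (|coeff e (f t) n| - 1), sq_abs (coeff e (f t) n), sq_nonneg (coeff e (f t) n)]

theorem duhamelH_spec {f : ℝ → H} {B k : ℝ} (hk : 0 < k) (hB : 0 ≤ B)
    (hm : AEStronglyMeasurable f (volume.restrict (Ioi 0)))
    (hb : ∀ s, 0 < s → ‖f s‖ ^ 2 ≤ B * Real.exp (2 * k * s)) {t : ℝ} (ht : 0 ≤ t) :
    coeff e (duhamelH e lam f t) = (fun n => duhamel (lam n) 0 (fun s => coeff e (f s) n) t) ∧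
      ‖duhamelH e lam f t‖ ^ 2 ≤ B / (4 * k) * Real.exp (2 * k * t) := by
  have h1 := (orbit_duhamelH (e := e) (lam := lam) hm hb ht).zeroSq_le_exp hk
    (by ext n; simp [duhamel_zero]) (fun s hs => by rw [zeroSq_coeff]; exact hb s hs) hB
  exact ⟨coeff_toH h1.1, by rw [duhamelH, norm_toH_sq h1.1]; exact h1.2⟩

theorem continuous_duhamelH {f : ℝ → H} {B k : ℝ}
    (hm : AEStronglyMeasurable f (volume.restrict (Ioi 0)))
    (hb : ∀ s, 0 < s → ‖f s‖ ^ 2 ≤ B * Real.exp (2 * k * s)) :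
    Continuous fun t => duhamelH e lam f (max t 0) := by
  have h1 : ContinuousOn (duhamelH e lam f) (Ici 0) := by
    intro t ht
    have ht0 : (0 : ℝ) ≤ t := ht
    have h2 := (orbit_duhamelH (e := e) (lam := lam) hm hb
      (T := t + 1) (by linarith)).continuousOn_toH (e := e) (by simp [duhamel_zero, summable_zero])
    have h3 := h2 t ⟨ht0, by linarith⟩
    refine ContinuousWithinAt.mono_of_mem_nhdsWithin h3 ?_
    exact mem_nhdsWithin.2 ⟨Iio (t + 1), isOpen_Iio, by simp, fun x hx => ⟨hx.2, le_of_lt hx.1⟩⟩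
  exact h1.comp_continuous (by fun_prop) fun t => le_max_right t 0

theorem duhamelH_sub {f₁ f₂ : ℝ → H} {B k B' : ℝ} (hk : 0 < k) (hB : 0 ≤ B) (hB' : 0 ≤ B')
    (hl : IsSpectrum lam)
    (hm₁ : AEStronglyMeasurable f₁ (volume.restrict (Ioi 0)))
    (hm₂ : AEStronglyMeasurable f₂ (volume.restrict (Ioi 0)))
    (hb₁ : ∀ s, 0 < s → ‖f₁ s‖ ^ 2 ≤ B * Real.exp (2 * k * s))
    (hb₂ : ∀ s, 0 < s → ‖f₂ s‖ ^ 2 ≤ B * Real.exp (2 * k * s))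
    (hb : ∀ s, 0 < s → ‖f₁ s - f₂ s‖ ^ 2 ≤ B' * Real.exp (2 * k * s)) {t : ℝ} (ht : 0 ≤ t) :
    ‖duhamelH e lam f₁ t - duhamelH e lam f₂ t‖ ^ 2 ≤ B' / (4 * k) * Real.exp (2 * k * t) := by
  have o := (orbit_duhamelH (e := e) (lam := lam) hm₁ hb₁ ht).sub hl
    (orbit_duhamelH (e := e) (lam := lam) hm₂ hb₂ ht)
  have h1 := o.zeroSq_le_exp hk (by ext n; simp [duhamel_zero])
    (fun s hs => by rw [← coeff_sub, zeroSq_coeff]; exact hb s hs) hB'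
  rw [← zeroSq_coeff e, coeff_sub, (duhamelH_spec hk hB hm₁ hb₁ ht).1,
    (duhamelH_spec hk hB hm₂ hb₂ ht).1]
  exact h1.2

/-- Mild solutions of `y' + A² y + A G(t, y) = 0`, `y(0) = 0`, for `G` Lipschitz in `y`. -/
theorem exists_mild [CompleteSpace H] (hl : IsSpectrum lam) {G : ℝ → H → H} {L M : ℝ} (hL : 0 < L)
    (hM : 0 ≤ M)
    (hLip : ∀ s x y, ‖G s x - G s y‖ ≤ L * ‖x - y‖) (h0 : ∀ s, 0 < s → ‖G s 0‖ ≤ M)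
    (hm : ∀ y : ℝ → H, Continuous y →
      AEStronglyMeasurable (fun s => G s (y s)) (volume.restrict (Ioi 0))) :
    ∃ y : ℝ → H, Continuous y ∧ y 0 = 0 ∧ ∀ T, 0 ≤ T →
      Orbit lam (fun t => coeff e (y t)) (fun t => coeff e (G t (y t))) 0 T := by
  -- In the unknown e^{-kt}y, a bounded continuous function, the Duhamel map has Lipschitz constant
  -- √(L²/(4k)), which is 1/2 for this k.
  set k : ℝ := L ^ 2 with hk
  have hk0 : 0 < k := by positivity
  set f : BoundedContinuousFunction ℝ H → ℝ → H := fun z s => G s (Real.exp (k * s) • z s) with hf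
  have hexp2 : ∀ s : ℝ, Real.exp (2 * k * s) = Real.exp (k * s) ^ 2 := fun s => by
    rw [← Real.exp_nat_mul]; congr 1; push_cast; ring
  have hfm : ∀ z, AEStronglyMeasurable (f z) (volume.restrict (Ioi 0)) := fun z =>
    hm _ ((by fun_prop : Continuous fun s : ℝ => Real.exp (k * s)).smul z.continuous)
  have hfb : ∀ z s, 0 < s → ‖f z s‖ ^ 2 ≤ (M + L * ‖z‖) ^ 2 * Real.exp (2 * k * s) := by
    intro z s hs
    rw [hexp2, ← mul_pow]
    apply pow_le_pow_left₀ (norm_nonneg _)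
    have h1 : ‖f z s‖ ≤ M + L * (Real.exp (k * s) * ‖z‖) := by
      have h2 := hLip s (Real.exp (k * s) • z s) 0
      rw [sub_zero, norm_smul, Real.norm_eq_abs, abs_of_pos (Real.exp_pos _)] at h2
      have h3 : ‖f z s‖ ≤ ‖f z s - G s 0‖ + ‖G s 0‖ := by
        simpa using norm_add_le (f z s - G s 0) (G s 0)
      have h4 : L * (Real.exp (k * s) * ‖z s‖) ≤ L * (Real.exp (k * s) * ‖z‖) := by
        gcongr; exact z.norm_coe_le_norm s
      linarith [h0 s hs]
    have h5 : 1 ≤ Real.exp (k * s) := Real.one_le_exp (by positivity)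
    nlinarith [norm_nonneg z]
  have hdiff : ∀ z w s, 0 < s →
      ‖f z s - f w s‖ ^ 2 ≤ (L * dist z w) ^ 2 * Real.exp (2 * k * s) := by
    intro z w s _
    rw [hexp2, ← mul_pow]
    apply pow_le_pow_left₀ (norm_nonneg _)
    refine (hLip s _ _).trans ?_
    rw [← smul_sub, norm_smul, Real.norm_eq_abs, abs_of_pos (Real.exp_pos _)]
    have := BoundedContinuousFunction.dist_coe_le_dist (f := z) (g := w) s
    rw [dist_eq_norm] at this
    calc _ ≤ L * (Real.exp (k * s) * dist z w) := by gcongr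
      _ = _ := by ring
  have hexpm : ∀ t : ℝ, Real.exp (2 * k * t) * Real.exp (-(k * t)) ^ 2 = 1 := fun t => by
    rw [hexp2, ← mul_pow, ← Real.exp_add]; simp
  -- Freezing the value for negative times keeps the map inside bounded continuous functions on the
  -- whole line.
  set Ψf : BoundedContinuousFunction ℝ H → ℝ → H := fun z t =>
    Real.exp (-(k * max t 0)) • duhamelH e lam (f z) (max t 0) with hΨf
  have hcont : ∀ z, Continuous (Ψf z) := fun z =>
    (by fun_prop : Continuous fun t : ℝ => Real.exp (-(k * max t 0))).smul
      (continuous_duhamelH (hfm z) (hfb z))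
  have hbound : ∀ z t, ‖Ψf z t‖ ≤ √((M + L * ‖z‖) ^ 2 / (4 * k)) := by
    intro z t
    apply Real.le_sqrt_of_sq_le
    have h1 := (duhamelH_spec (e := e) (lam := lam) hk0 (sq_nonneg _) (hfm z) (hfb z)
      (le_max_right t 0)).2
    rw [hΨf]
    simp only [norm_smul, Real.norm_eq_abs, abs_of_pos (Real.exp_pos _), mul_pow]
    calc _ ≤ Real.exp (-(k * max t 0)) ^ 2 *
          ((M + L * ‖z‖) ^ 2 / (4 * k) * Real.exp (2 * k * max t 0)) := by gcongr
      _ = _ := by linear_combination ((M + L * ‖z‖) ^ 2 / (4 * k)) * hexpm (max t 0)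
  set Ψ : BoundedContinuousFunction ℝ H → BoundedContinuousFunction ℝ H := fun z =>
    BoundedContinuousFunction.ofNormedAddCommGroup (Ψf z) (hcont z) _ (hbound z) with hΨ
  have hcontr : ContractingWith (1 / 2) Ψ := by
    refine ⟨by norm_num, LipschitzWith.of_dist_le_mul fun z w => ?_⟩
    rw [BoundedContinuousFunction.dist_le (by positivity)]
    intro t
    have h1 := duhamelH_sub (e := e) (lam := lam) (B := (M + L * max ‖z‖ ‖w‖) ^ 2) hk0
      (sq_nonneg _) (sq_nonneg _) hl (hfm z) (hfm w)
      (fun s hs => (hfb z s hs).trans (by gcongr; exact le_max_left _ _))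
      (fun s hs => (hfb w s hs).trans (by gcongr; exact le_max_right _ _))
      (hdiff z w) (le_max_right t 0)
    have h2 : (dist (Ψ z t) (Ψ w t)) ^ 2 ≤ (1 / 2 * dist z w) ^ 2 := by
      have : dist (Ψ z t) (Ψ w t) = Real.exp (-(k * max t 0)) *
          ‖duhamelH e lam (f z) (max t 0) - duhamelH e lam (f w) (max t 0)‖ := by
        rw [dist_eq_norm]
        simp only [hΨ, BoundedContinuousFunction.coe_ofNormedAddCommGroup, hΨf]
        rw [← smul_sub, norm_smul, Real.norm_eq_abs, abs_of_pos (Real.exp_pos _)]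
      rw [this, mul_pow]
      calc _ ≤ Real.exp (-(k * max t 0)) ^ 2 *
            ((L * dist z w) ^ 2 / (4 * k) * Real.exp (2 * k * max t 0)) := by gcongr
        _ = (L * dist z w) ^ 2 / (4 * k) := by
          linear_combination ((L * dist z w) ^ 2 / (4 * k)) * hexpm (max t 0)
        _ = _ := by rw [hk]; field_simp; ring
    have h3 := abs_le_of_sq_le_sq h2 (by positivity)
    have : ((1 / 2 : NNReal) : ℝ) = 1 / 2 := by norm_num
    rw [this]
    exact (le_abs_self _).trans h3
  set z := hcontr.fixedPoint Ψ with hz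
  have hfix : Ψ z = z := hcontr.fixedPoint_isFixedPt
  have hzt : ∀ t, 0 ≤ t → Real.exp (k * t) • z t = duhamelH e lam (f z) t := by
    intro t ht
    have h1 : Ψ z t = z t := by rw [hfix]
    rw [← h1]
    simp only [hΨ, BoundedContinuousFunction.coe_ofNormedAddCommGroup, hΨf, max_eq_left ht]
    rw [smul_smul, ← Real.exp_add]; simp
  refine ⟨fun t => Real.exp (k * t) • z t,
    (by fun_prop : Continuous fun s : ℝ => Real.exp (k * s)).smul z.continuous, ?_, fun T hT => ?_⟩
  · simp only
    rw [hzt 0 le_rfl]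
    apply coeff_injective e
    rw [(duhamelH_spec hk0 (sq_nonneg _) (hfm z) (hfb z) le_rfl).1, coeff_zero]
    ext n; simp [duhamel_zero]
  · refine (orbit_duhamelH (hfm z) (hfb z) hT).congr fun t ht => ?_
    simp only
    rw [hzt t ht.1, (duhamelH_spec hk0 (sq_nonneg _) (hfm z) (hfb z) ht.1).1]

end Mild

section Existence

variable {H : Type*} [NormedAddCommGroup H] [InnerProductSpace ℝ H]
  {e : HilbertBasis ℕ ℝ H} {lam : ℕ → ℝ}

/-- The free evolution `exp(-A² t) ξ`. -/
noncomputable def free (lam ξ : ℕ → ℝ) (t : ℝ) : ℕ → ℝ := fun n => duhamel (lam n) (ξ n) 0 t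

theorem free_zero (ξ : ℕ → ℝ) : free lam ξ 0 = ξ := by ext n; simp [free, duhamel_zero]

theorem orbit_free {ξ : ℕ → ℝ} (hξ : Summable fun n => (lam n)⁻¹ * ξ n ^ 2) {T : ℝ} (hT : 0 ≤ T) :
    Orbit lam (free lam ξ) (fun _ => 0) 0 T := by
  refine orbit_duhamel (g := fun _ => 0) hT (fun n => ?_) ⟨fun n => ?_, ?_⟩ hξ
  · simp
  · simp
  · simp [summable_zero]

theorem summable_free (hl : IsSpectrum lam) {ξ : ℕ → ℝ}
    (hξ : Summable fun n => (lam n)⁻¹ * ξ n ^ 2) {t : ℝ}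
    (ht : 0 < t) : Summable fun n => free lam ξ t n ^ 2 :=
  ((orbit_free hξ ht.le).smoothing hl ht).1

theorem continuousOn_free (hl : IsSpectrum lam) {ξ : ℕ → ℝ}
    (hξ : Summable fun n => (lam n)⁻¹ * ξ n ^ 2) :
    ContinuousOn (fun t => toH e (free lam ξ t)) (Ioi 0) := by
  intro t ht
  have ht0 : (0 : ℝ) < t := ht
  have h := ((orbit_free hξ (T := t + 1) (by linarith)).mono hl (s := t / 2) (t := t + 1)
    (by linarith) (by linarith) le_rfl).continuousOn_toH (e := e)
    (summable_free hl hξ (by linarith))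
  exact (h.continuousAt (Icc_mem_nhds (by linarith) (by linarith))).continuousWithinAt

theorem continuous_free {ξ : ℕ → ℝ} (hl : IsSpectrum lam) (hξ : Summable fun n => ξ n ^ 2) :
    Continuous fun t => toH e (free lam ξ (max t 0)) := by
  have h1 : ContinuousOn (fun t => toH e (free lam ξ t)) (Ici 0) := by
    intro t ht
    have ht0 : (0 : ℝ) ≤ t := ht
    have h2 := (orbit_free (summable_neg_of_zero hl hξ)
      (T := t + 1) (by linarith)).continuousOn_toH (e := e) (by simpa [free_zero] using hξ)
    refine ContinuousWithinAt.mono_of_mem_nhdsWithin (h2 t ⟨ht0, by linarith⟩) ?_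
    exact mem_nhdsWithin.2 ⟨Iio (t + 1), isOpen_Iio, by simp, fun x hx => ⟨hx.2, le_of_lt hx.1⟩⟩
  exact h1.comp_continuous (by fun_prop) fun t => le_max_right t 0

theorem summable_free_of_zero {ξ : ℕ → ℝ} (hl : IsSpectrum lam) (hξ : Summable fun n => ξ n ^ 2)
    {t : ℝ} (ht : 0 ≤ t) :
    (Summable fun n => free lam ξ t n ^ 2) ∧ zeroSq (free lam ξ t) ≤ zeroSq ξ := by
  have h := (orbit_free (summable_neg_of_zero hl hξ) ht).zeroSq_le (s := 0) (t := t)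
    (by simpa [free_zero] using hξ) le_rfl ht le_rfl
  refine ⟨h.1, h.2.trans ?_⟩
  simp [free_zero, zeroSq]

/-- Solutions of `y' + A² y + A G(t, y) = 0` with initial value in `H`. -/
theorem exists_mild_init [CompleteSpace H] (hl : IsSpectrum lam) {G : ℝ → H → H} {L M : ℝ}
    (hL : 0 < L) (hM : 0 ≤ M)
    (hLip : ∀ s x y, ‖G s x - G s y‖ ≤ L * ‖x - y‖) (h0 : ∀ s, 0 < s → ‖G s 0‖ ≤ M)
    (hm : ∀ y : ℝ → H, Continuous y →
      AEStronglyMeasurable (fun s => G s (y s)) (volume.restrict (Ioi 0))) (x₀ : H) :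
    ∃ y : ℝ → H, Continuous y ∧ y 0 = x₀ ∧ ∀ T, 0 ≤ T →
      Orbit lam (fun t => coeff e (y t)) (fun t => coeff e (G t (y t))) 0 T := by
  set ξ := coeff e x₀ with hξd
  have hξ := summable_coeff_sq e x₀
  set b : ℝ → H := fun t => toH e (free lam ξ (max t 0)) with hb
  have hbc : Continuous b := continuous_free hl hξ
  have hcoeff : ∀ t, 0 ≤ t → coeff e (b t) = free lam ξ t := fun t ht => by
    simp only [hb, max_eq_left ht]
    exact coeff_toH (summable_free_of_zero hl hξ ht).1
  have hbn : ∀ t, ‖b t‖ ≤ ‖x₀‖ := fun t => by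
    have h1 := summable_free_of_zero hl hξ (le_max_right t 0)
    have h2 : ‖b t‖ ^ 2 ≤ ‖x₀‖ ^ 2 := by
      rw [hb, norm_toH_sq h1.1, ← zeroSq_coeff e x₀]; exact h1.2
    exact (abs_le_of_sq_le_sq h2 (norm_nonneg _)).trans' (le_abs_self _)
  obtain ⟨y, hyc, hy0, hy⟩ := exists_mild (e := e) (lam := lam) hl (G := fun s x => G s (b s + x))
    (L := L) (M := M + L * ‖x₀‖) hL (by positivity)
    (fun s x y => by simpa using hLip s (b s + x) (b s + y))
    (fun s hs => by
      have h1 := hLip s (b s) 0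
      rw [sub_zero] at h1
      have h2 : ‖G s (b s)‖ ≤ ‖G s (b s) - G s 0‖ + ‖G s 0‖ := by
        simpa using norm_add_le (G s (b s) - G s 0) (G s 0)
      have h3 := mul_le_mul_of_nonneg_left (hbn s) hL.le
      simp only [add_zero]
      linarith [h0 s hs])
    (fun y hy => hm _ (hbc.add hy))
  have hb0 : b 0 = x₀ := by
    apply coeff_injective e; rw [hcoeff 0 le_rfl, free_zero]
  refine ⟨fun t => b t + y t, hbc.add hyc, by simp [hy0, hb0], fun T hT => ?_⟩
  have h1 := (orbit_free (summable_neg_of_zero hl hξ) hT).lin hl (hy T hT) 1 1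
  refine (h1.congr fun t ht => ?_).congr_forcing fun n => ae_of_all _ fun t _ => ?_
  · ext n; rw [coeff_add, hcoeff t ht.1]; simp [hξd]
  · simp

/-- For ξ in H^{-1} the free evolution need not lie in H at t = 0. It is split off, and boundedness
of F controls the shifted nonlinearity uniformly for t > 0. -/
theorem exists_solution [CompleteSpace H] (hl : IsSpectrum lam) {F : H → H} {L C : ℝ} (hL : 0 < L)
    (hb : ∀ x, ‖F x‖ ≤ C) (hLip : ∀ x y, ‖F x - F y‖ ≤ L * ‖x - y‖) {ξ : ℕ → ℝ}
    (hξ : Summable fun n => (lam n)⁻¹ * ξ n ^ 2) :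
    ∃ u : ℝ → ℕ → ℝ, u 0 = ξ ∧ ∀ T > 0, IsSolution e lam F u 0 T := by
  have hFc : Continuous F := (LipschitzWith.of_dist_le_mul (K := ⟨L, hL.le⟩) fun x y => by
    rw [dist_eq_norm, dist_eq_norm]; exact hLip x y).continuous
  have hC : 0 ≤ C := (norm_nonneg _).trans (hb 0)
  obtain ⟨y, hyc, hy0, hy⟩ := exists_mild (e := e) (lam := lam) hl
    (G := fun s x => F (toH e (free lam ξ s) + x)) (L := L) (M := C) hL hC
    (fun s x y => by simpa using hLip (toH e (free lam ξ s) + x) (toH e (free lam ξ s) + y))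
    (fun s _ => hb _)
    (fun y hy => (hFc.comp_continuousOn ((continuousOn_free hl hξ).add
      hy.continuousOn)).aestronglyMeasurable measurableSet_Ioi)
  refine ⟨fun t n => free lam ξ t n + coeff e (y t) n, ?_, fun T hT => ?_⟩
  · ext n; simp [free_zero, hy0, coeff_zero]
  · have h1 := (orbit_free hξ hT.le).lin hl (hy T hT.le) 1 1
    refine Orbit.isEnergySolution hl ?_
    refine (h1.congr fun t ht => ?_).congr_forcing fun n => ae_of_all _ fun t ht => ?_
    · ext n; simp
    · have e1 : toH e (fun n => free lam ξ t n + coeff e (y t) n) =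
          toH e (free lam ξ t) + y t := by
        have hs := summable_free hl hξ ht.1
        apply coeff_injective e
        rw [coeff_add, coeff_toH hs]
        exact coeff_toH (zeroSq_add_le hs (summable_coeff_sq e (y t))).1
      simp [e1]

theorem exists_solution_H [CompleteSpace H] (hl : IsSpectrum lam) {F : H → H} {L C : ℝ}
    (hL : 0 < L) (hb : ∀ x, ‖F x‖ ≤ C) (hLip : ∀ x y, ‖F x - F y‖ ≤ L * ‖x - y‖) (x₀ : H) :
    ∃ u : ℝ → H, Continuous u ∧ u 0 = x₀ ∧
      ∀ T > 0, IsSolution e lam F (fun t => coeff e (u t)) 0 T := by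
  have hFc : Continuous F := (LipschitzWith.of_dist_le_mul (K := ⟨L, hL.le⟩) fun x y => by
    rw [dist_eq_norm, dist_eq_norm]; exact hLip x y).continuous
  obtain ⟨y, hyc, hy0, hy⟩ := exists_mild_init (e := e) hl (G := fun _ x => F x) hL
    ((norm_nonneg _).trans (hb 0)) (fun _ => hLip) (fun _ _ => hb 0)
    (fun y hy => (hFc.comp hy).aestronglyMeasurable) x₀
  refine ⟨y, hyc, hy0, fun T hT => ?_⟩
  unfold IsSolution
  simp only [toH_coeff]
  exact (hy T hT.le).isEnergySolution hl

theorem exists_variation [CompleteSpace H] (hl : IsSpectrum lam) {F' : H → H →L[ℝ] H} {L : ℝ}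
    (hL : 0 < L) (hb : ∀ x, ‖F' x‖ ≤ L) (hc : Continuous F') {u : ℝ → H} (hu : Continuous u)
    (x₀ : H) :
    ∃ v : ℝ → H, Continuous v ∧ v 0 = x₀ ∧ ∀ T, 0 ≤ T →
      Orbit lam (fun t => coeff e (v t)) (fun t => coeff e (F' (u t) (v t))) 0 T := by
  refine exists_mild_init (e := e) hl (G := fun t x => F' (u t) x) (M := 0) hL le_rfl
    (fun s x y => ?_) (fun s _ => by simp) (fun y hy => ?_) x₀
  · rw [← map_sub]; exact (F' (u s)).le_of_opNorm_le (hb _) _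
  · exact ((hc.comp hu).clm_apply hy).aestronglyMeasurable

end Existence

/-! ### Regularity of the nonlinearity. -/

section Nonlinearity

variable {H : Type*} [NormedAddCommGroup H] [InnerProductSpace ℝ H] {F : H → H}
  {F' : H → H →L[ℝ] H} {L : ℝ}

theorem IsAdmissible.lipschitz (hF : IsAdmissible F F' L) (x y : H) :
    ‖F x - F y‖ ≤ L * ‖x - y‖ := by
  rw [hF.mean_value x y]
  have := intervalIntegral.norm_integral_le_of_norm_le_const (a := (0 : ℝ)) (b := 1)
    (C := L * ‖x - y‖) (f := fun s : ℝ => F' (s • x + (1 - s) • y) (x - y))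
    fun s _ => (F' _).le_of_opNorm_le (hF.deriv_bound _) _
  simpa using this

/-- For ‖h'‖ = ‖x - y‖ the vector (F'(x) - F'(y))h' is a combination of the Taylor remainders for
the pairs (x, y + h'), (y, y + h') and (x, y), each of order ‖x - y‖^{1+δ}. Homogeneity in h'
removes the restriction on its length. -/
theorem norm_deriv_sub_le {δ CF : ℝ} (hδ : 0 < δ) (hCF : 0 ≤ CF)
    (h : ∀ u₁ u₂ : H, ‖F u₁ - F u₂ - F' u₁ (u₁ - u₂)‖ ≤ CF * ‖u₁ - u₂‖ ^ (1 + δ)) (x y : H) :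
    ‖F' x - F' y‖ ≤ CF * (2 ^ (1 + δ) + 2) * ‖x - y‖ ^ δ := by
  rcases eq_or_ne x y with rfl | hxy
  · simp [Real.zero_rpow hδ.ne']
  set r := ‖x - y‖ with hr
  have hr0 : 0 < r := norm_pos_iff.2 (sub_ne_zero.2 hxy)
  have key : ∀ h' : H, ‖h'‖ = r → ‖(F' x - F' y) h'‖ ≤ CF * (2 ^ (1 + δ) + 2) * r ^ (1 + δ) := by
    intro h' hh
    have h1 := h x (y + h')
    have h2 := h y (y + h')
    have h3 := h x y
    have e1 : ‖x - (y + h')‖ ≤ 2 * r := by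
      calc _ = ‖(x - y) - h'‖ := by congr 1; abel
        _ ≤ _ := by linarith [norm_sub_le (x - y) h']
    have e2 : ‖x - (y + h')‖ ^ (1 + δ) ≤ 2 ^ (1 + δ) * r ^ (1 + δ) := by
      rw [← Real.mul_rpow (by norm_num) hr0.le]
      exact Real.rpow_le_rpow (norm_nonneg _) e1 (by linarith)
    have e3 : ‖y - (y + h')‖ = r := by simp [hh]
    rw [e3] at h2
    have e4 : (F' x - F' y) h' = (F x - F (y + h') - F' x (x - (y + h'))) -
        (F y - F (y + h') - F' y (y - (y + h'))) - (F x - F y - F' x (x - y)) := by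
      simp only [map_sub, map_add, sub_apply]
      abel
    rw [e4]
    calc _ ≤ _ := norm_sub_le _ _
      _ ≤ _ := add_le_add_left (norm_sub_le _ _) _
      _ ≤ CF * (2 ^ (1 + δ) * r ^ (1 + δ)) + CF * r ^ (1 + δ) + CF * r ^ (1 + δ) := by
        gcongr
        exact h1.trans (by gcongr)
      _ = _ := by ring
  refine ContinuousLinearMap.opNorm_le_bound _ (by positivity) fun h' => ?_
  rcases eq_or_ne h' 0 with rfl | hh
  · simp
  have hn : 0 < ‖h'‖ := norm_pos_iff.2 hh
  have h1 := key ((r / ‖h'‖) • h') (by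
    rw [norm_smul, Real.norm_eq_abs, abs_of_pos (by positivity)]; field_simp)
  rw [map_smul, norm_smul, Real.norm_eq_abs, abs_of_pos (by positivity), Real.rpow_add hr0,
    Real.rpow_one] at h1
  have h2 : ‖(F' x - F' y) h'‖ = ‖h'‖ / r * (r / ‖h'‖ * ‖(F' x - F' y) h'‖) := by field_simp
  rw [h2]
  calc _ ≤ ‖h'‖ / r * (CF * (2 ^ (1 + δ) + 2) * (r * r ^ δ)) := by gcongr
    _ = _ := by field_simp

/-- With F' continuous, the forcing F'(u(t))v(t) is continuous in time. Both the solvability of (2)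
and the differentiation of V at the initial time rely on this. -/
theorem continuous_deriv {δ CF : ℝ} (hδ : 0 < δ) (hCF : 0 ≤ CF)
    (h : ∀ u₁ u₂ : H, ‖F u₁ - F u₂ - F' u₁ (u₁ - u₂)‖ ≤ CF * ‖u₁ - u₂‖ ^ (1 + δ)) :
    Continuous F' := by
  refine continuous_iff_continuousAt.2 fun y => ?_
  refine tendsto_iff_norm_sub_tendsto_zero.2 (squeeze_zero (fun _ => norm_nonneg _)
    (fun x => norm_deriv_sub_le hδ hCF h x y) ?_)
  have h1 : Tendsto (fun x : H => ‖x - y‖) (𝓝 y) (𝓝 0) := by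
    have : Continuous fun x : H => ‖x - y‖ := by fun_prop
    simpa using this.tendsto y
  have h2 := (h1.rpow_const (p := δ) (Or.inr hδ.le)).const_mul (CF * (2 ^ (1 + δ) + 2))
  simpa [Real.zero_rpow hδ.ne'] using h2

end Nonlinearity

/-! ### From the differential cone condition to a pointwise inequality. -/

section Reflection

variable {H : Type*} [NormedAddCommGroup H] [InnerProductSpace ℝ H] (e : HilbertBasis ℕ ℝ H)

/-- The reflection `Q_N - P_N`. -/
noncomputable def refl (N : ℕ) (x : H) : H := x - (2 : ℝ) • ∑ n ∈ Finset.range N, coeff e x n • e n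

theorem inner_refl (N : ℕ) (x y : H) :
    HasSum (fun n => sg N n * (coeff e y n * coeff e x n)) ⟪y, refl e N x⟫_ℝ := by
  have h1 := hasSum_coeff_mul e y x
  have h2 : HasSum (fun n => 2 * (cP N n * (coeff e y n * coeff e x n)))
      (2 * ∑ n ∈ Finset.range N, coeff e y n * coeff e x n) := by
    refine HasSum.mul_left 2 ?_
    have : ∑ n ∈ Finset.range N, coeff e y n * coeff e x n =
        ∑ n ∈ Finset.range N, cP N n * (coeff e y n * coeff e x n) := by
      refine Finset.sum_congr rfl fun n hn => ?_
      simp [cP, Finset.mem_range.1 hn]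
    rw [this]
    refine hasSum_sum_of_ne_finset_zero fun n hn => ?_
    simp [cP, Finset.mem_range.not.1 hn]
  have h3 := h1.sub h2
  have e1 : ⟪y, refl e N x⟫_ℝ =
      ⟪y, x⟫_ℝ - 2 * ∑ n ∈ Finset.range N, coeff e y n * coeff e x n := by
    rw [refl, inner_sub_right, inner_smul_right, inner_sum]
    congr 2
    refine Finset.sum_congr rfl fun n _ => ?_
    rw [inner_smul_right, coeff, coeff, real_inner_comm y]; ring
  rw [e1]
  refine h3.congr_fun ?_
  intro n
  unfold sg cP; split_ifs <;> ring

theorem continuous_refl (N : ℕ) : Continuous (refl e N) := by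
  unfold refl coeff; fun_prop

variable {e} {lam : ℕ → ℝ}

theorem summable_sg_one {ξ : ℕ → ℝ} (hξ : Summable fun n => lam n * ξ n ^ 2) (N : ℕ) :
    Summable fun n => sg N n * (lam n * ξ n ^ 2) := by
  refine Summable.of_norm_bounded hξ.norm fun n => ?_
  rw [norm_mul]
  exact mul_le_of_le_one_left (norm_nonneg _) (abs_sg_le N n)

/-- Through the reflection the forcing part is an inner product in H, which passes to limits and
commutes with integrals. -/
theorem wRate_eq (N : ℕ) {x y : H} (hx : Summable fun n => lam n * coeff e x n ^ 2) :
    wRate lam (sg N) (coeff e x) (coeff e y) =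
      -2 * ∑' n, sg N n * (lam n * coeff e x n ^ 2) - 2 * ⟪y, refl e N x⟫_ℝ := by
  have h1 := ((summable_sg_one hx N).hasSum.mul_left (-2)).sub ((inner_refl e N x y).mul_left 2)
  rw [← h1.tsum_eq, wRate]
  congr 1; ext n; ring

end Reflection

section InitialDerivative

variable {lam : ℕ → ℝ} {v g y : ℝ → ℕ → ℝ}

theorem wRate_one_le_add (hl : IsSpectrum lam) {ξ γ : ℕ → ℝ}
    (hξ : Summable fun n => lam n * ξ n ^ 2)
    (hγ : Summable fun n => γ n ^ 2) {κ : ℝ} (hκ : 0 < κ) :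
    wRate lam (fun _ => 1) ξ γ ≤ κ * zeroSq γ + κ⁻¹ * zeroSq ξ := by
  have h0 := summable_zero_of_one hl hξ
  refine hasSum_le (fun n => ?_) (summable_wRate hl hξ hγ (c := fun _ => 1) (by simp)).hasSum
    ((hγ.hasSum.mul_left κ).add (h0.hasSum.mul_left κ⁻¹))
  have e1 : 0 ≤ κ⁻¹ * (κ * γ n + ξ n) ^ 2 := by positivity
  have e2 : κ⁻¹ * (κ * γ n + ξ n) ^ 2 = κ * γ n ^ 2 + 2 * (γ n * ξ n) + κ⁻¹ * ξ n ^ 2 := by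
    field_simp; ring
  have e3 : 0 ≤ lam n * ξ n ^ 2 := mul_nonneg (hl.pos n).le (sq_nonneg _)
  linarith

/-- Orbits that start from zero are small in `H^{-1}`. -/
theorem Orbit.negSq_le_of_zero (hl : IsSpectrum lam) {t K : ℝ} (ht : 0 < t)
    (h : Orbit lam y g 0 t) (h0 : y 0 = 0) (hK : ∀ s ∈ Ioc 0 t, zeroSq (g s) ≤ K) :
    negSq lam (y t) ≤ 3 / 2 * K * (√t * t) := by
  have hX := h.isPrimitive_wForm hl (c := fun _ => 1) (by simp)
  simp only [wForm_one] at hX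
  have hst : 0 < √t := Real.sqrt_pos.2 ht
  have hint : ∀ s ∈ Icc 0 t, ∫ r in (0 : ℝ)..s, zeroSq (g r) ≤ K * t := by
    intro s hs
    have h1 := integral_mono_of_ae_Ioc hs.1 (g := fun _ => K)
      (intervalIntegrable_subinterval h.intervalIntegrable_forcing le_rfl hs.1 hs.2)
      intervalIntegrable_const
      (ae_of_all _ fun r hr => hK r ⟨hr.1, hr.2.trans hs.2⟩)
    rw [intervalIntegral.integral_const, smul_eq_mul, sub_zero] at h1
    have hK0 : 0 ≤ K := (zeroSq_nonneg _).trans (hK t ⟨ht, le_rfl⟩)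
    nlinarith [hs.2]
  have hz : ∀ s ∈ Icc 0 t, zeroSq (y s) ≤ 2⁻¹ * (K * t) := by
    intro s hs
    have h1 := (h.zeroSq_le (s := 0) (t := s) (by simp [h0, summable_zero]) le_rfl hs.1 hs.2).2
    have h2 : zeroSq (y 0) = 0 := by simp [h0, zeroSq]
    have := hint s hs
    linarith
  -- The Young parameter √t balances the forcing, of size K, against the state, whose squared H norm
  -- is at most Kt/2; integration then gives t^{3/2}.
  have h1 := integral_mono_of_ae_Ioc ht.le hX.1
    (g := fun s => √t * K + (√t)⁻¹ * (2⁻¹ * (K * t))) intervalIntegrable_const (by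
    filter_upwards [h.ae_summable_one hl, h.ae_summable_forcing] with s h1 h2 hm
    refine (wRate_one_le_add hl (h1 hm) (h2 hm) hst).trans ?_
    gcongr
    · exact hK s hm
    · exact hz s ⟨hm.1.le, hm.2⟩)
  rw [← hX.sub_eq ht.le, intervalIntegral.integral_const, smul_eq_mul, sub_zero] at h1
  have h3 : negSq lam (y 0) = 0 := by simp [h0, negSq]
  have h4 : (√t)⁻¹ * t = √t := by
    rw [inv_mul_eq_div, div_eq_iff hst.ne', Real.mul_self_sqrt ht.le]
  calc negSq lam (y t) ≤ t * (√t * K + (√t)⁻¹ * (2⁻¹ * (K * t))) := by linarith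
    _ = t * (√t * K) + 2⁻¹ * K * t * ((√t)⁻¹ * t) := by ring
    _ = _ := by rw [h4]; ring

theorem Orbit.hasDerivWithinAt_mode (h : Orbit lam v g 0 1) (n : ℕ)
    (hg : Continuous fun t => g t n) :
    HasDerivWithinAt (fun t => v t n) (-(lam n ^ 2 * v 0 n + lam n * g 0 n)) (Icc 0 1) 0 := by
  have h1 : ContinuousOn (fun t => -(lam n ^ 2 * v t n + lam n * g t n)) (Icc 0 1) :=
    (((h.continuousOn n).const_mul _).add (hg.continuousOn.const_mul _)).neg
  have : Fact ((0 : ℝ) ∈ Icc (0 : ℝ) 1) := ⟨by simp⟩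
  have h2 := intervalIntegral.integral_hasDerivWithinAt_right (a := (0 : ℝ)) (b := 0)
    (s := Icc 0 1) (t := Icc 0 1)
    (f := fun t => -(lam n ^ 2 * v t n + lam n * g t n)) (by simp)
    (h1.stronglyMeasurableAtFilter_nhdsWithin measurableSet_Icc 0) (h1 0 (by simp))
  refine (h2.const_add (v 0 n)).congr (fun t ht => ?_) (by simp)
  exact (h.mode n).2 t ht

theorem hasDerivWithinAt_zero_of_le {f : ℝ → ℝ} {C : ℝ} (h0 : f 0 = 0)
    (h : ∀ t ∈ Ioc (0 : ℝ) 1, |f t| ≤ C * (√t * t)) : HasDerivWithinAt f 0 (Icc 0 1) 0 := by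
  rw [hasDerivWithinAt_iff_isLittleO, Asymptotics.isLittleO_iff]
  intro c hc
  have h1 : Tendsto (fun t => C * √t) (𝓝[Icc 0 1] (0 : ℝ)) (𝓝 0) := by
    have : Continuous fun t : ℝ => C * √t := by fun_prop
    have h2 := (this.tendsto 0).mono_left (nhdsWithin_le_nhds (s := Icc (0 : ℝ) 1))
    simpa using h2
  filter_upwards [h1.eventually (gt_mem_nhds hc), self_mem_nhdsWithin] with t ht hm
  simp only [h0, sub_zero, smul_zero, Real.norm_eq_abs]
  rcases hm.1.eq_or_lt with h3 | h3
  · rw [← h3, h0]; simp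
  · refine (h t ⟨h3, hm.2⟩).trans ?_
    rw [abs_of_pos h3, ← mul_assoc]
    gcongr

/-- The cone form is differentiable at the initial time if the initial value has finitely many
modes. -/
theorem Orbit.hasDerivWithinAt_wForm (hl : IsSpectrum lam) (h : Orbit lam v g 0 1) {m : ℕ} {K : ℝ}
    (hm : ∀ n, m ≤ n → v 0 n = 0) (hg : ∀ n, Continuous fun t => g t n)
    (hK : ∀ s ∈ Icc (0 : ℝ) 1, zeroSq (g s) ≤ K) {c : ℕ → ℝ} (hc : ∀ n, |c n| ≤ 1) :
    HasDerivWithinAt (fun t => wForm lam c (v t)) (wRate lam c (v 0) (g 0)) (Icc 0 1) 0 := by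
  have hf : Orbit lam (free lam (v 0)) (fun _ => 0) 0 1 := orbit_free h.init zero_le_one
  have hy := h.sub hl hf
  -- The difference y starts from zero, so its form is O(t^{3/2}) and has derivative 0. The free
  -- evolution has no modes beyond m, so the forms of v and y differ by a finite sum of
  -- differentiable terms.
  set y : ℝ → ℕ → ℝ := fun t => v t - free lam (v 0) t with hyd
  have hy0 : y 0 = 0 := by simp [hyd, free_zero]
  have hyv : ∀ t n, m ≤ n → y t n = v t n := fun t n hn => by
    simp [hyd, free, duhamel, hm n hn]
  have hg' : ∀ n, Continuous fun t => (fun t => g t - (0 : ℕ → ℝ)) t n := fun n => by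
    simpa using hg n
  have hK0 : 0 ≤ K := (zeroSq_nonneg _).trans (hK 0 (by simp))
  have d1 : HasDerivWithinAt (fun t => wForm lam c (y t)) 0 (Icc 0 1) 0 := by
    refine hasDerivWithinAt_zero_of_le (C := 3 / 2 * K) ?_ fun t ht => ?_
    · simp [hy0, wForm]
    · have h1 := hy.mono hl le_rfl ht.1.le ht.2
      refine (abs_wForm_le hl (h1.mem_neg hl (right_mem_Icc.2 ht.1.le)) hc).trans ?_
      exact h1.negSq_le_of_zero hl ht.1 hy0 fun s hs => by
        simpa using hK s ⟨hs.1.le, hs.2.trans ht.2⟩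
  have d2 : ∀ n, HasDerivWithinAt (fun t => c n * (lam n)⁻¹ * (v t n ^ 2 - y t n ^ 2))
      (c n * (-2 * (lam n * v 0 n ^ 2) - 2 * (g 0 n * v 0 n))) (Icc 0 1) 0 := by
    intro n
    have h1 := h.hasDerivWithinAt_mode n (hg n)
    have h2 := hy.hasDerivWithinAt_mode n (hg' n)
    have h3 := ((h1.pow 2).sub (h2.pow 2)).const_mul (c n * (lam n)⁻¹)
    convert! h3 using 1
    have := (hl.pos n).ne'
    simp only [hy0, Pi.zero_apply]
    field_simp
    ring
  have d3 : HasDerivWithinAt (fun t => ∑ n ∈ Finset.range m,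
      c n * (lam n)⁻¹ * (v t n ^ 2 - y t n ^ 2)) (wRate lam c (v 0) (g 0)) (Icc 0 1) 0 := by
    have h1 := HasDerivWithinAt.fun_sum (u := Finset.range m) fun n _ => d2 n
    convert! h1 using 1
    refine tsum_eq_sum fun n hn => ?_
    rw [hm n (by simpa using hn)]; ring
  have d4 := d3.add d1
  rw [add_zero] at d4
  have heq : ∀ t ∈ Icc (0 : ℝ) 1, wForm lam c (v t) =
      ∑ n ∈ Finset.range m, c n * (lam n)⁻¹ * (v t n ^ 2 - y t n ^ 2) + wForm lam c (y t) := by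
    intro t ht
    have s1 := summable_wForm hl (h.mem_neg hl ht) hc
    have s2 := summable_wForm hl (hy.mem_neg hl ht) hc
    have : wForm lam c (v t) - wForm lam c (y t) =
        ∑ n ∈ Finset.range m, c n * (lam n)⁻¹ * (v t n ^ 2 - y t n ^ 2) := by
      unfold wForm
      rw [← s1.tsum_sub s2, tsum_eq_sum (s := Finset.range m)]
      · exact Finset.sum_congr rfl fun n _ => by ring
      · intro n hn
        rw [hyv t n (by simpa using hn), sub_self]
    linarith
  exact d4.congr heq (heq 0 (by simp))

end InitialDerivative

/-- The nonlinearity `F` with derivative `F'` satisfies the strong cone condition pointwise. -/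
structure ConeSystem {H : Type*} [NormedAddCommGroup H] [InnerProductSpace ℝ H]
    [MeasurableSpace H] (P : ConeParams) (e : HilbertBasis ℕ ℝ H)
    (F : H → H) (F' : H → H →L[ℝ] H) (α : H → ℝ) (C : ℝ) : Prop where
  bound : ∀ x, ‖F x‖ ≤ C
  lip : ∀ x y, ‖F x - F y‖ ≤ P.L * ‖x - y‖
  deriv : ∀ x, ‖F' x‖ ≤ P.L
  deriv_cont : Continuous F'
  α_meas : Measurable α
  α_mem : ∀ x, P.αm ≤ α x ∧ α x ≤ P.αp
  cone : ∀ u x, (Summable fun n => P.lam n * coeff e x n ^ 2) →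
    wRate P.lam (sg P.N) (coeff e x) (coeff e (F' u x)) + α u * P.V (coeff e x) ≤ -P.μ * ‖x‖ ^ 2
  cone_diff : ∀ x y, (Summable fun n => P.lam n * coeff e (x - y) n ^ 2) →
    wRate P.lam (sg P.N) (coeff e (x - y)) (coeff e (F x - F y)) +
      min (P.αm * P.V (coeff e (x - y))) (P.αp * P.V (coeff e (x - y))) ≤ -P.μ * ‖x - y‖ ^ 2

section Reflection

variable {H : Type*} [NormedAddCommGroup H] [InnerProductSpace ℝ H] (e : HilbertBasis ℕ ℝ H)

theorem coeff_sum_basis (m n : ℕ) (x : H) :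
    coeff e (∑ n ∈ Finset.range m, coeff e x n • e n) n = if n < m then coeff e x n else 0 := by
  simp only [coeff, inner_sum, inner_smul_right]
  simp only [orthonormal_iff_ite.1 e.orthonormal, mul_ite, mul_one, mul_zero,
    Finset.sum_ite_eq, Finset.mem_range]

theorem coeff_refl (N n : ℕ) (x : H) : coeff e (refl e N x) n = sg N n * coeff e x n := by
  rw [refl, coeff_sub, coeff_smul, Pi.sub_apply, Pi.smul_apply, coeff_sum_basis, smul_eq_mul]
  unfold sg; split_ifs <;> ring

theorem norm_refl (N : ℕ) (x : H) : ‖refl e N x‖ = ‖x‖ := by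
  have h : ‖refl e N x‖ ^ 2 = ‖x‖ ^ 2 := by
    rw [← zeroSq_coeff e, ← zeroSq_coeff e, zeroSq, zeroSq]
    congr 1; ext n
    rw [coeff_refl]; unfold sg; split_ifs <;> ring
  exact (sq_eq_sq₀ (norm_nonneg _) (norm_nonneg _)).1 h

end Reflection

section Pointwise

variable {H : Type*} [NormedAddCommGroup H] [InnerProductSpace ℝ H]
  {e : HilbertBasis ℕ ℝ H} {lam : ℕ → ℝ} {N : ℕ} {F : H → H} {F' : H → H →L[ℝ] H} {L : ℝ}

/-- Any u₀ in H and any x with finitely many modes occur as initial values of a trajectory and of a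
solution of (2). The cone inequality at t = 0, with the one-sided derivative, involves these values
only. -/
theorem cone_of_finite [CompleteSpace H] (hl : IsSpectrum lam) {C μ : ℝ} {α : H → ℝ} (hL : 0 < L)
    (hb : ∀ x, ‖F x‖ ≤ C) (hLip : ∀ x y, ‖F x - F y‖ ≤ L * ‖x - y‖)
    (hb' : ∀ x, ‖F' x‖ ≤ L) (hc : Continuous F')
    (hcone : ∀ T > 0, ∀ u : ℝ → H, ContinuousOn u (Icc 0 T) →
      IsSolution e lam F (fun t => coeff e (u t)) 0 T →
      ∀ v : ℝ → ℕ → ℝ, IsVariationSolution e lam F' u v 0 T →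
      ∀ t ∈ Icc 0 T, MemHs lam 0 (v t) →
      ∀ D : ℝ, HasDerivWithinAt (fun s => coneForm lam N (v s)) D (Icc 0 T) t →
        D + α (u t) * coneForm lam N (v t) ≤ -μ * normHs lam 0 (v t) ^ 2)
    (u₀ x : H) {m : ℕ} (hm : ∀ n, m ≤ n → coeff e x n = 0) :
    wRate lam (sg N) (coeff e x) (coeff e (F' u₀ x)) + α u₀ * wForm lam (sg N) (coeff e x) ≤
      -μ * ‖x‖ ^ 2 := by
  obtain ⟨u, huc, hu0, hu⟩ := exists_solution_H (e := e) hl hL hb hLip u₀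
  obtain ⟨v, hvc, hv0, hv⟩ := exists_variation (e := e) (lam := lam) hl hL hb' hc huc x
  have h := hv 1 zero_le_one
  have hfc : Continuous fun t => F' (u t) (v t) := (hc.comp huc).clm_apply hvc
  obtain ⟨K, hK⟩ := isCompact_Icc.exists_bound_of_continuousOn (s := Icc (0 : ℝ) 1)
    (f := fun t => ‖F' (u t) (v t)‖ ^ 2) ((hfc.norm.pow 2).continuousOn)
  have hD := h.hasDerivWithinAt_wForm hl (m := m) (K := K) (c := sg N)
    (fun n hn => by rw [hv0]; exact hm n hn) (fun n => (continuous_coeff e n).comp hfc)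
    (fun s hs => by rw [zeroSq_coeff]; exact (le_abs_self _).trans (hK s hs)) (abs_sg_le N)
  have hvs : IsVariationSolution e lam F' u (fun t => coeff e (v t)) 0 1 := by
    unfold IsVariationSolution
    simp only [toH_coeff]
    exact h.isEnergySolution hl
  have hcf : ∀ s ∈ Icc (0 : ℝ) 1, coneForm lam N (coeff e (v s)) = wForm lam (sg N) (coeff e (v s)) :=
    fun s hs => coneForm_eq hl (h.mem_neg hl hs) N
  have := hcone 1 one_pos u huc.continuousOn (hu 1 one_pos) _ hvs 0 (by simp)
    (memHs_zero.2 (summable_coeff_sq e _)) _ (hD.congr hcf (hcf 0 (by simp)))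
  rw [hcf 0 (by simp), normHs_zero_sq, zeroSq_coeff, hu0, hv0] at this
  exact this

/-- Truncation to the first m modes: the diagonal sums become partial sums of convergent series, and
the term with the bounded operator is continuous in H. -/
theorem cone_of_summable (hl : IsSpectrum lam) {μ a : ℝ} {B : H →L[ℝ] H}
    (h : ∀ x m, (∀ n, m ≤ n → coeff e x n = 0) →
      wRate lam (sg N) (coeff e x) (coeff e (B x)) + a * wForm lam (sg N) (coeff e x) ≤
        -μ * ‖x‖ ^ 2) (x : H) (hx : Summable fun n => lam n * coeff e x n ^ 2) :
    wRate lam (sg N) (coeff e x) (coeff e (B x)) + a * wForm lam (sg N) (coeff e x) ≤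
      -μ * ‖x‖ ^ 2 := by
  set X : ℕ → H := fun m => ∑ n ∈ Finset.range m, coeff e x n • e n with hX
  have hcX : ∀ m n, coeff e (X m) n = if n < m then coeff e x n else 0 := fun m n => by
    exact coeff_sum_basis e m n x
  have hXlim : Tendsto X atTop (𝓝 x) := by
    have := (e.hasSum_repr x).tendsto_sum_nat
    simp only [HilbertBasis.repr_apply_apply] at this
    exact this
  have hsX : ∀ m, Summable fun n => lam n * coeff e (X m) n ^ 2 := fun m => by
    refine summable_of_ne_finset_zero (s := Finset.range m) fun n hn => ?_
    rw [hcX, if_neg (by simpa using hn)]; ring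
  have partial_sum : ∀ (w : ℕ → ℝ) m, ∑' n, w n * coeff e (X m) n ^ 2 =
      ∑ n ∈ Finset.range m, w n * coeff e x n ^ 2 := by
    intro w m
    rw [tsum_eq_sum (s := Finset.range m)]
    · refine Finset.sum_congr rfl fun n hn => ?_
      rw [hcX, if_pos (by simpa using hn)]
    · intro n hn
      rw [hcX, if_neg (by simpa using hn)]; ring
  have t1 : Tendsto (fun m => ∑' n, sg N n * (lam n * coeff e (X m) n ^ 2)) atTop
      (𝓝 (∑' n, sg N n * (lam n * coeff e x n ^ 2))) := by
    have h1 := (summable_sg_one hx N).hasSum.tendsto_sum_nat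
    simp only [← mul_assoc] at h1 ⊢
    simp only [partial_sum]
    exact h1
  have t2 : Tendsto (fun m => wForm lam (sg N) (coeff e (X m))) atTop
      (𝓝 (wForm lam (sg N) (coeff e x))) := by
    have h1 := (summable_wForm hl (summable_neg_of_zero hl (summable_coeff_sq e x))
      (abs_sg_le N)).hasSum.tendsto_sum_nat
    unfold wForm
    simp only [← mul_assoc] at h1 ⊢
    simp only [partial_sum]
    exact h1
  have t3 : Tendsto (fun m => ⟪B (X m), refl e N (X m)⟫_ℝ) atTop (𝓝 ⟪B x, refl e N x⟫_ℝ) := by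
    have : Continuous fun z => ⟪B z, refl e N z⟫_ℝ := B.continuous.inner (continuous_refl e N)
    exact (this.tendsto x).comp hXlim
  have t4 : Tendsto (fun m => -μ * ‖X m‖ ^ 2) atTop (𝓝 (-μ * ‖x‖ ^ 2)) :=
    (hXlim.norm.pow 2).const_mul _
  rw [wRate_eq N hx]
  refine le_of_tendsto_of_tendsto' (((t1.const_mul (-2)).sub (t3.const_mul 2)).add
    (t2.const_mul a)) t4 fun m => ?_
  rw [← wRate_eq N (hsX m)]
  exact h (X m) m fun n hn => by rw [hcX, if_neg (not_lt.2 hn)]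

/-- The pointwise inequality is averaged over the segment by the integral mean value formula. The
vector x - y stays fixed while α varies along the segment, so only the smaller of α₋V and α₊V
survives. -/
theorem cone_diff_of_cone [CompleteSpace H] {μ αm αp : ℝ} {α : H → ℝ} (hF : IsAdmissible F F' L)
    (hα : ∀ x, αm ≤ α x ∧ α x ≤ αp)
    (h : ∀ u x, (Summable fun n => lam n * coeff e x n ^ 2) →
      wRate lam (sg N) (coeff e x) (coeff e (F' u x)) + α u * wForm lam (sg N) (coeff e x) ≤
        -μ * ‖x‖ ^ 2) (x y : H) (hx : Summable fun n => lam n * coeff e (x - y) n ^ 2) :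
    wRate lam (sg N) (coeff e (x - y)) (coeff e (F x - F y)) +
      min (αm * wForm lam (sg N) (coeff e (x - y))) (αp * wForm lam (sg N) (coeff e (x - y))) ≤
        -μ * ‖x - y‖ ^ 2 := by
  set V := wForm lam (sg N) (coeff e (x - y)) with hV
  have hmin : ∀ u, min (αm * V) (αp * V) ≤ α u * V := fun u => by
    rcases le_total 0 V with h0 | h0
    · exact (min_le_left _ _).trans (mul_le_mul_of_nonneg_right (hα u).1 h0)
    · exact (min_le_right _ _).trans (mul_le_mul_of_nonpos_right (hα u).2 h0)
  set A := ∑' n, sg N n * (lam n * coeff e (x - y) n ^ 2) with hA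
  have key : ∀ s : ℝ, (-μ * ‖x - y‖ ^ 2 - min (αm * V) (αp * V) + 2 * A) / (-2) ≤
      ⟪refl e N (x - y), F' (s • x + (1 - s) • y) (x - y)⟫_ℝ := by
    intro s
    have h1 := h (s • x + (1 - s) • y) (x - y) hx
    rw [wRate_eq N hx, real_inner_comm] at h1
    have h2 := hmin (s • x + (1 - s) • y)
    rw [div_le_iff_of_neg (by norm_num)]
    linarith
  have hint := hF.integrable x y
  have h2 : ⟪refl e N (x - y), F x - F y⟫_ℝ =
      ∫ s in (0 : ℝ)..1, ⟪refl e N (x - y), F' (s • x + (1 - s) • y) (x - y)⟫_ℝ := by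
    rw [hF.mean_value x y]
    exact ((innerSL ℝ (refl e N (x - y))).intervalIntegral_comp_comm hint).symm
  have h3 := intervalIntegral.integral_mono_on zero_le_one intervalIntegrable_const
    ⟨(innerSL ℝ (refl e N (x - y))).integrable_comp hint.1,
      (innerSL ℝ (refl e N (x - y))).integrable_comp hint.2⟩ fun s _ => key s
  rw [intervalIntegral.integral_const] at h3
  simp only [sub_zero, one_smul, innerSL_apply_apply] at h3
  rw [← h2, div_le_iff_of_neg (by norm_num), real_inner_comm] at h3
  rw [wRate_eq N hx]
  linarith

end Pointwise

theorem isSpectrum_of_eigenbasis {H : Type*} [NormedAddCommGroup H] [InnerProductSpace ℝ H]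
    [CompleteSpace H] {A : H →ₗ.[ℝ] H} (hA : IsPositiveWithCompactInverse A)
    {e : HilbertBasis ℕ ℝ H} {lam : ℕ → ℝ} (he : IsEigenbasis A e lam) : IsSpectrum lam := by
  refine ⟨?_, he.mono⟩
  obtain ⟨h, h1⟩ := he.eigen 0
  have hn : ‖e 0‖ = 1 := e.orthonormal.1 0
  have h2 := hA.positive ⟨e 0, h⟩ (fun hc => by
    have : e 0 = 0 := congrArg Subtype.val hc
    rw [this] at hn; simp at hn)
  rw [h1, real_inner_smul_left, real_inner_self_eq_norm_sq, hn] at h2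
  simpa using h2

theorem exists_coneSystem {H : Type*} [NormedAddCommGroup H] [InnerProductSpace ℝ H]
    [CompleteSpace H] [MeasurableSpace H]
    {e : HilbertBasis ℕ ℝ H} {lam : ℕ → ℝ} (hl : IsSpectrum lam) (N : ℕ)
    {F : H → H} {F' : H → H →L[ℝ] H} {L : ℝ} (hF : IsAdmissible F F' L)
    (hcone : StrongCone e lam N F F') (hc : Continuous F') :
    ∃ P : ConeParams, P.lam = lam ∧ P.N = N ∧ ∃ α C, ConeSystem P e F F' α C := by
  obtain ⟨μ, hμ, α, hαm, ⟨am, ap, ham, hα⟩, hcone⟩ := hcone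
  obtain ⟨C, hC⟩ := hF.bounded
  have hL0 : 0 ≤ L := (norm_nonneg _).trans (hF.deriv_bound 0)
  -- The constant L + 1 is used in place of L because a strictly positive one is needed.
  have hlip : ∀ x y, ‖F x - F y‖ ≤ (L + 1) * ‖x - y‖ := fun x y =>
    (hF.lipschitz x y).trans (mul_le_mul_of_nonneg_right (by linarith) (norm_nonneg _))
  have hd : ∀ x, ‖F' x‖ ≤ L + 1 := fun x => (hF.deriv_bound x).trans (by linarith)
  have hpt : ∀ u x, (Summable fun n => lam n * coeff e x n ^ 2) →
      wRate lam (sg N) (coeff e x) (coeff e (F' u x)) + α u * wForm lam (sg N) (coeff e x) ≤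
        -μ * ‖x‖ ^ 2 := fun u x hx =>
    cone_of_summable hl (fun x m hm => cone_of_finite hl (by linarith) hC hlip hd hc hcone u x hm)
      x hx
  refine ⟨⟨lam, N, L + 1, am, ap, μ, hl, by linarith, ham, (hα 0).1.trans (hα 0).2, hμ⟩, rfl, rfl,
    α, C, hC, hlip, hd, hc, hαm, hα, hpt, cone_diff_of_cone hF hα hpt⟩

/-! ### The spectral gap forced by the strong cone condition. -/

section Gap

variable {H : Type*} [NormedAddCommGroup H] [InnerProductSpace ℝ H] [MeasurableSpace H]
  {P : ConeParams} {e : HilbertBasis ℕ ℝ H} {F : H → H} {F' : H → H →L[ℝ] H} {α : H → ℝ} {C : ℝ}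

/-- The spectral gap. -/
theorem ConeSystem.gap (h : ConeSystem P e F F' α C) (hN : 1 ≤ P.N) :
    P.lam (P.N - 1) < P.lam P.N := by
  refine lt_of_le_of_ne (P.spec.mono (Nat.sub_le _ _)) fun heq => ?_
  set N := P.N with hNd
  set i := N - 1 with hi
  have hiN : i ≠ N := by omega
  have hcoef : ∀ s : ℝ, ∀ n, coeff e (s • (e i + e N)) n = if n = i then s else if n = N then s else 0 := by
    intro s n
    have := orthonormal_iff_ite.1 e.orthonormal
    simp only [coeff, inner_smul_right, inner_add_right, this]
    by_cases h1 : n = i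
    · have : n ≠ N := by omega
      simp [h1, hiN]
    · simp [h1]
  have hout : ∀ s : ℝ, ∀ n ∉ ({i, N} : Finset ℕ), coeff e (s • (e i + e N)) n = 0 := by
    intro s n hn
    simp only [Finset.mem_insert, Finset.mem_singleton, not_or] at hn
    rw [hcoef, if_neg hn.1, if_neg hn.2]
  have hsg : sg N i = -1 ∧ sg N N = 1 := by
    constructor
    · simp only [sg]; rw [if_pos (by omega)]
    · simp [sg]
  have hsum : ∀ (s : ℝ) (f : ℕ → ℝ → ℝ), (∀ n, f n 0 = 0) →
      ∑' n, f n (coeff e (s • (e i + e N)) n) = f i s + f N s := by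
    intro s f hf
    rw [tsum_eq_sum (s := {i, N}) fun n hn => by rw [hout s n hn, hf], Finset.sum_pair hiN, hcoef,
      hcoef]
    simp [hiN.symm]
  -- With equal eigenvalues both V and the linear part of its rate vanish on this vector. Then 2μs²
  -- is bounded by the forcing term, which is at most linear in s because F is bounded; large s
  -- gives the contradiction.
  have key : ∀ s : ℝ, 2 * P.μ * s ^ 2 ≤ 2 * (2 * C) * (2 * |s|) := by
    intro s
    set x := s • (e i + e N) with hx
    have hs : Summable fun n => P.lam n * coeff e x n ^ 2 :=
      summable_of_ne_finset_zero (s := {i, N}) fun n hn => by rw [hout s n hn]; ring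
    have hnorm : ‖x‖ ^ 2 = 2 * s ^ 2 := by
      rw [← zeroSq_coeff e, zeroSq, hsum s (fun _ z => z ^ 2) (by simp)]; ring
    have hV : P.V (coeff e x) = 0 := by
      rw [ConeParams.V, wForm, hsum s (fun n z => sg P.N n * ((P.lam n)⁻¹ * z ^ 2)) (by simp),
        ← hNd, hsg.1, hsg.2, heq]; ring
    have h1 := h.cone_diff x 0 (by simpa using hs)
    rw [sub_zero, hV, mul_zero, mul_zero, min_self, add_zero, wRate_eq _ hs,
      hsum s (fun n z => sg P.N n * (P.lam n * z ^ 2)) (by simp), ← hNd, hsg.1, hsg.2, heq] at h1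
    have hr : ‖refl e N x‖ ≤ 2 * |s| := by
      rw [norm_refl]
      refine le_trans (le_abs_self _) (abs_le_of_sq_le_sq ?_ (by positivity))
      rw [hnorm, mul_pow, sq_abs]; nlinarith [sq_nonneg s]
    have h4 : ⟪F x - F 0, refl e N x⟫_ℝ ≤ (2 * C) * (2 * |s|) := by
      refine (real_inner_le_norm _ _).trans ?_
      have : ‖F x - F 0‖ ≤ 2 * C := (norm_sub_le _ _).trans (by linarith [h.bound x, h.bound 0])
      have h5 : 0 ≤ 2 * C := (norm_nonneg _).trans this
      gcongr
    rw [hnorm] at h1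
    linarith
  have hC : 0 ≤ C := (norm_nonneg _).trans (h.bound 0)
  have hμ := P.μ_pos
  have := key (4 * C / P.μ + 1)
  rw [abs_of_pos (by positivity)] at this
  have h6 : P.μ * (4 * C / P.μ + 1) = 4 * C + P.μ := by field_simp
  have h7 : 0 < 4 * C / P.μ + 1 := by positivity
  nlinarith

end Gap

theorem IsPrimitive.le_of_rate_le {X k : ℝ → ℝ} {a b β K : ℝ} (hX : IsPrimitive X k a b)
    (hab : a ≤ b) (hβ : 0 < β) (hK : 0 ≤ K)
    (h : ∀ᵐ t, t ∈ Ioc a b → k t + β * X t ≤ K) :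
    X b ≤ Real.exp (-(β * (b - a))) * X a + K / β := by
  have h1 : IsPrimitive (fun _ : ℝ => -(K / β)) (fun _ => 0) a b :=
    IsPrimitive.of_hasDerivAt (fun t => hasDerivAt_const t _) continuous_const
  have h2 := (hX.add h1).gronwall_const (β := β) (R := fun _ => 0) hab intervalIntegrable_const (by
    filter_upwards [h] with t ht hm
    have := ht hm
    have e : β * (X t + -(K / β)) = β * X t - K := by field_simp; ring
    rw [e]; linarith)
  simp only [mul_zero, intervalIntegral.integral_zero, add_zero] at h2
  have h3 : 0 ≤ Real.exp (-(β * (b - a))) * (K / β) := by positivity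
  linarith

/-! ### The semigroup on H^{-1} and backward trajectories. -/

section Solutions

variable {H : Type*} [NormedAddCommGroup H] [InnerProductSpace ℝ H]
  {e : HilbertBasis ℕ ℝ H} {lam : ℕ → ℝ} {F : H → H} {C : ℝ} {u w : ℝ → ℕ → ℝ} {a b s t : ℝ}

theorem Orbit.isSolution (hl : IsSpectrum lam)
    (h : Orbit lam u (fun t => coeff e (F (toH e (u t)))) a b) : IsSolution e lam F u a b :=
  h.isEnergySolution hl

theorem IsSolution.mono (hl : IsSpectrum lam) (hF : ∀ x, ‖F x‖ ≤ C) (h : IsSolution e lam F u a b)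
    (hs : a ≤ s) (hst : s ≤ t) (ht : t ≤ b) : IsSolution e lam F u s t :=
  ((h.orbit hl (hs.trans (hst.trans ht)) hF).mono hl hs hst ht).isSolution hl

theorem IsSolution.shift (hl : IsSpectrum lam) (hF : ∀ x, ‖F x‖ ≤ C) (hab : a ≤ b)
    (h : IsSolution e lam F u a b) (τ : ℝ) :
    IsSolution e lam F (fun t => u (t + τ)) (a - τ) (b - τ) :=
  ((h.orbit hl hab hF).shift τ).isSolution hl

theorem IsSolution.congr (hl : IsSpectrum lam) (hF : ∀ x, ‖F x‖ ≤ C) (hab : a ≤ b)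
    (h : IsSolution e lam F u a b) (huw : ∀ t ∈ Icc a b, u t = w t) : IsSolution e lam F w a b := by
  refine Orbit.isSolution hl (((h.orbit hl hab hF).congr huw).congr_forcing fun n =>
    ae_of_all _ fun t ht => ?_)
  rw [huw t ⟨ht.1.le, ht.2⟩]

end Solutions

namespace ConeSystem

variable {H : Type*} [NormedAddCommGroup H] [InnerProductSpace ℝ H] [MeasurableSpace H]
  {P : ConeParams} {e : HilbertBasis ℕ ℝ H} {F : H → H} {F' : H → H →L[ℝ] H} {α : H → ℝ} {C : ℝ}
  {u w : ℝ → ℕ → ℝ} {a b s t : ℝ} {ξ η : ℕ → ℝ}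

theorem orbit (S : ConeSystem P e F F' α C) (hab : a ≤ b) (h : IsSolution e P.lam F u a b) :
    Orbit P.lam u (fun t => coeff e (F (toH e (u t)))) a b := h.orbit P.spec hab S.bound

/-- The difference of two solutions satisfies the cone inequality. -/
theorem coneOrbit (S : ConeSystem P e F F' α C) (hab : a ≤ b) (hu : IsSolution e P.lam F u a b)
    (hw : IsSolution e P.lam F w a b) :
    ConeOrbit P (fun t => u t - w t)
      (fun t => coeff e (F (toH e (u t))) - coeff e (F (toH e (w t)))) a b := by
  have ou := S.orbit hab hu
  have ow := S.orbit hab hw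
  have o := ou.sub P.spec ow
  refine ⟨⟨o, ?_⟩, ?_⟩
  · filter_upwards [ou.ae_summable_one P.spec, ow.ae_summable_one P.spec] with t h1 h2 hm
    have s1 := summable_zero_of_one P.spec (h1 hm)
    have s2 := summable_zero_of_one P.spec (h2 hm)
    rw [← coeff_sub, zeroSq_coeff, ← norm_toH_sq (e := e) (zeroSq_sub_le s1 s2).1, toH_sub s1 s2,
      ← mul_pow]
    exact pow_le_pow_left₀ (norm_nonneg _) (S.lip _ _) 2
  · filter_upwards [ou.ae_summable_one P.spec, ow.ae_summable_one P.spec,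
      o.ae_summable_one P.spec] with t h1 h2 h3 hm
    have s1 := summable_zero_of_one P.spec (h1 hm)
    have s2 := summable_zero_of_one P.spec (h2 hm)
    have e1 : coeff e (toH e (u t) - toH e (w t)) = u t - w t := by
      rw [coeff_sub, coeff_toH s1, coeff_toH s2]
    have := S.cone_diff (toH e (u t)) (toH e (w t)) (by rw [e1]; exact h3 hm)
    rw [← zeroSq_coeff e, e1, coeff_sub] at this
    exact this

theorem solution_unique (S : ConeSystem P e F F' α C) (hab : a ≤ b)
    (hu : IsSolution e P.lam F u a b) (hw : IsSolution e P.lam F w a b) (h : u a = w a)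
    (ht : t ∈ Icc a b) : u t = w t :=
  sub_eq_zero.1 ((S.coneOrbit hab hu hw).eq_zero (by simp [h]) ht)

/-- The semigroup on `H^{-1}`. -/
noncomputable def flow (_ : ConeSystem P e F F' α C) (t : ℝ) (ξ : ℕ → ℝ) : ℕ → ℝ :=
  solutionMap e P.lam F t ξ

variable [CompleteSpace H]

theorem flow_spec (S : ConeSystem P e F F' α C) (hξ : Summable fun n => (P.lam n)⁻¹ * ξ n ^ 2) :
    S.flow 0 ξ = ξ ∧ ∀ T, 0 ≤ T → IsSolution e P.lam F (fun t => S.flow t ξ) 0 T := by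
  have h := exists_solution (e := e) (lam := P.lam) P.spec P.L_pos S.bound S.lip hξ
  have h1 : ∀ t, S.flow t ξ = h.choose t := fun t => by
    rw [flow, solutionMap, dif_pos h]
  have h3 : ∀ T > 0, IsSolution e P.lam F (fun t => S.flow t ξ) 0 T := fun T hT => by
    simp only [h1]; exact h.choose_spec.2 T hT
  refine ⟨by rw [h1]; exact h.choose_spec.1, fun T hT => ?_⟩
  exact (h3 (T + 1) (by linarith)).mono P.spec S.bound le_rfl hT (by linarith)

theorem flow_zero (S : ConeSystem P e F F' α C)
    (hξ : Summable fun n => (P.lam n)⁻¹ * ξ n ^ 2) : S.flow 0 ξ = ξ := (S.flow_spec hξ).1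

theorem flow_mem (S : ConeSystem P e F F' α C) (hξ : Summable fun n => (P.lam n)⁻¹ * ξ n ^ 2)
    (ht : 0 ≤ t) : Summable fun n => (P.lam n)⁻¹ * S.flow t ξ n ^ 2 := by
  have h : IsSolution e P.lam F (fun t => S.flow t ξ) 0 t := (S.flow_spec hξ).2 t ht
  have h1 := (S.orbit ht h).mem_neg (t := t) P.spec (right_mem_Icc.2 ht)
  exact h1

theorem eq_flow (S : ConeSystem P e F F' α C) (h : IsSolution e P.lam F u a b) (ht : t ∈ Icc a b) :
    u t = S.flow (t - a) (u a) := by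
  have hab := ht.1.trans ht.2
  have hm := (S.orbit hab h).init
  have h1 := ((S.flow_spec hm).2 (b - a) (by linarith)).shift P.spec S.bound (by linarith) (-a)
  have e1 : (0 : ℝ) - -a = a := by ring
  have e2 : b - a - -a = b := by ring
  rw [e1, e2] at h1
  have := S.solution_unique hab h h1 (by simp [S.flow_zero hm]) ht
  rw [this, sub_eq_add_neg]

theorem flow_add (S : ConeSystem P e F F' α C) (hξ : Summable fun n => (P.lam n)⁻¹ * ξ n ^ 2)
    (hs : 0 ≤ s) (ht : 0 ≤ t) : S.flow (s + t) ξ = S.flow s (S.flow t ξ) := by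
  have h := ((S.flow_spec hξ).2 (s + t) (by linarith)).mono P.spec S.bound ht
    (by linarith : t ≤ s + t) le_rfl
  have := S.eq_flow h (right_mem_Icc.2 (by linarith))
  simpa using this

theorem flow_diff (S : ConeSystem P e F F' α C) (hξ : Summable fun n => (P.lam n)⁻¹ * ξ n ^ 2)
    (hη : Summable fun n => (P.lam n)⁻¹ * η n ^ 2) (ht : 0 ≤ t) :
    ∃ g, ConeOrbit P (fun t => S.flow t ξ - S.flow t η) g 0 t :=
  ⟨_, S.coneOrbit ht ((S.flow_spec hξ).2 t ht) ((S.flow_spec hη).2 t ht)⟩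

theorem flow_negSq_le (S : ConeSystem P e F F' α C)
    (hξ : Summable fun n => (P.lam n)⁻¹ * ξ n ^ 2)
    (hη : Summable fun n => (P.lam n)⁻¹ * η n ^ 2) (ht : 0 ≤ t) :
    negSq P.lam (S.flow t ξ - S.flow t η) ≤ Real.exp (P.L ^ 2 * t) * negSq P.lam (ξ - η) := by
  obtain ⟨g, hg⟩ := S.flow_diff hξ hη ht
  have := hg.negSq_le
  simpa [S.flow_zero hξ, S.flow_zero hη] using this

/-- A trajectory defined for all `t ≤ 0`. -/
structure Past (S : ConeSystem P e F F' α C) (u : ℝ → ℕ → ℝ) : Prop where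
  mem : ∀ t ≤ 0, Summable fun n => (P.lam n)⁻¹ * u t n ^ 2
  flow_eq : ∀ r h, 0 ≤ h → r + h ≤ 0 → u (r + h) = S.flow h (u r)

theorem Past.isSolution {S : ConeSystem P e F F' α C} (h : S.Past u) (hab : a ≤ b) (hb : b ≤ 0) :
    IsSolution e P.lam F u a b := by
  have h1 := ((S.flow_spec (h.mem a (hab.trans hb))).2 (b - a) (by linarith)).shift P.spec S.bound
    (by linarith) (-a)
  have e1 : (0 : ℝ) - -a = a := by ring
  have e2 : b - a - -a = b := by ring
  rw [e1, e2] at h1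
  refine h1.congr P.spec S.bound hab fun t ht => ?_
  have := h.flow_eq a (t - a) (by linarith [ht.1]) (by linarith [ht.2])
  rw [add_sub_cancel] at this
  rw [this, sub_eq_add_neg]

theorem Past.of_isSolution (S : ConeSystem P e F F' α C)
    (h : ∀ T > 0, IsSolution e P.lam F u (-T) 0) : S.Past u := by
  have key : ∀ t ≤ 0, IsSolution e P.lam F u t 0 := fun t ht =>
    (h (-t + 1) (by linarith)).mono P.spec S.bound (by linarith) ht le_rfl
  refine ⟨fun t ht => (S.orbit ht (key t ht)).init, fun r s hs hrs => ?_⟩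
  have := S.eq_flow (key r (by linarith)) (t := r + s) ⟨by linarith, hrs⟩
  simpa using this

theorem Past.shift {S : ConeSystem P e F F' α C} (h : S.Past u) {τ : ℝ} (hτ : τ ≤ 0) :
    S.Past (fun t => u (t + τ)) := by
  refine ⟨fun t ht => h.mem _ (by linarith), fun r s hs hrs => ?_⟩
  rw [show r + s + τ = (r + τ) + s by ring]
  exact h.flow_eq _ _ hs (by linarith)

/-- Continuation of a trajectory into the future by time `τ`. -/
theorem Past.extend {S : ConeSystem P e F F' α C} (h : S.Past u) (τ : ℝ) :
    S.Past (fun t => if t ≤ -τ then u (t + τ) else S.flow (t + τ) (u 0)) := by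
  have h0 := h.mem 0 le_rfl
  refine ⟨fun t ht => ?_, fun r s hs hrs => ?_⟩
  · split_ifs with h1
    · exact h.mem _ (by linarith)
    · exact S.flow_mem h0 (by linarith)
  · split_ifs with h1 h2 h3
    · rw [show r + s + τ = (r + τ) + s by ring]; exact h.flow_eq _ _ hs (by linarith)
    · linarith
    · have h4 := h.flow_eq (r + τ) (-(r + τ)) (by linarith) (by linarith)
      rw [add_neg_cancel] at h4
      have h5 := S.flow_add (s := r + s + τ) (t := -(r + τ)) (h.mem (r + τ) (by linarith))
        (by linarith) (by linarith)
      rw [h4, ← h5]; congr 1; ring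
    · rw [← S.flow_add h0 hs (by linarith)]; congr 1; ring

end ConeSystem

/-! ### Decay of the high modes and backward growth of the low modes. -/

section LowHigh

variable {P : ConeParams} {ξ γ : ℕ → ℝ} {C κ : ℝ}

theorem wForm_sub_le {lam c : ℕ → ℝ} (hl : IsSpectrum lam) (hc : ∀ n, |c n| ≤ 1) (hc0 : ∀ n, 0 ≤ c n)
    (hξ : Summable fun n => (lam n)⁻¹ * ξ n ^ 2) (hγ : Summable fun n => (lam n)⁻¹ * γ n ^ 2) :
    wForm lam c (ξ - γ) ≤ 2 * wForm lam c ξ + 2 * wForm lam c γ := by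
  refine hasSum_le (fun n => ?_) (summable_wForm hl (summable_neg_sub hl hξ hγ) hc).hasSum
    (((summable_wForm hl hξ hc).hasSum.mul_left 2).add ((summable_wForm hl hγ hc).hasSum.mul_left 2))
  have h1 : (ξ - γ) n ^ 2 ≤ 2 * ξ n ^ 2 + 2 * γ n ^ 2 := by
    simp only [Pi.sub_apply]; nlinarith [sq_nonneg (ξ n + γ n)]
  have h2 := mul_le_mul_of_nonneg_left (mul_le_mul_of_nonneg_left h1
    (inv_nonneg.2 (hl.pos n).le)) (hc0 n)
  linarith

theorem two_mul_abs_le {l : ℝ} (hl : 0 < l) (hκ : 0 < κ) (x y : ℝ) :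
    2 * |y * x| ≤ κ * (l * x ^ 2) + κ⁻¹ * (l⁻¹ * y ^ 2) := by
  have e2 : 0 ≤ κ⁻¹ * l⁻¹ * (κ * l * |x| - |y|) ^ 2 := by positivity
  have e3 : κ⁻¹ * l⁻¹ * (κ * l * |x| - |y|) ^ 2 =
      κ * (l * x ^ 2) + κ⁻¹ * (l⁻¹ * y ^ 2) - 2 * |y * x| := by
    rw [abs_mul, ← sq_abs x, ← sq_abs y]; field_simp; ring
  linarith

/-- A share κ of the dissipation absorbs the forcing, and the decay rate left over can be taken as
close to twice the square of `lam N` as desired. -/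
theorem rate_minus_le (hκ : 0 < κ) (hκ2 : κ ≤ 2) (hξ : Summable fun n => P.lam n * ξ n ^ 2)
    (hγ : Summable fun n => γ n ^ 2) (hC : zeroSq γ ≤ C ^ 2) :
    wRate P.lam (cQ P.N) ξ γ + (2 - κ) * P.lam P.N ^ 2 * P.minus ξ ≤
      κ⁻¹ * ((P.lam 0)⁻¹ * C ^ 2) := by
  have hl := P.spec
  have hn := summable_neg_of_zero hl (summable_zero_of_one hl hξ)
  have h := hasSum_le (fun n => ?_) ((summable_wRate hl hξ hγ (abs_cQ_le P.N)).hasSum.add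
    ((summable_wForm hl hn (abs_cQ_le P.N)).hasSum.mul_left ((2 - κ) * P.lam P.N ^ 2)))
    (hγ.hasSum.mul_left (κ⁻¹ * (P.lam 0)⁻¹))
  · refine h.trans ?_
    have : 0 ≤ κ⁻¹ * (P.lam 0)⁻¹ := mul_nonneg (inv_nonneg.2 hκ.le) (inv_nonneg.2 hl.zero_pos.le)
    have := mul_le_mul_of_nonneg_left hC this
    rw [zeroSq] at this; linarith
  · have hp := hl.pos n
    have e0 : 0 ≤ κ⁻¹ * (P.lam 0)⁻¹ * γ n ^ 2 := by
      have := hl.zero_pos; positivity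
    unfold cQ
    split_ifs with hnN
    · simpa using e0
    · have e1 := two_mul_abs_le hp hκ (ξ n) (γ n)
      have e2 := neg_abs_le (γ n * ξ n)
      have e3 : κ⁻¹ * ((P.lam n)⁻¹ * γ n ^ 2) ≤ κ⁻¹ * ((P.lam 0)⁻¹ * γ n ^ 2) := by
        have := hl.inv_le n; gcongr
      have e4 : P.lam P.N ^ 2 * ((P.lam n)⁻¹ * ξ n ^ 2) ≤ P.lam n * ξ n ^ 2 := by
        have h1 : P.lam P.N ^ 2 ≤ P.lam n ^ 2 :=
          pow_le_pow_left₀ (hl.pos _).le (hl.mono (not_lt.1 hnN)) 2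
        calc _ ≤ P.lam n ^ 2 * ((P.lam n)⁻¹ * ξ n ^ 2) := by gcongr
          _ = _ := by field_simp
      have e5 := mul_le_mul_of_nonneg_left e4 (by linarith : 0 ≤ 2 - κ)
      linarith

/-- The counterpart for the low modes: their backward growth exceeds twice the square of `lam (N -
1)` only by the share κ that pays for the forcing. -/
theorem rate_plus_le (hκ : 0 < κ) (hξ : Summable fun n => P.lam n * ξ n ^ 2)
    (hγ : Summable fun n => γ n ^ 2) (hC : zeroSq γ ≤ C ^ 2) :
    -wRate P.lam (cP P.N) ξ γ ≤ (2 + κ) * P.lam (P.N - 1) ^ 2 * P.plus ξ +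
      κ⁻¹ * ((P.lam 0)⁻¹ * C ^ 2) := by
  have hl := P.spec
  have hn := summable_neg_of_zero hl (summable_zero_of_one hl hξ)
  have h := hasSum_le (fun n => ?_) (summable_wRate hl hξ hγ (abs_cP_le P.N)).hasSum.neg
    (((summable_wForm hl hn (abs_cP_le P.N)).hasSum.mul_left ((2 + κ) * P.lam (P.N - 1) ^ 2)).add
    (hγ.hasSum.mul_left (κ⁻¹ * (P.lam 0)⁻¹)))
  · refine h.trans ?_
    have : 0 ≤ κ⁻¹ * (P.lam 0)⁻¹ := mul_nonneg (inv_nonneg.2 hκ.le) (inv_nonneg.2 hl.zero_pos.le)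
    have := mul_le_mul_of_nonneg_left hC this
    rw [zeroSq] at this
    rw [ConeParams.plus, wForm]; linarith
  · have hp := hl.pos n
    have e0 : 0 ≤ κ⁻¹ * (P.lam 0)⁻¹ * γ n ^ 2 := by
      have := hl.zero_pos; positivity
    unfold cP
    split_ifs with hnN
    · have e1 := two_mul_abs_le hp hκ (ξ n) (γ n)
      have e2 := le_abs_self (γ n * ξ n)
      have e3 : κ⁻¹ * ((P.lam n)⁻¹ * γ n ^ 2) ≤ κ⁻¹ * ((P.lam 0)⁻¹ * γ n ^ 2) := by
        have := hl.inv_le n; gcongr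
      have e4 : P.lam n * ξ n ^ 2 ≤ P.lam (P.N - 1) ^ 2 * ((P.lam n)⁻¹ * ξ n ^ 2) := by
        have h1 : P.lam n ^ 2 ≤ P.lam (P.N - 1) ^ 2 :=
          pow_le_pow_left₀ hp.le (hl.mono (by omega)) 2
        calc _ = P.lam n ^ 2 * ((P.lam n)⁻¹ * ξ n ^ 2) := by field_simp
          _ ≤ _ := by gcongr
      have e5 := mul_le_mul_of_nonneg_left e4 (by linarith : 0 ≤ 2 + κ)
      linarith
    · simpa using e0

end LowHigh

namespace ConeSystem

variable {H : Type*} [NormedAddCommGroup H] [InnerProductSpace ℝ H] [MeasurableSpace H]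
  {P : ConeParams} {e : HilbertBasis ℕ ℝ H} {F : H → H} {F' : H → H →L[ℝ] H} {α : H → ℝ} {C : ℝ}
  {u w : ℝ → ℕ → ℝ} {a b κ : ℝ}

/-- As F is bounded, the high modes have an absorbing ball whose radius does not depend on the low
modes. -/
theorem minus_le (S : ConeSystem P e F F' α C) (hab : a ≤ b) (h : IsSolution e P.lam F u a b)
    (hκ : 0 < κ) (hκ2 : κ < 2) :
    P.minus (u b) ≤ Real.exp (-((2 - κ) * P.lam P.N ^ 2 * (b - a))) * P.minus (u a) +
      κ⁻¹ * ((P.lam 0)⁻¹ * C ^ 2) / ((2 - κ) * P.lam P.N ^ 2) := by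
  have o := S.orbit hab h
  have hp := P.spec.pos P.N
  have h0 := P.spec.zero_pos
  refine (o.isPrimitive_wForm P.spec (abs_cQ_le P.N)).le_of_rate_le hab
    (mul_pos (by linarith) (by positivity)) (by positivity) ?_
  filter_upwards [o.ae_summable_one P.spec, o.ae_summable_forcing] with t h1 h2 hm
  refine rate_minus_le hκ hκ2.le (h1 hm) (h2 hm) ?_
  rw [zeroSq_coeff]
  exact pow_le_pow_left₀ (norm_nonneg _) (S.bound _) 2

theorem plus_le (S : ConeSystem P e F F' α C) (hab : a ≤ b) (h : IsSolution e P.lam F u a b)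
    (hκ : 0 < κ) :
    P.plus (u a) ≤ Real.exp ((2 + κ) * P.lam (P.N - 1) ^ 2 * (b - a)) * (P.plus (u b) +
      κ⁻¹ * ((P.lam 0)⁻¹ * C ^ 2) / ((2 + κ) * P.lam (P.N - 1) ^ 2)) := by
  have o := S.orbit hab h
  have hp := P.spec.pos (P.N - 1)
  have h0 := P.spec.zero_pos
  have h1 := ((o.isPrimitive_wForm P.spec (abs_cP_le P.N)).const_mul (-1)).le_of_rate_le
    (β := (2 + κ) * P.lam (P.N - 1) ^ 2) (K := κ⁻¹ * ((P.lam 0)⁻¹ * C ^ 2)) hab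
    (mul_pos (by linarith) (by positivity)) (by positivity) (by
      filter_upwards [o.ae_summable_one P.spec, o.ae_summable_forcing] with t h1 h2 hm
      have := rate_plus_le (P := P) (C := C) hκ (h1 hm) (h2 hm) (by
        rw [zeroSq_coeff]
        exact pow_le_pow_left₀ (norm_nonneg _) (S.bound _) 2)
      rw [ConeParams.plus] at this
      linarith)
  have h2 : Real.exp (-((2 + κ) * P.lam (P.N - 1) ^ 2 * (b - a))) * P.plus (u a) ≤ P.plus (u b) +
      κ⁻¹ * ((P.lam 0)⁻¹ * C ^ 2) / ((2 + κ) * P.lam (P.N - 1) ^ 2) := by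
    rw [ConeParams.plus, ConeParams.plus]; linarith
  rw [Real.exp_neg, inv_mul_le_iff₀ (Real.exp_pos _)] at h2
  exact h2

variable [CompleteSpace H]

/-- Two trajectories with bounded high modes differ by an element of the cone. -/
theorem V_nonpos_of_bounded (S : ConeSystem P e F F' α C) {B : ℝ} (hu : S.Past u) (hw : S.Past w)
    (hub : ∀ t ≤ 0, P.minus (u t) ≤ B) (hwb : ∀ t ≤ 0, P.minus (w t) ≤ B) :
    P.V (u 0 - w 0) ≤ 0 := by
  by_contra hpos
  push Not at hpos
  have key : ∀ T : ℝ, 0 ≤ T → P.V (u 0 - w 0) ≤ Real.exp (-(P.αm * T)) * (4 * B) := by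
    intro T hT
    have h1 := S.coneOrbit (a := -T) (b := 0) (by linarith) (hu.isSolution (by linarith) le_rfl)
      (hw.isSolution (by linarith) le_rfl)
    have h2 := h1.squeeze hpos.le
    have m1 := hu.mem (-T) (by linarith)
    have m2 := hw.mem (-T) (by linarith)
    have h3 : P.V (u (-T) - w (-T)) ≤ 4 * B := by
      rw [P.V_eq (summable_neg_sub P.spec m1 m2)]
      have h4 := wForm_sub_le P.spec (abs_cQ_le P.N) (cQ_nonneg P.N) m1 m2
      have h5 := hub (-T) (by linarith)
      have h6 := hwb (-T) (by linarith)
      have h7 := P.plus_nonneg (ξ := u (-T) - w (-T))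
      simp only [ConeParams.minus] at *
      linarith
    simp only [sub_neg_eq_add, zero_add] at h2
    exact h2.trans (mul_le_mul_of_nonneg_left h3 (Real.exp_pos _).le)
  have hlim : Tendsto (fun T : ℝ => Real.exp (-(P.αm * T)) * (4 * B)) atTop (𝓝 0) := by
    have h1 : Tendsto (fun T : ℝ => P.αm * T) atTop atTop := tendsto_id.const_mul_atTop P.αm_pos
    have h2 := (Real.tendsto_exp_neg_atTop_nhds_zero.comp h1).mul_const (4 * B)
    simpa using h2
  have := ge_of_tendsto hlim (eventually_atTop.2 ⟨0, key⟩)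
  linarith

end ConeSystem

/-! ### Backward trajectories with prescribed low modes at the final time. -/

theorem sq_integral_le {f : ℝ → ℝ} {a b : ℝ} (hab : a ≤ b) (hf : IntervalIntegrable f volume a b)
    (hf2 : IntervalIntegrable (fun t => f t ^ 2) volume a b) :
    (∫ t in a..b, f t) ^ 2 ≤ (b - a) * ∫ t in a..b, f t ^ 2 := by
  rcases hab.eq_or_lt with rfl | hlt
  · simp
  set I := ∫ t in a..b, f t with hI
  set τ := b - a with hτ
  have hτ0 : 0 < τ := sub_pos.2 hlt
  have h0 : 0 ≤ ∫ t in a..b, (τ * f t - I) ^ 2 :=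
    intervalIntegral.integral_nonneg hab fun t _ => sq_nonneg _
  have e : ∀ t, (τ * f t - I) ^ 2 = τ ^ 2 * f t ^ 2 - 2 * τ * I * f t + I ^ 2 := fun t => by ring
  simp only [e] at h0
  rw [intervalIntegral.integral_add ((hf2.const_mul _).sub (hf.const_mul _)) intervalIntegrable_const,
    intervalIntegral.integral_sub (hf2.const_mul _) (hf.const_mul _),
    intervalIntegral.integral_const_mul, intervalIntegral.integral_const_mul,
    intervalIntegral.integral_const, smul_eq_mul, ← hI, ← hτ] at h0
  have h1 : 0 ≤ τ * (τ * (∫ t in a..b, f t ^ 2) - I ^ 2) := by linarith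
  have := nonneg_of_mul_nonneg_right h1 hτ0
  linarith

/-- Fatou's lemma for weighted sums of squares under convergence of the coefficients. -/
theorem sum_le_of_tendsto {ι : Type*} {l : Filter ι} [NeBot l] {a y : ℕ → ℝ} {x : ι → ℕ → ℝ} {B : ℝ}
    (ha : ∀ n, 0 ≤ a n) (hx : ∀ n, Tendsto (fun k => x k n) l (𝓝 (y n)))
    (h : ∀ᶠ k in l, (Summable fun n => a n * x k n ^ 2) ∧ ∑' n, a n * x k n ^ 2 ≤ B) :
    (Summable fun n => a n * y n ^ 2) ∧ ∑' n, a n * y n ^ 2 ≤ B := by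
  have h0 : ∀ n, 0 ≤ a n * y n ^ 2 := fun n => mul_nonneg (ha n) (sq_nonneg _)
  have h1 : ∀ s : Finset ℕ, ∑ n ∈ s, a n * y n ^ 2 ≤ B := fun s => by
    refine le_of_tendsto (tendsto_finsetSum s fun n _ => ((hx n).pow 2).const_mul (a n)) ?_
    filter_upwards [h] with k hk
    exact (hk.1.sum_le_tsum s fun n _ => mul_nonneg (ha n) (sq_nonneg _)).trans hk.2
  have hs := summable_of_sum_le h0 h1
  exact ⟨hs, hs.tsum_le_of_sum_le h1⟩

theorem zeroSq_le_of_tendsto {ι : Type*} {l : Filter ι} [NeBot l] {y : ℕ → ℝ} {x : ι → ℕ → ℝ} {B : ℝ}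
    (hx : ∀ n, Tendsto (fun k => x k n) l (𝓝 (y n)))
    (h : ∀ᶠ k in l, (Summable fun n => x k n ^ 2) ∧ zeroSq (x k) ≤ B) :
    (Summable fun n => y n ^ 2) ∧ zeroSq y ≤ B := by
  have := sum_le_of_tendsto (a := fun _ => 1) (B := B) (fun _ => zero_le_one) hx
    (by simpa [zeroSq] using h)
  simpa [zeroSq] using this

namespace ConeParams

variable (P : ConeParams) {ξ η : ℕ → ℝ}

theorem plus_eq : P.plus ξ = ∑ n ∈ Finset.range P.N, (P.lam n)⁻¹ * ξ n ^ 2 := by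
  rw [plus, wForm, tsum_eq_sum (s := Finset.range P.N)]
  · exact Finset.sum_congr rfl fun n hn => by simp [cP, Finset.mem_range.1 hn]
  · intro n hn
    simp [cP, mt Finset.mem_range.2 hn]

theorem plus_le_of_abs_le {r : ℝ} (h : ∀ n < P.N, |ξ n| ≤ r) :
    P.plus ξ ≤ (P.lam 0)⁻¹ * P.N * r ^ 2 := by
  have : ∀ n ∈ Finset.range P.N, (P.lam n)⁻¹ * ξ n ^ 2 ≤ (P.lam 0)⁻¹ * r ^ 2 := fun n hn => by
    have h1 := sq_le_sq' (neg_le_of_abs_le (h n (Finset.mem_range.1 hn)))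
      (le_of_abs_le (h n (Finset.mem_range.1 hn)))
    have := P.spec.inv_le n
    have := P.spec.zero_pos
    gcongr
  rw [P.plus_eq]
  refine (Finset.sum_le_sum this).trans (le_of_eq ?_)
  simp; ring

theorem plus_eq_zero (h : ∀ n < P.N, ξ n = 0) : P.plus ξ = 0 := by
  rw [P.plus_eq]
  exact Finset.sum_eq_zero fun n hn => by simp [h n (Finset.mem_range.1 hn)]

theorem minus_eq_zero (h : ∀ n, P.N ≤ n → ξ n = 0) : P.minus ξ = 0 := by
  rw [minus, wForm]
  convert! tsum_zero with n
  unfold cQ; split_ifs with hn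
  · simp
  · simp [h n (not_lt.1 hn)]

theorem negSq_le_of_V_nonpos (hs : Summable fun n => (P.lam n)⁻¹ * ξ n ^ 2) (h : P.V ξ ≤ 0) :
    negSq P.lam ξ ≤ 2 * P.plus ξ := by
  rw [P.V_eq hs] at h; rw [P.negSq_eq hs]; linarith

theorem eq_zero_of_negSq (hs : Summable fun n => (P.lam n)⁻¹ * ξ n ^ 2) (h : negSq P.lam ξ ≤ 0) :
    ξ = 0 := by
  ext n
  have := mode_sq_le_negSq P.spec hs n
  have h2 : ξ n ^ 2 ≤ 0 := this.trans (mul_nonpos_of_nonneg_of_nonpos (P.spec.pos n).le h)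
  simpa using le_antisymm h2 (sq_nonneg _)

end ConeParams

/-- Integrating the scalar equation and applying Cauchy–Schwarz in time produces the factor τ; all
low eigenvalues are bounded by `lam N`. -/
theorem ControlledOrbit.low_mode_sub_le {P : ConeParams} {v g : ℝ → ℕ → ℝ} {τ : ℝ}
    (h : ControlledOrbit P v g 0 τ) (hτ : τ ≤ 1) {n : ℕ} (hn : n < P.N) :
    (v τ n - v 0 n) ^ 2 ≤ τ * (2 * (P.lam P.N ^ 4 + P.lam P.N ^ 2 * P.L ^ 2) *
      ((P.lam 0)⁻¹ * Real.exp (P.L ^ 2))) * negSq P.lam (v 0) := by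
  have hl := P.spec
  have h0 := h.le
  have hvi : IntervalIntegrable (fun t => v t n) volume 0 τ := by
    apply ContinuousOn.intervalIntegrable
    rw [uIcc_of_le h.le]; exact h.continuousOn n
  have e1 := (h.mode n).sub_eq h.le
  rw [intervalIntegral.integral_neg, intervalIntegral.integral_add (hvi.const_mul _)
    ((h.forcing n).const_mul _), intervalIntegral.integral_const_mul,
    intervalIntegral.integral_const_mul] at e1
  have e2 := sq_integral_le h.le hvi (h.intervalIntegrable_sq n)
  have e3 := sq_integral_le h.le (h.forcing n) (h.sq_forcing.1 n)
  rw [sub_zero] at e2 e3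
  have e4 : ∫ t in (0 : ℝ)..τ, v t n ^ 2 ≤ ∫ t in (0 : ℝ)..τ, zeroSq (v t) := by
    refine integral_mono_of_ae_Ioc h.le (h.intervalIntegrable_sq n) (h.intervalIntegrable_zeroSq hl) ?_
    filter_upwards [h.ae_summable_one hl] with t ht hm
    exact (summable_zero_of_one hl (ht hm)).le_tsum n fun m _ => sq_nonneg (v t m)
  have e5 : ∫ t in (0 : ℝ)..τ, g t n ^ 2 ≤ P.L ^ 2 * ∫ t in (0 : ℝ)..τ, zeroSq (v t) := by
    refine le_trans ?_ h.integral_forcing_le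
    refine integral_mono_of_ae_Ioc h.le (h.sq_forcing.1 n) h.intervalIntegrable_forcing ?_
    filter_upwards [h.ae_summable_forcing] with t ht hm
    exact (ht hm).le_tsum n fun m _ => sq_nonneg (g t m)
  have e6 := h.integral_zeroSq_le
  have e7 : Real.exp (P.L ^ 2 * (τ - 0)) ≤ Real.exp (P.L ^ 2) :=
    Real.exp_le_exp.2 (by nlinarith [sq_nonneg P.L])
  have e8 : P.lam n ≤ P.lam P.N := hl.mono hn.le
  have p0 := hl.pos n
  have p1 := hl.zero_pos
  have p2 := negSq_nonneg hl (v 0)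
  set X := ∫ t in (0 : ℝ)..τ, zeroSq (v t)
  have hX : 0 ≤ X := intervalIntegral.integral_nonneg h.le fun t _ => zeroSq_nonneg _
  set I := ∫ t in (0 : ℝ)..τ, v t n
  set J := ∫ t in (0 : ℝ)..τ, g t n
  calc (v τ n - v 0 n) ^ 2 = (P.lam n ^ 2 * I + P.lam n * J) ^ 2 := by rw [e1, neg_sq]
    _ ≤ 2 * (P.lam n ^ 2) ^ 2 * I ^ 2 + 2 * P.lam n ^ 2 * J ^ 2 := sq_lin_le _ _ _ _
    _ ≤ 2 * (P.lam P.N ^ 2) ^ 2 * (τ * X) + 2 * P.lam P.N ^ 2 * (τ * (P.L ^ 2 * X)) := by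
      have f1 : I ^ 2 ≤ τ * X := e2.trans (mul_le_mul_of_nonneg_left e4 h0)
      have f2 : J ^ 2 ≤ τ * (P.L ^ 2 * X) := e3.trans (mul_le_mul_of_nonneg_left e5 h0)
      gcongr
    _ = τ * (2 * (P.lam P.N ^ 4 + P.lam P.N ^ 2 * P.L ^ 2)) * X := by ring
    _ ≤ τ * (2 * (P.lam P.N ^ 4 + P.lam P.N ^ 2 * P.L ^ 2)) *
        ((P.lam 0)⁻¹ * Real.exp (P.L ^ 2) * negSq P.lam (v 0)) := by
      have f3 : X ≤ (P.lam 0)⁻¹ * Real.exp (P.L ^ 2) * negSq P.lam (v 0) :=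
        e6.trans (by gcongr)
      gcongr
    _ = _ := by ring

/-- A set of states with differences in the cone that covers the low modes. -/
structure IsCover (P : ConeParams) (Γ : Set (ℕ → ℝ)) : Prop where
  mem : ∀ ξ ∈ Γ, Summable fun n => (P.lam n)⁻¹ * ξ n ^ 2
  cone : ∀ ξ ∈ Γ, ∀ η ∈ Γ, P.V (ξ - η) ≤ 0
  cover : ∀ x : Fin P.N → ℝ, ∃ ξ ∈ Γ, ∀ i : Fin P.N, ξ i = x i

/-- The states without high modes. -/
def lowSet (N : ℕ) : Set (ℕ → ℝ) := {ξ | ∀ n, N ≤ n → ξ n = 0}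

theorem summable_of_mem_lowSet (P : ConeParams) {ξ : ℕ → ℝ} (h : ξ ∈ lowSet P.N) :
    Summable fun n => (P.lam n)⁻¹ * ξ n ^ 2 :=
  summable_of_ne_finset_zero (s := Finset.range P.N) fun n hn => by
    simp [h n (by simpa using hn)]

theorem isCover_lowSet (P : ConeParams) : IsCover P (lowSet P.N) where
  mem _ h := summable_of_mem_lowSet P h
  cone ξ h η h' := by
    rw [P.V_eq (summable_neg_sub P.spec (summable_of_mem_lowSet P h) (summable_of_mem_lowSet P h')),
      P.minus_eq_zero (ξ := ξ - η) fun n hn => by simp [h n hn, h' n hn]]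
    linarith [P.plus_nonneg (ξ := ξ - η)]
  cover x := ⟨fun n => if h : n < P.N then x ⟨n, h⟩ else 0, fun n hn => by simp [hn], fun i => by simp⟩

namespace ConeSystem

variable {H : Type*} [NormedAddCommGroup H] [InnerProductSpace ℝ H] [MeasurableSpace H]
  {P : ConeParams} {e : HilbertBasis ℕ ℝ H} {F : H → H} {F' : H → H →L[ℝ] H} {α : H → ℝ} {C : ℝ}
  {u w : ℝ → ℕ → ℝ} {a b s t : ℝ} {ξ η : ℕ → ℝ} [CompleteSpace H]

theorem flow_V_nonpos (S : ConeSystem P e F F' α C)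
    (hξ : Summable fun n => (P.lam n)⁻¹ * ξ n ^ 2)
    (hη : Summable fun n => (P.lam n)⁻¹ * η n ^ 2) (hV : P.V (ξ - η) ≤ 0) (ht : 0 ≤ t) :
    P.V (S.flow t ξ - S.flow t η) ≤ 0 := by
  obtain ⟨g, hg⟩ := S.flow_diff hξ hη ht
  exact hg.V_nonpos (by simpa [S.flow_zero hξ, S.flow_zero hη] using hV) (right_mem_Icc.2 ht)

/-- Prescribing the low modes p at time τ is a fixed-point problem for x ↦ x - (P_N S(τ)γ(x) - p) on
ℝ^N, where γ(x) is a state of Γ over x. Differences in Γ lie in the cone and are controlled by the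
low modes, which barely move in a short time, so the map is a contraction. The time τ is the same
for all Γ, which allows iteration. -/
theorem exists_isCover_image (S : ConeSystem P e F F' α C) :
    ∃ τ, 0 < τ ∧ ∀ Γ, IsCover P Γ → IsCover P (S.flow τ '' Γ) := by
  set K := 2 * (P.lam P.N ^ 4 + P.lam P.N ^ 2 * P.L ^ 2) * ((P.lam 0)⁻¹ * Real.exp (P.L ^ 2)) with hK
  have p0 := P.spec.zero_pos
  have pN := P.spec.pos P.N
  have hK0 : 0 ≤ K := by positivity
  set M := K * (2 * ((P.lam 0)⁻¹ * P.N)) with hM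
  have hM0 : 0 ≤ M := by positivity
  -- Chosen so that τM ≤ 1/4, the square of the contraction constant 1/2.
  set τ := (4 * M + 1)⁻¹ with hτ
  have hτ0 : 0 < τ := by positivity
  have hτ1 : τ ≤ 1 := inv_le_one_of_one_le₀ (by linarith)
  have hτM : τ * M ≤ 1 / 4 := by
    rw [hτ, inv_mul_le_iff₀ (by positivity)]; linarith
  refine ⟨τ, hτ0, fun Γ hΓ => ⟨?_, ?_, fun p => ?_⟩⟩
  · rintro _ ⟨ξ, hξ, rfl⟩; exact S.flow_mem (hΓ.mem ξ hξ) hτ0.le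
  · rintro _ ⟨ξ, hξ, rfl⟩ _ ⟨η, hη, rfl⟩
    exact S.flow_V_nonpos (hΓ.mem ξ hξ) (hΓ.mem η hη) (hΓ.cone ξ hξ η hη) hτ0.le
  · choose γ hγ hγx using hΓ.cover
    have hG : ContractingWith 2⁻¹ fun (x : Fin P.N → ℝ) (i : Fin P.N) =>
        x i - (S.flow τ (γ x) i - p i) := by
      refine ⟨by norm_num, LipschitzWith.of_dist_le_mul fun x y => ?_⟩
      rw [dist_pi_le_iff (by positivity)]
      intro i
      have mx := hΓ.mem _ (hγ x)
      have my := hΓ.mem _ (hγ y)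
      obtain ⟨g, hg⟩ := S.flow_diff mx my hτ0.le
      have h1 := hg.low_mode_sub_le hτ1 i.2
      have h2 := P.negSq_le_of_V_nonpos (summable_neg_sub P.spec mx my)
        (hΓ.cone _ (hγ x) _ (hγ y))
      have h3 := P.plus_le_of_abs_le (ξ := γ x - γ y) (r := dist x y) fun n hn => by
        have a1 := hγx x ⟨n, hn⟩
        have a2 := hγx y ⟨n, hn⟩
        simp only at a1 a2
        rw [Pi.sub_apply, a1, a2, ← Real.dist_eq]
        exact dist_le_pi_dist x y _
      simp only [S.flow_zero mx, S.flow_zero my] at h1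
      simp only [Pi.sub_apply, hγx] at h1
      rw [Real.dist_eq]
      have h4 : (x i - (S.flow τ (γ x) i - p i) - (y i - (S.flow τ (γ y) i - p i))) ^ 2 ≤
          (2⁻¹ * dist x y) ^ 2 := by
        calc _ = (S.flow τ (γ x) i - S.flow τ (γ y) i - (x i - y i)) ^ 2 := by ring
          _ ≤ τ * K * negSq P.lam (γ x - γ y) := h1
          _ ≤ τ * K * (2 * ((P.lam 0)⁻¹ * P.N * dist x y ^ 2)) := by
            have := h2.trans (mul_le_mul_of_nonneg_left h3 zero_le_two)
            gcongr
          _ = τ * M * dist x y ^ 2 := by rw [hM]; ring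
          _ ≤ 1 / 4 * dist x y ^ 2 := by gcongr
          _ = _ := by ring
      have := abs_le_of_sq_le_sq h4 (by positivity)
      refine this.trans (le_of_eq ?_)
      push_cast; rfl
    refine ⟨_, mem_image_of_mem _ (hγ (ContractingWith.fixedPoint _ hG)), fun i => ?_⟩
    have := congrFun hG.fixedPoint_isFixedPt i
    simp only at this
    linarith

theorem exists_isCover_flow (S : ConeSystem P e F F' α C) :
    ∃ τ, 0 < τ ∧ ∀ k : ℕ, IsCover P (S.flow (k * τ) '' lowSet P.N) := by
  obtain ⟨τ, hτ, h⟩ := S.exists_isCover_image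
  refine ⟨τ, hτ, fun k => ?_⟩
  induction k with
  | zero =>
    have : S.flow ((0 : ℕ) * τ) '' lowSet P.N = lowSet P.N := by
      rw [Nat.cast_zero, zero_mul]
      refine (image_congr fun ξ hξ => S.flow_zero (summable_of_mem_lowSet P hξ)).trans ?_
      simp
    rw [this]; exact isCover_lowSet P
  | succ k ih =>
    have : S.flow ((k + 1 : ℕ) * τ) '' lowSet P.N = S.flow τ '' (S.flow (k * τ) '' lowSet P.N) := by
      rw [image_image]
      refine image_congr fun ξ hξ => ?_
      rw [← S.flow_add (summable_of_mem_lowSet P hξ) hτ.le (by positivity)]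
      congr 1; push_cast; ring
    rw [this]; exact h _ ih

theorem exists_approximation (S : ConeSystem P e F F' α C) :
    ∃ τ, 0 < τ ∧ ∀ (p : Fin P.N → ℝ) (k : ℕ), ∃ u, IsSolution e P.lam F u (-(k * τ)) 0 ∧
      P.minus (u (-(k * τ))) = 0 ∧ ∀ i : Fin P.N, u 0 i = p i := by
  obtain ⟨τ, hτ, h⟩ := S.exists_isCover_flow
  refine ⟨τ, hτ, fun p k => ?_⟩
  obtain ⟨_, ⟨ξ, hξ, rfl⟩, h1⟩ := (h k).cover p
  have hm := summable_of_mem_lowSet P hξ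
  have h2 := ((S.flow_spec hm).2 (k * τ) (by positivity)).shift P.spec S.bound (by positivity) (k * τ)
  rw [zero_sub, sub_self] at h2
  refine ⟨_, h2, ?_, fun i => by simpa using h1 i⟩
  simp only [neg_add_cancel, S.flow_zero hm]
  exact P.minus_eq_zero hξ

/-- Equal low modes at time 0 keep the difference outside the cone at all earlier times. It is
squeezed from a to t - 1, V at t - 1 bounds its integral over [t - 1, t], and smoothing gives the
value at t. The factor 4B bounds V at the start through the high modes alone. -/
theorem zeroSq_sub_le_of_plus_eq (S : ConeSystem P e F F' α C) {B : ℝ} (hu : IsSolution e P.lam F u a 0)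
    (hw : IsSolution e P.lam F w a 0) (hp : ∀ n < P.N, u 0 n = w 0 n)
    (hub : P.minus (u a) ≤ B) (hwb : P.minus (w a) ≤ B) (hat : a ≤ t - 1) (ht : t ≤ 0) :
    (Summable fun n => (u t - w t) n ^ 2) ∧ zeroSq (u t - w t) ≤
      (1 + P.L ^ 2) * P.μ⁻¹ * (4 * B) * Real.exp (-(P.αm * (t - 1 - a))) := by
  have ha : a ≤ 0 := by linarith
  have h := S.coneOrbit ha hu hw
  have m0 := h.mem_neg P.spec (right_mem_Icc.2 ha)
  have hV : 0 ≤ P.V (u 0 - w 0) := by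
    rw [P.V_eq m0, P.plus_eq_zero (ξ := u 0 - w 0) fun n hn => by simp [hp n hn]]
    simpa using P.minus_nonneg (ξ := u 0 - w 0)
  have hV1 := h.V_nonneg hV (t := t - 1) ⟨hat, by linarith⟩
  have h1 := (h.mono'' le_rfl hat (by linarith)).squeeze hV1
  have h2 := (h.mono'' hat (by linarith : t - 1 ≤ 0) le_rfl).integral_le_of_nonneg hV
  have hm := (h.mono'' le_rfl (by linarith : a ≤ t) ht)
  have h3 := hm.zeroSq_le_integral (by linarith)
  refine ⟨h3.1, h3.2.trans ?_⟩
  have h4 := integral_mono_subinterval le_rfl (by linarith : t - 1 ≤ t) ht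
    ((h.mono'' hat (by linarith : t - 1 ≤ 0) le_rfl).intervalIntegrable_zeroSq P.spec)
    (ae_of_all _ fun t _ => zeroSq_nonneg (u t - w t))
  have ma := h.mem_neg P.spec (left_mem_Icc.2 ha)
  have h5 : P.V (u a - w a) ≤ 4 * B := by
    rw [P.V_eq ma]
    have := wForm_sub_le P.spec (abs_cQ_le P.N) (cQ_nonneg P.N) (S.orbit ha hu).init
      (S.orbit ha hw).init
    have := P.plus_nonneg (ξ := u a - w a)
    simp only [ConeParams.minus] at *
    linarith
  have hμ := P.μ_pos
  have h6 : P.μ * ∫ r in (t - 1)..t, zeroSq (u r - w r) ≤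
      Real.exp (-(P.αm * (t - 1 - a))) * (4 * B) :=
    (mul_le_mul_of_nonneg_left h4 hμ.le).trans (h2.trans (h1.trans (by gcongr)))
  rw [← le_inv_mul_iff₀ hμ] at h6
  calc _ ≤ (1 + P.L ^ 2) * (P.μ⁻¹ * (Real.exp (-(P.αm * (t - 1 - a))) * (4 * B))) := by gcongr
    _ = _ := by ring

/-- The coefficients form Cauchy sequences, and the limit again follows the flow because the flow is
Lipschitz in H^{-1}. -/
theorem exists_limit_past (S : ConeSystem P e F F' α C) {u : ℕ → ℝ → ℕ → ℝ} {τ : ℝ} (hτ : 0 < τ)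
    (hu : ∀ k : ℕ, IsSolution e P.lam F (u k) (-(k * τ)) 0) {ε : ℝ → ℕ → ℝ}
    (hε : ∀ t, Tendsto (ε t) atTop (𝓝 0))
    (h : ∀ t ≤ 0, ∀ k m : ℕ, k ≤ m → -(k * τ) ≤ t - 1 →
      (Summable fun n => (u k t - u m t) n ^ 2) ∧ zeroSq (u k t - u m t) ≤ ε t k) :
    ∃ w, S.Past w ∧ ∀ t ≤ 0, ∀ n, Tendsto (fun k => u k t n) atTop (𝓝 (w t n)) := by
  have hev : ∀ t, ∀ᶠ k : ℕ in atTop, -(k * τ) ≤ t - 1 := fun t => by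
    have h1 : Tendsto (fun k : ℕ => (k : ℝ) * τ) atTop atTop :=
      tendsto_natCast_atTop_atTop.atTop_mul_const hτ
    filter_upwards [h1.eventually_ge_atTop (1 - t)] with k hk
    linarith
  have hlim : ∀ t, t ≤ 0 → ∀ n, ∃ y, Tendsto (fun k => u k t n) atTop (𝓝 y) := fun t ht n => by
    refine cauchySeq_tendsto_of_complete (Metric.cauchySeq_iff'.2 fun r hr => ?_)
    obtain ⟨k, hk1, hk2⟩ := (((hε t).eventually (gt_mem_nhds (by positivity : (0:ℝ) < r ^ 2))).and
      (hev t)).exists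
    refine ⟨k, fun m hm => ?_⟩
    have h1 := h t ht k m hm hk2
    have h2 := h1.1.le_tsum n fun i _ => sq_nonneg _
    rw [dist_comm, Real.dist_eq]
    exact abs_lt_of_sq_lt_sq ((h2.trans h1.2).trans_lt hk1) hr.le
  choose! w hw using hlim
  have hz : ∀ t ≤ 0, ∀ᶠ k in atTop, (Summable fun n => (u k t - w t) n ^ 2) ∧
      zeroSq (u k t - w t) ≤ ε t k := fun t ht => by
    filter_upwards [hev t] with k hk
    refine zeroSq_le_of_tendsto (x := fun m => u k t - u m t) (l := atTop)
      (fun n => tendsto_const_nhds.sub (hw t ht n)) ?_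
    filter_upwards [eventually_ge_atTop k] with m hm using h t ht k m hm hk
  have hum : ∀ t ≤ 0, ∀ᶠ k in atTop, Summable fun n => (P.lam n)⁻¹ * u k t n ^ 2 := fun t ht => by
    filter_upwards [hev t] with k hk
    exact (S.orbit (neg_nonpos.2 (by positivity)) (hu k)).mem_neg P.spec ⟨by linarith, ht⟩
  have hwm : ∀ t ≤ 0, Summable fun n => (P.lam n)⁻¹ * w t n ^ 2 := fun t ht => by
    obtain ⟨k, h1, h2⟩ := ((hz t ht).and (hum t ht)).exists
    have := summable_neg_sub P.spec h2 (summable_neg_of_zero P.spec h1.1)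
    simpa using this
  refine ⟨w, ⟨hwm, fun r s hs hrs => ?_⟩, hw⟩
  have hr : r ≤ 0 := by linarith
  ext n
  refine tendsto_nhds_unique (hw (r + s) hrs n) ?_
  have h0 : Tendsto (fun k => P.lam n * (Real.exp (P.L ^ 2 * s) * ((P.lam 0)⁻¹ * ε r k))) atTop
      (𝓝 0) := by
    simpa using (((hε r).const_mul ((P.lam 0)⁻¹)).const_mul (Real.exp (P.L ^ 2 * s))).const_mul
      (P.lam n)
  have h0' := (Real.continuous_sqrt.tendsto 0).comp h0
  rw [Real.sqrt_zero] at h0'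
  refine tendsto_iff_dist_tendsto_zero.2 (squeeze_zero' (Eventually.of_forall fun _ => dist_nonneg)
    ?_ h0')
  filter_upwards [hz r hr, hum r hr, hev r] with k h1 h2 h3
  have hpos : -(k * τ) ≤ (0 : ℝ) := neg_nonpos.2 (by positivity)
  have e1 : u k (r + s) = S.flow s (u k r) := by
    have := S.eq_flow ((hu k).mono P.spec S.bound (s := r) (t := 0) (by linarith) hr le_rfl)
      (t := r + s) ⟨by linarith, hrs⟩
    simpa using this
  rw [Real.dist_eq, e1]
  apply Real.abs_le_sqrt
  have hp := (P.spec.pos n).le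
  have h4 := mode_sq_le_negSq P.spec
    (summable_neg_sub P.spec (S.flow_mem h2 hs) (S.flow_mem (hwm r hr) hs)) n
  refine h4.trans (mul_le_mul_of_nonneg_left ?_ hp)
  refine (S.flow_negSq_le h2 (hwm r hr) hs).trans (mul_le_mul_of_nonneg_left ?_ (Real.exp_pos _).le)
  exact (negSq_le_zeroSq P.spec h1.1).trans
    (mul_le_mul_of_nonneg_left h1.2 (inv_nonneg.2 P.spec.zero_pos.le))

/-- A trajectory for `t ≤ 0` with bounded high modes exists above every low-mode vector. -/
theorem exists_past (S : ConeSystem P e F F' α C) :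
    ∃ B, 0 ≤ B ∧ ∀ p : Fin P.N → ℝ, ∃ u, S.Past u ∧ (∀ t ≤ 0, P.minus (u t) ≤ B) ∧
      ∀ i : Fin P.N, u 0 i = p i := by
  obtain ⟨τ, hτ, h⟩ := S.exists_approximation
  have p0 := P.spec.zero_pos
  have pN := P.spec.pos P.N
  -- The absorbing radius for κ = 1; solutions that start without high modes never leave the
  -- corresponding ball.
  set B := (1 : ℝ)⁻¹ * ((P.lam 0)⁻¹ * C ^ 2) / ((2 - 1) * P.lam P.N ^ 2) with hB
  have hB0 : 0 ≤ B := div_nonneg (by positivity) (mul_nonneg (by norm_num) (sq_nonneg _))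
  refine ⟨B, hB0, fun p => ?_⟩
  choose u hu hu0 hup using h p
  have hk0 : ∀ k : ℕ, -(k * τ) ≤ (0 : ℝ) := fun k => neg_nonpos.2 (by positivity)
  have hbd : ∀ k : ℕ, ∀ t ∈ Icc (-(k * τ)) 0, P.minus (u k t) ≤ B := fun k t ht => by
    have := S.minus_le ht.1 ((hu k).mono P.spec S.bound le_rfl ht.1 ht.2) one_pos one_lt_two
    rwa [hu0, mul_zero, zero_add] at this
  obtain ⟨w, hw, hlim⟩ := S.exists_limit_past hτ hu
    (ε := fun t k => (1 + P.L ^ 2) * P.μ⁻¹ * (4 * B) * Real.exp (-(P.αm * (t - 1 - -(k * τ)))))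
    (fun t => by
      have h1 : Tendsto (fun k : ℕ => P.αm * (t - 1 - -(k * τ))) atTop atTop := by
        refine Tendsto.const_mul_atTop P.αm_pos ?_
        simp only [sub_neg_eq_add]
        exact tendsto_atTop_add_const_left _ _ (tendsto_natCast_atTop_atTop.atTop_mul_const hτ)
      have := (Real.tendsto_exp_neg_atTop_nhds_zero.comp h1).const_mul
        ((1 + P.L ^ 2) * P.μ⁻¹ * (4 * B))
      simpa using this)
    (fun t ht k m hkm hk => by
      have hmk : -(m * τ) ≤ -((k : ℝ) * τ) := by
        have : (k : ℝ) ≤ m := by exact_mod_cast hkm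
        have := mul_le_mul_of_nonneg_right this hτ.le
        linarith
      exact S.zeroSq_sub_le_of_plus_eq (hu k) ((hu m).mono P.spec S.bound hmk (hk0 k) le_rfl)
        (fun n hn => (hup k ⟨n, hn⟩).trans (hup m ⟨n, hn⟩).symm)
        (hbd k _ ⟨le_rfl, hk0 k⟩) (hbd m _ ⟨hmk, hk0 k⟩) hk ht)
  refine ⟨w, hw, fun t ht => ?_, fun i => ?_⟩
  · have := sum_le_of_tendsto (a := fun n => cQ P.N n * (P.lam n)⁻¹) (B := B)
      (fun n => mul_nonneg (cQ_nonneg _ _) (inv_nonneg.2 (P.spec.pos n).le)) (hlim t ht) (by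
        have h1 : Tendsto (fun k : ℕ => (k : ℝ) * τ) atTop atTop :=
          tendsto_natCast_atTop_atTop.atTop_mul_const hτ
        filter_upwards [h1.eventually_ge_atTop (-t)] with k hk
        have hm : t ∈ Icc (-(k * τ)) 0 := ⟨by linarith, ht⟩
        have h2 := summable_wForm P.spec ((S.orbit (hk0 k) (hu k)).mem_neg P.spec hm) (abs_cQ_le P.N)
        have h3 := hbd k t hm
        simp only [ConeParams.minus, wForm] at h3
        simp only [mul_assoc]
        exact ⟨h2, h3⟩)
    simp only [ConeParams.minus, wForm]
    simpa only [mul_assoc] using this.2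
  · exact tendsto_nhds_unique (hlim 0 le_rfl i)
      (tendsto_const_nhds.congr fun k => (hup k i).symm)

end ConeSystem

/-! ### The invariant manifold and exponential tracking. -/

theorem wForm_le_add {lam c : ℕ → ℝ} {ξ η : ℕ → ℝ} {ε : ℝ} (hl : IsSpectrum lam) (hε : 0 < ε)
    (hc : ∀ n, |c n| ≤ 1) (hc0 : ∀ n, 0 ≤ c n)
    (hξ : Summable fun n => (lam n)⁻¹ * ξ n ^ 2) (hη : Summable fun n => (lam n)⁻¹ * η n ^ 2) :
    wForm lam c ξ ≤ (1 + ε) * wForm lam c η + (1 + ε⁻¹) * wForm lam c (ξ - η) := by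
  refine hasSum_le (fun n => ?_) (summable_wForm hl hξ hc).hasSum
    (((summable_wForm hl hη hc).hasSum.mul_left (1 + ε)).add
      ((summable_wForm hl (summable_neg_sub hl hξ hη) hc).hasSum.mul_left (1 + ε⁻¹)))
  have h1 : ξ n ^ 2 ≤ (1 + ε) * η n ^ 2 + (1 + ε⁻¹) * (ξ - η) n ^ 2 := by
    have e : (1 + ε) * η n ^ 2 + (1 + ε⁻¹) * (ξ - η) n ^ 2 - ξ n ^ 2 =
        ε⁻¹ * (ε * η n - (ξ n - η n)) ^ 2 := by
      simp only [Pi.sub_apply]; field_simp; ring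
    have : 0 ≤ ε⁻¹ * (ε * η n - (ξ n - η n)) ^ 2 := by positivity
    linarith
  have h2 := mul_le_mul_of_nonneg_left (mul_le_mul_of_nonneg_left h1
    (inv_nonneg.2 (hl.pos n).le)) (hc0 n)
  linarith

/-- The set {V ≥ 0} is closed in H^{-1}: the low and high parts are compared by Young's inequality
with a parameter ε, sending first η to its limit and then ε to 0. -/
theorem ConeParams.V_nonneg_of_tendsto {P : ConeParams} {ι : Type*} {l : Filter ι} [NeBot l]
    {ξ : ℕ → ℝ} {η : ι → ℕ → ℝ} (hξ : Summable fun n => (P.lam n)⁻¹ * ξ n ^ 2)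
    (hη : ∀ k, Summable fun n => (P.lam n)⁻¹ * η k n ^ 2)
    (hlim : Tendsto (fun k => negSq P.lam (η k - ξ)) l (𝓝 0)) (h : ∀ᶠ k in l, 0 ≤ P.V (η k)) :
    0 ≤ P.V ξ := by
  have key : ∀ ε : ℝ, 0 < ε → P.plus ξ ≤ (1 + ε) * ((1 + ε) * P.minus ξ) := fun ε hε => by
    have h1 : Tendsto (fun k => (1 + ε) * ((1 + ε) * P.minus ξ + (1 + ε⁻¹) * negSq P.lam (η k - ξ)) +
        (1 + ε⁻¹) * negSq P.lam (η k - ξ)) l (𝓝 ((1 + ε) * ((1 + ε) * P.minus ξ))) := by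
      have a1 := hlim.const_mul (1 + ε⁻¹)
      simpa using ((a1.const_add ((1 + ε) * P.minus ξ)).const_mul (1 + ε)).add a1
    refine ge_of_tendsto h1 ?_
    filter_upwards [h] with k hk
    rw [P.V_eq (hη k)] at hk
    have s1 := summable_neg_sub P.spec (hη k) hξ
    have s2 := summable_neg_sub P.spec hξ (hη k)
    have e1 := wForm_le_add P.spec hε (abs_cP_le P.N) (cP_nonneg P.N) hξ (hη k)
    have e2 := wForm_le_add P.spec hε (abs_cQ_le P.N) (cQ_nonneg P.N) (hη k) hξ
    have e3 := (le_abs_self _).trans (abs_wForm_le P.spec s1 (abs_cQ_le P.N))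
    have e4 := (le_abs_self _).trans (abs_wForm_le P.spec s2 (abs_cP_le P.N))
    have e5 : negSq P.lam (ξ - η k) = negSq P.lam (η k - ξ) := by
      unfold negSq; congr 1; ext n; simp only [Pi.sub_apply]; ring
    rw [e5] at e4
    have e6 : 0 ≤ 1 + ε⁻¹ := by positivity
    have e7 := mul_le_mul_of_nonneg_left e3 e6
    have e8 := mul_le_mul_of_nonneg_left e4 e6
    simp only [ConeParams.plus, ConeParams.minus] at *
    have e9 : (1 + ε) * wForm P.lam (cP P.N) (η k) ≤ (1 + ε) *
        ((1 + ε) * wForm P.lam (cQ P.N) ξ + (1 + ε⁻¹) * negSq P.lam (η k - ξ)) := by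
      have : 0 ≤ 1 + ε := by positivity
      refine mul_le_mul_of_nonneg_left ?_ this
      linarith
    linarith
  have h2 : Tendsto (fun ε : ℝ => (1 + ε) * ((1 + ε) * P.minus ξ)) (𝓝[>] 0) (𝓝 (P.minus ξ)) := by
    have : Continuous fun ε : ℝ => (1 + ε) * ((1 + ε) * P.minus ξ) := by fun_prop
    have := this.tendsto 0
    simp only [add_zero, one_mul] at this
    exact this.mono_left nhdsWithin_le_nhds
  have := ge_of_tendsto h2 (by filter_upwards [self_mem_nhdsWithin] with ε hε using key ε hε)
  rw [P.V_eq hξ]; linarith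

namespace ConeSystem

variable {H : Type*} [NormedAddCommGroup H] [InnerProductSpace ℝ H] [MeasurableSpace H]
  {P : ConeParams} {e : HilbertBasis ℕ ℝ H} {F : H → H} {F' : H → H →L[ℝ] H} {α : H → ℝ} {C : ℝ}
  {u w : ℝ → ℕ → ℝ} {a b s t : ℝ} {ξ η : ℕ → ℝ} [CompleteSpace H]

/-- A trajectory for `t ≤ 0` with bounded high modes. -/
structure BoundedPast (S : ConeSystem P e F F' α C) (u : ℝ → ℕ → ℝ) : Prop extends Past S u where
  bdd : ∃ B, ∀ t ≤ 0, P.minus (u t) ≤ B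

/-- The states on trajectories with bounded high modes. -/
def manifold (S : ConeSystem P e F F' α C) : Set (ℕ → ℝ) := {ξ | ∃ u, S.BoundedPast u ∧ u 0 = ξ}

namespace BoundedPast

variable {S : ConeSystem P e F F' α C}

theorem shift' (h : S.BoundedPast u) {τ : ℝ} (hτ : τ ≤ 0) : S.BoundedPast (fun t => u (t + τ)) :=
  ⟨h.shift hτ, h.bdd.imp fun _ hB t ht => hB _ (by linarith)⟩

theorem coneOrbit (hu : S.BoundedPast u) (hw : S.BoundedPast w) (hab : a ≤ b) (hb : b ≤ 0) :
    ConeOrbit P (fun t => u t - w t)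
      (fun t => coeff e (F (toH e (u t))) - coeff e (F (toH e (w t)))) a b :=
  S.coneOrbit hab (hu.isSolution hab hb) (hw.isSolution hab hb)

theorem V_nonpos (hu : S.BoundedPast u) (hw : S.BoundedPast w) (ht : t ≤ 0) :
    P.V (u t - w t) ≤ 0 := by
  obtain ⟨B, hB⟩ := (hu.shift' ht).bdd
  obtain ⟨B', hB'⟩ := (hw.shift' ht).bdd
  have := S.V_nonpos_of_bounded (B := max B B') (hu.shift ht) (hw.shift ht)
    (fun t ht => (hB t ht).trans (le_max_left _ _)) (fun t ht => (hB' t ht).trans (le_max_right _ _))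
  simpa using this

theorem summable_sq (hu : S.BoundedPast u) (ht : t ≤ 0) : Summable fun n => u t n ^ 2 :=
  ((S.orbit (by linarith) (hu.isSolution (a := t - 1) (by linarith) ht)).smoothing P.spec
    (by linarith)).1

theorem integral_le (hu : S.BoundedPast u) (hw : S.BoundedPast w) {T : ℝ} (hT : 0 ≤ T) :
    ∫ r in (-T)..0, zeroSq (u r - w r) ≤ P.μ⁻¹ * Real.exp (P.αp * T) * P.plus (u 0 - w 0) := by
  have := (hu.coneOrbit hw (neg_nonpos.2 hT) le_rfl).integral_le_of_nonpos
    (hu.V_nonpos hw (neg_nonpos.2 hT))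
  simpa using this

/-- The past of a difference is governed by its low modes at time 0, with growth at most e^{α₊|t|}
for the square of the norm. Uniqueness over the low modes, the Lipschitz constant of the manifold
and the time for which trajectories stay close all come from here. -/
theorem zeroSq_le (hu : S.BoundedPast u) (hw : S.BoundedPast w) (ht : t ≤ 0) :
    zeroSq (u t - w t) ≤
      (1 + P.L ^ 2) * P.μ⁻¹ * Real.exp (P.αp * (-t + 1)) * P.plus (u 0 - w 0) := by
  have h1 := hu.integral_le hw (T := -t + 1) (by linarith)
  have h2 := ((hu.coneOrbit hw (a := t - 1) (b := t) (by linarith) ht).zeroSq_le_integral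
    (by linarith)).2
  have h3 := integral_mono_subinterval (a := -(-t + 1)) (b := 0) (c := t - 1) (d := t)
    (by linarith) (by linarith) ht
    ((hu.coneOrbit hw (a := -(-t + 1)) (b := 0) (by linarith) le_rfl).intervalIntegrable_zeroSq P.spec)
    (ae_of_all _ fun t _ => zeroSq_nonneg (u t - w t))
  calc _ ≤ (1 + P.L ^ 2) * (P.μ⁻¹ * Real.exp (P.αp * (-t + 1)) * P.plus (u 0 - w 0)) := by
        have := h3.trans h1
        exact h2.trans (by gcongr)
    _ = _ := by ring

theorem eq_of_low (hu : S.BoundedPast u) (hw : S.BoundedPast w) (h : ∀ n < P.N, u 0 n = w 0 n)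
    (ht : t ≤ 0) : u t = w t := by
  have h1 := hu.zeroSq_le hw ht
  rw [P.plus_eq_zero (ξ := u 0 - w 0) fun n hn => by simp [h n hn], mul_zero] at h1
  have s := (zeroSq_sub_le (hu.summable_sq ht) (hw.summable_sq ht)).1
  have s1 := summable_neg_of_zero P.spec s
  refine sub_eq_zero.1 (P.eq_zero_of_negSq s1 ((negSq_le_zeroSq P.spec s).trans ?_))
  exact mul_nonpos_of_nonneg_of_nonpos (inv_nonneg.2 P.spec.zero_pos.le) h1

theorem extend' (h : S.BoundedPast u) (τ : ℝ) :
    S.BoundedPast (fun t => if t ≤ -τ then u (t + τ) else S.flow (t + τ) (u 0)) := by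
  have h1 := h.toPast.extend τ
  refine ⟨h1, ?_⟩
  obtain ⟨B, hB⟩ := h.bdd
  have p0 := P.spec.zero_pos
  have pN := P.spec.pos P.N
  have hB0 : 0 ≤ B := P.minus_nonneg.trans (hB 0 le_rfl)
  set K := (1 : ℝ)⁻¹ * ((P.lam 0)⁻¹ * C ^ 2) / ((2 - 1) * P.lam P.N ^ 2) with hK
  have hK0 : 0 ≤ K := div_nonneg (by positivity) (mul_nonneg (by norm_num) (sq_nonneg _))
  refine ⟨B + K, fun t ht => ?_⟩
  split_ifs with h2
  · have := hB (t + τ) (by linarith); linarith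
  · push Not at h2
    have h3 := (S.flow_spec (h.mem 0 le_rfl)).2 (t + τ) (by linarith)
    have h4 := S.minus_le (by linarith) h3 one_pos one_lt_two
    rw [S.flow_zero (h.mem 0 le_rfl), ← hK] at h4
    have h5 : Real.exp (-((2 - 1) * P.lam P.N ^ 2 * (t + τ - 0))) ≤ 1 := by
      rw [Real.exp_le_one_iff, neg_nonpos]
      exact mul_nonneg (by positivity) (by linarith)
    have h6 := mul_le_of_le_one_left (P.minus_nonneg (ξ := u 0)) h5
    have := hB 0 le_rfl
    linarith

end BoundedPast

theorem summable_of_mem_manifold (S : ConeSystem P e F F' α C) (h : ξ ∈ S.manifold) :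
    Summable fun n => ξ n ^ 2 := by
  obtain ⟨u, hu, rfl⟩ := h
  exact hu.summable_sq le_rfl

theorem eq_of_mem_manifold (S : ConeSystem P e F F' α C) (hξ : ξ ∈ S.manifold) (hη : η ∈ S.manifold)
    (h : ∀ n < P.N, ξ n = η n) : ξ = η := by
  obtain ⟨u, hu, rfl⟩ := hξ
  obtain ⟨w, hw, rfl⟩ := hη
  exact hu.eq_of_low hw h le_rfl

theorem V_nonpos_of_mem_manifold (S : ConeSystem P e F F' α C) (hξ : ξ ∈ S.manifold)
    (hη : η ∈ S.manifold) : P.V (ξ - η) ≤ 0 := by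
  obtain ⟨u, hu, rfl⟩ := hξ
  obtain ⟨w, hw, rfl⟩ := hη
  exact hu.V_nonpos hw le_rfl

theorem exists_mem_manifold (S : ConeSystem P e F F' α C) (p : ℕ → ℝ) :
    ∃ ξ ∈ S.manifold, ∀ n < P.N, ξ n = p n := by
  obtain ⟨B, -, h⟩ := S.exists_past
  obtain ⟨u, hu, hb, hp⟩ := h fun i => p i
  exact ⟨u 0, ⟨u, ⟨hu, B, hb⟩, rfl⟩, fun n hn => hp ⟨n, hn⟩⟩

theorem image_manifold (S : ConeSystem P e F F' α C) (ht : 0 ≤ t) :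
    S.flow t '' S.manifold = S.manifold := by
  apply subset_antisymm
  · rintro _ ⟨_, ⟨u, hu, rfl⟩, rfl⟩
    refine ⟨_, hu.extend' t, ?_⟩
    split_ifs with h
    · have : t = 0 := by linarith
      subst this
      rw [add_zero, S.flow_zero (hu.mem 0 le_rfl)]
    · rw [zero_add]
  · rintro _ ⟨u, hu, rfl⟩
    refine ⟨u (-t), ⟨_, hu.shift' (τ := -t) (by linarith), by simp⟩, ?_⟩
    have := hu.flow_eq (-t) t ht (by simp)
    rw [← this, neg_add_cancel]

/-- The states of the manifold that agree with `ξ` in the low modes after a long time converge along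
a subsequence, and the limit stays outside the cone with vertex on the trajectory of `ξ`. -/
theorem exists_tracking_point (S : ConeSystem P e F F' α C)
    (hξ : Summable fun n => (P.lam n)⁻¹ * ξ n ^ 2) :
    ∃ η ∈ S.manifold, ∀ t, 0 ≤ t → 0 ≤ P.V (S.flow t ξ - S.flow t η) := by
  obtain ⟨B, hB, hpast⟩ := S.exists_past
  choose u hu hub hup using fun k : ℕ => hpast fun i => S.flow k ξ i
  have hbp : ∀ k, S.BoundedPast (u k) := fun k => ⟨hu k, B, hub k⟩
  set η : ℕ → ℕ → ℝ := fun k => u k (-k) with hη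
  have hk0 : ∀ k : ℕ, -(k : ℝ) ≤ 0 := fun k => by simp
  have hηM : ∀ k, η k ∈ S.manifold := fun k => ⟨_, (hbp k).shift' (hk0 k), by simp [hη]⟩
  have hηs : ∀ k, Summable fun n => (P.lam n)⁻¹ * η k n ^ 2 := fun k => (hu k).mem _ (hk0 k)
  have hηk : ∀ k : ℕ, S.flow k (η k) = u k 0 := fun k => by
    have := (hu k).flow_eq (-k) k k.cast_nonneg (by simp)
    rw [← this, neg_add_cancel]
  -- At time k the two solutions share their low modes, so V ≥ 0 there, and backward invariance
  -- extends this to [0, k].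
  have hV : ∀ k : ℕ, ∀ t ∈ Icc (0 : ℝ) k, 0 ≤ P.V (S.flow t ξ - S.flow t (η k)) := fun k t ht => by
    obtain ⟨g, hg⟩ := S.flow_diff hξ (hηs k) k.cast_nonneg
    refine hg.V_nonneg ?_ ht
    rw [P.V_eq (hg.mem_neg P.spec (right_mem_Icc.2 k.cast_nonneg)), hηk]
    rw [P.plus_eq_zero (ξ := S.flow k ξ - u k 0) fun n hn => by
      have := hup k ⟨n, hn⟩
      simp only at this
      simp [this]]
    simpa using P.minus_nonneg (ξ := S.flow k ξ - u k 0)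
  -- At time 0, V ≥ 0 bounds the low modes of ξ - η by its high modes, which are bounded uniformly
  -- in k. This is the compactness needed for a subsequence.
  set R := P.lam P.N * (2 * P.minus ξ + 2 * B) with hR
  have hlow : ∀ k : ℕ, ∀ n < P.N, |η k n - ξ n| ≤ √R := fun k n hn => by
    apply Real.abs_le_sqrt
    have h1 := hV k 0 ⟨le_rfl, k.cast_nonneg⟩
    rw [S.flow_zero hξ, S.flow_zero (hηs k), P.V_eq (summable_neg_sub P.spec hξ (hηs k))] at h1
    have h2 := wForm_sub_le P.spec (abs_cQ_le P.N) (cQ_nonneg P.N) hξ (hηs k)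
    have h3 := hub k (-k) (hk0 k)
    have h4 : (P.lam n)⁻¹ * (ξ - η k) n ^ 2 ≤ P.plus (ξ - η k) := by
      rw [P.plus_eq]
      exact Finset.single_le_sum (f := fun n => (P.lam n)⁻¹ * (ξ - η k) n ^ 2)
        (fun m _ => mul_nonneg (inv_nonneg.2 (P.spec.pos m).le) (sq_nonneg _)) (Finset.mem_range.2 hn)
    rw [inv_mul_le_iff₀ (P.spec.pos n)] at h4
    have h5 : P.plus (ξ - η k) ≤ 2 * P.minus ξ + 2 * B := by
      simp only [ConeParams.minus] at *; linarith
    have h6 := P.spec.mono hn.le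
    have h7 := P.plus_nonneg (ξ := ξ - η k)
    have h8 := P.spec.pos P.N
    calc (η k n - ξ n) ^ 2 = (ξ - η k) n ^ 2 := by simp only [Pi.sub_apply]; ring
      _ ≤ P.lam n * P.plus (ξ - η k) := h4
      _ ≤ R := by rw [hR]; gcongr
  obtain ⟨p, -, φ, hφ, hlim⟩ := tendsto_subseq_of_bounded
    (Metric.isBounded_closedBall (x := fun i : Fin P.N => ξ i) (r := √R))
    (x := fun k (i : Fin P.N) => η k i) (fun k => by
      rw [Metric.mem_closedBall, dist_pi_le_iff (Real.sqrt_nonneg _)]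
      exact fun i => by rw [Real.dist_eq]; exact hlow k i i.2)
  obtain ⟨w, hw, hwb, hwp⟩ := hpast p
  have hwM : w 0 ∈ S.manifold := ⟨w, ⟨hw, B, hwb⟩, rfl⟩
  have hws := hw.mem 0 le_rfl
  refine ⟨w 0, hwM, fun t ht => ?_⟩
  -- Both states lie on the manifold, where convergence of the low modes forces convergence in
  -- H^{-1}.
  have hzero : Tendsto (fun k => negSq P.lam (η (φ k) - w 0)) atTop (𝓝 0) := by
    have h1 : Tendsto (fun k => 2 * P.plus (η (φ k) - w 0)) atTop (𝓝 0) := by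
      have h2 : Tendsto (fun k => 2 * ∑ n ∈ Finset.range P.N, (P.lam n)⁻¹ * (η (φ k) n - w 0 n) ^ 2)
          atTop (𝓝 (2 * ∑ n ∈ Finset.range P.N, (P.lam n)⁻¹ * (w 0 n - w 0 n) ^ 2)) := by
        refine Tendsto.const_mul _ (tendsto_finsetSum _ fun n hn => ?_)
        refine (Tendsto.pow (Tendsto.sub_const ?_ _) 2).const_mul _
        have := tendsto_pi_nhds.1 hlim ⟨n, Finset.mem_range.1 hn⟩
        have h3 := hwp ⟨n, Finset.mem_range.1 hn⟩
        simp only at h3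
        rw [h3]; exact this
      simpa [P.plus_eq] using h2
    exact squeeze_zero (fun k => negSq_nonneg P.spec _) (fun k =>
      P.negSq_le_of_V_nonpos (summable_neg_sub P.spec (hηs _) hws)
        (S.V_nonpos_of_mem_manifold (hηM _) hwM)) h1
  refine P.V_nonneg_of_tendsto (l := atTop) (η := fun k => S.flow t ξ - S.flow t (η (φ k)))
    (summable_neg_sub P.spec (S.flow_mem hξ ht) (S.flow_mem hws ht))
    (fun k => summable_neg_sub P.spec (S.flow_mem hξ ht) (S.flow_mem (hηs _) ht)) ?_ ?_
  · have h1 := hzero.const_mul (Real.exp (P.L ^ 2 * t))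
    rw [mul_zero] at h1
    refine squeeze_zero (fun k => negSq_nonneg P.spec _) (fun k => ?_) h1
    have h2 := S.flow_negSq_le (hηs (φ k)) hws ht
    refine (le_of_eq ?_).trans h2
    unfold negSq; congr 1; ext n; simp only [Pi.sub_apply]; ring
  · filter_upwards [(tendsto_natCast_atTop_atTop (R := ℝ)).comp hφ.tendsto_atTop
      |>.eventually_ge_atTop t] with k hk
    exact hV (φ k) t ⟨ht, hk⟩

/-- Since V of the difference stays nonnegative, it is squeezed up to time t - 1, and dissipation
with smoothing over [t - 1, t] bounds the difference in H. Times t ≤ 1 are covered by the Lipschitz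
continuity of the flow. -/
theorem exists_tracking (S : ConeSystem P e F F' α C) :
    ∃ K, 0 < K ∧ ∀ ξ : ℕ → ℝ, (Summable fun n => (P.lam n)⁻¹ * ξ n ^ 2) →
      ∃ η ∈ S.manifold, ∀ t, 0 ≤ t → negSq P.lam (S.flow t ξ - S.flow t η) ≤
        K * Real.exp (-(P.αm * t)) * negSq P.lam (ξ - η) := by
  have p0 := P.spec.zero_pos
  have hμ := P.μ_pos
  refine ⟨(P.lam 0)⁻¹ * ((1 + P.L ^ 2) * P.μ⁻¹) * Real.exp P.αm + Real.exp (P.L ^ 2 + P.αm),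
    by positivity, fun ξ hξ => ?_⟩
  obtain ⟨η, hη, hV⟩ := S.exists_tracking_point hξ
  refine ⟨η, hη, fun t ht => ?_⟩
  have hηs := summable_neg_of_zero P.spec (S.summable_of_mem_manifold hη)
  have hn := negSq_nonneg P.spec (ξ - η)
  obtain ⟨g, hg⟩ := S.flow_diff hξ hηs ht
  rcases le_total t 1 with h1 | h1
  · have h2 := S.flow_negSq_le hξ hηs ht
    have h3 : Real.exp (P.L ^ 2 * t) ≤ Real.exp (P.L ^ 2 + P.αm) * Real.exp (-(P.αm * t)) := by
      rw [← Real.exp_add]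
      apply Real.exp_le_exp.2
      nlinarith [sq_nonneg P.L, P.αm_pos]
    have h4 := mul_le_mul_of_nonneg_right h3 hn
    have h5 : 0 ≤ (P.lam 0)⁻¹ * ((1 + P.L ^ 2) * P.μ⁻¹) * Real.exp P.αm * Real.exp (-(P.αm * t)) *
      negSq P.lam (ξ - η) := by positivity
    linarith
  · have h2 := (hg.mono'' le_rfl (by linarith : 0 ≤ t - 1) (by linarith)).squeeze
      (hV _ (by linarith))
    have h3 := (hg.mono'' (by linarith : 0 ≤ t - 1) (by linarith) le_rfl).integral_le_of_nonneg
      (hV _ ht)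
    have h4 := hg.zeroSq_le_integral (by linarith)
    rw [← le_inv_mul_iff₀ hμ] at h3
    simp only [S.flow_zero hξ, S.flow_zero hηs, sub_zero] at h2
    have h5 := (le_abs_self _).trans (P.abs_V_le (summable_neg_sub P.spec hξ hηs))
    have h6 : Real.exp (-(P.αm * (t - 1))) = Real.exp P.αm * Real.exp (-(P.αm * t)) := by
      rw [← Real.exp_add]; congr 1; ring
    have h7 : 0 ≤ Real.exp (P.L ^ 2 + P.αm) * Real.exp (-(P.αm * t)) * negSq P.lam (ξ - η) := by
      positivity
    calc _ ≤ (P.lam 0)⁻¹ * zeroSq (S.flow t ξ - S.flow t η) := negSq_le_zeroSq P.spec h4.1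
      _ ≤ (P.lam 0)⁻¹ * ((1 + P.L ^ 2) * (P.μ⁻¹ * (Real.exp P.αm * Real.exp (-(P.αm * t)) *
          negSq P.lam (ξ - η)))) := by
        rw [← h6]
        have h8 := h2.trans (mul_le_mul_of_nonneg_left h5 (Real.exp_pos _).le)
        have h9 := h3.trans (mul_le_mul_of_nonneg_left h8 (inv_nonneg.2 hμ.le))
        have h10 := h4.2.trans (mul_le_mul_of_nonneg_left h9 (by positivity))
        exact mul_le_mul_of_nonneg_left h10 (inv_nonneg.2 p0.le)
      _ ≤ _ := by linarith

end ConeSystem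

/-! ### Graphs over the low modes and their identification with the manifold. -/

section Splitting

variable {H : Type*} [NormedAddCommGroup H] [InnerProductSpace ℝ H] {e : HilbertBasis ℕ ℝ H}

theorem mem_Hminus_iff {N : ℕ} {x : H} : x ∈ Hminus e N ↔ ∀ n < N, coeff e x n = 0 := by
  rw [Hminus, Submodule.mem_orthogonal]
  constructor
  · exact fun h n hn => h _ (Submodule.subset_span ⟨n, hn, rfl⟩)
  · intro h y hy
    induction hy using Submodule.span_induction with
    | mem y hy => obtain ⟨n, hn, rfl⟩ := hy; exact h n hn
    | zero => simp
    | add y z _ _ h1 h2 => rw [inner_add_left, h1, h2, add_zero]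
    | smul k y _ h1 => rw [inner_smul_left, h1, mul_zero]

theorem mem_Hplus_iff {N : ℕ} {x : H} : x ∈ Hplus e N ↔ ∀ n, N ≤ n → coeff e x n = 0 := by
  constructor
  · intro hx n hn
    induction hx using Submodule.span_induction with
    | mem y hy =>
      obtain ⟨m, hm, rfl⟩ := hy
      exact e.orthonormal.2 (by omega)
    | zero => simp [coeff_zero]
    | add y z _ _ h1 h2 => rw [coeff_add, Pi.add_apply, h1, h2, add_zero]
    | smul k y _ h1 => rw [coeff_smul, Pi.smul_apply, h1, smul_zero]
  · intro h
    have : x = ∑ n ∈ Finset.range N, coeff e x n • e n := by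
      apply coeff_injective e
      ext n
      rw [coeff_sum_basis]
      split_ifs with hn
      · rfl
      · exact h n (not_lt.1 hn)
    rw [this]
    exact Submodule.sum_mem _ fun n hn => Submodule.smul_mem _ _
      (Submodule.subset_span ⟨n, Finset.mem_range.1 hn, rfl⟩)

theorem coeff_add_of_lt {N n : ℕ} (p : Hplus e N) (q : Hminus e N) (hn : n < N) :
    coeff e ((p : H) + q) n = coeff e p n := by
  rw [coeff_add, Pi.add_apply, mem_Hminus_iff.1 q.2 n hn, add_zero]

theorem coeff_add_of_le {N n : ℕ} (p : Hplus e N) (q : Hminus e N) (hn : N ≤ n) :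
    coeff e ((p : H) + q) n = coeff e q n := by
  rw [coeff_add, Pi.add_apply, mem_Hplus_iff.1 p.2 n hn, zero_add]

namespace ConeParams

variable {P : ConeParams} {ξ η : ℕ → ℝ}

theorem plus_congr (h : ∀ n < P.N, ξ n = η n) : P.plus ξ = P.plus η := by
  rw [P.plus_eq, P.plus_eq]
  exact Finset.sum_congr rfl fun n hn => by rw [h n (Finset.mem_range.1 hn)]

theorem minus_congr (h : ∀ n, P.N ≤ n → ξ n = η n) : P.minus ξ = P.minus η := by
  unfold minus wForm cQ
  congr 1; ext n; split_ifs with hn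
  · simp
  · rw [h n (not_lt.1 hn)]

theorem plus_le_zeroSq (h : Summable fun n => ξ n ^ 2) : P.plus ξ ≤ (P.lam 0)⁻¹ * zeroSq ξ :=
  ((le_abs_self _).trans (abs_wForm_le P.spec (summable_neg_of_zero P.spec h) (abs_cP_le P.N))).trans
    (negSq_le_zeroSq P.spec h)

theorem minus_le_zeroSq (h : Summable fun n => ξ n ^ 2) : P.minus ξ ≤ (P.lam 0)⁻¹ * zeroSq ξ :=
  ((le_abs_self _).trans (abs_wForm_le P.spec (summable_neg_of_zero P.spec h) (abs_cQ_le P.N))).trans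
    (negSq_le_zeroSq P.spec h)

theorem plus_coeff_le (x : H) : P.plus (coeff e x) ≤ (P.lam 0)⁻¹ * ‖x‖ ^ 2 := by
  rw [← zeroSq_coeff e]; exact plus_le_zeroSq (summable_coeff_sq e x)

theorem minus_coeff_le (x : H) : P.minus (coeff e x) ≤ (P.lam 0)⁻¹ * ‖x‖ ^ 2 := by
  rw [← zeroSq_coeff e]; exact minus_le_zeroSq (summable_coeff_sq e x)

theorem norm_sq_le_plus (p : Hplus e P.N) : ‖(p : H)‖ ^ 2 ≤ P.lam P.N * P.plus (coeff e (p : H)) := by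
  rw [← zeroSq_coeff e, zeroSq, tsum_eq_sum (s := Finset.range P.N) fun n hn => by
    rw [mem_Hplus_iff.1 p.2 n (by simpa using hn)]; simp, P.plus_eq, Finset.mul_sum]
  refine Finset.sum_le_sum fun n hn => ?_
  have h1 := P.spec.mono (Finset.mem_range.1 hn).le
  have h2 := P.spec.pos n
  rw [← mul_assoc]
  refine le_mul_of_one_le_left (sq_nonneg _) ?_
  rw [← div_eq_mul_inv, one_le_div h2]; exact h1

end ConeParams

end Splitting

namespace ConeSystem

variable {H : Type*} [NormedAddCommGroup H] [InnerProductSpace ℝ H] [MeasurableSpace H]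
  {P : ConeParams} {e : HilbertBasis ℕ ℝ H} {F : H → H} {F' : H → H →L[ℝ] H} {α : H → ℝ} {C : ℝ}
  {u w : ℝ → ℕ → ℝ} {a b s t : ℝ} {ξ η : ℕ → ℝ} [CompleteSpace H]
  {Φ : Hplus e P.N → Hminus e P.N}

theorem zeroSq_sub_le_of_mem_manifold (S : ConeSystem P e F F' α C) (hξ : ξ ∈ S.manifold)
    (hη : η ∈ S.manifold) :
    zeroSq (ξ - η) ≤ (1 + P.L ^ 2) * P.μ⁻¹ * Real.exp P.αp * P.plus (ξ - η) := by
  obtain ⟨u, hu, rfl⟩ := hξ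
  obtain ⟨w, hw, rfl⟩ := hη
  simpa using hu.zeroSq_le hw le_rfl

theorem exists_minus_bound (S : ConeSystem P e F F' α C) : ∃ B, ∀ ξ ∈ S.manifold, P.minus ξ ≤ B := by
  obtain ⟨B, -, h⟩ := S.exists_past
  refine ⟨B, fun ξ hξ => ?_⟩
  obtain ⟨u, hu, hb, hp⟩ := h fun i => ξ i
  rw [S.eq_of_mem_manifold hξ ⟨u, ⟨hu, B, hb⟩, rfl⟩ fun n hn => (hp ⟨n, hn⟩).symm]
  exact hb 0 le_rfl

/-- A Lipschitz constant of the manifold over the low modes. -/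
noncomputable def slope (_ : ConeSystem P e F F' α C) : ℝ :=
  √((1 + P.L ^ 2) * P.μ⁻¹ * Real.exp P.αp * (P.lam 0)⁻¹)

theorem slope_nonneg (S : ConeSystem P e F F' α C) : 0 ≤ S.slope := Real.sqrt_nonneg _

theorem slope_sq (S : ConeSystem P e F F' α C) :
    S.slope ^ 2 = (1 + P.L ^ 2) * P.μ⁻¹ * Real.exp P.αp * (P.lam 0)⁻¹ :=
  Real.sq_sqrt (by have := P.spec.zero_pos; have := P.μ_pos; positivity)

theorem norm_graph_sub_le (S : ConeSystem P e F F' α C) (hΦ : graphSet e P.N Φ ⊆ S.manifold)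
    (p q : Hplus e P.N) : ‖((p : H) + Φ p) - (q + Φ q)‖ ≤ S.slope * ‖p - q‖ := by
  have h1 := S.zeroSq_sub_le_of_mem_manifold (hΦ (mem_range_self p)) (hΦ (mem_range_self q))
  have h2 : P.plus (coeff e ((p : H) + Φ p) - coeff e ((q : H) + Φ q)) =
      P.plus (coeff e ((p - q : Hplus e P.N) : H)) :=
    ConeParams.plus_congr fun n hn => by
      rw [Pi.sub_apply, coeff_add_of_lt _ _ hn, coeff_add_of_lt _ _ hn, Submodule.coe_sub, coeff_sub,
        Pi.sub_apply]
  have h3 := ConeParams.plus_coeff_le (P := P) (e := e) ((p - q : Hplus e P.N) : H)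
  rw [h2, ← coeff_sub, zeroSq_coeff] at h1
  have hμ := P.μ_pos
  refine (le_abs_self _).trans (abs_le_of_sq_le_sq ?_ (mul_nonneg (S.slope_nonneg) (norm_nonneg _)))
  rw [mul_pow, S.slope_sq]
  calc _ ≤ _ := h1
    _ ≤ (1 + P.L ^ 2) * P.μ⁻¹ * Real.exp P.αp * ((P.lam 0)⁻¹ * ‖p - q‖ ^ 2) := by
      gcongr; exact h3
    _ = _ := by ring

theorem exists_isInertialManifold (S : ConeSystem P e F F' α C) :
    ∃ Φ : Hplus e P.N → Hminus e P.N, IsInertialManifold e P.lam F P.N Φ := by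
  choose ξ hξ hp using fun p : Hplus e P.N => S.exists_mem_manifold (coeff e (p : H))
  have hs := fun p => S.summable_of_mem_manifold (hξ p)
  have hm : ∀ p : Hplus e P.N, toH e (ξ p) - p ∈ Hminus e P.N := fun p =>
    mem_Hminus_iff.2 fun n hn => by
      rw [coeff_sub, coeff_toH (hs p), Pi.sub_apply, hp p n hn, sub_self]
  set Φ : Hplus e P.N → Hminus e P.N := fun p => ⟨toH e (ξ p) - p, hm p⟩ with hΦ
  have hΦξ : ∀ p : Hplus e P.N, coeff e ((p : H) + Φ p) = ξ p := fun p => by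
    simp [hΦ, coeff_toH (hs p)]
  have hgr : graphSet e P.N Φ = S.manifold := by
    apply subset_antisymm
    · rintro _ ⟨p, rfl⟩
      simp only [hΦξ]; exact hξ p
    · intro η hη
      have h0 : (∑ n ∈ Finset.range P.N, coeff e (toH e η) n • e n) ∈ Hplus e P.N :=
        Submodule.sum_mem _ fun n hn => Submodule.smul_mem _ _
          (Submodule.subset_span ⟨n, Finset.mem_range.1 hn, rfl⟩)
      refine ⟨⟨_, h0⟩, (hΦξ _).trans (S.eq_of_mem_manifold (hξ _) hη fun n hn => ?_)⟩
      rw [hp _ n hn, coeff_sum_basis, if_pos hn, coeff_toH (S.summable_of_mem_manifold hη)]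
  refine ⟨Φ, ⟨fun t ht => ?_, ?_, ?_⟩⟩
  · rw [hgr]; exact S.image_manifold ht
  · refine ⟨(S.slope + 1).toNNReal, LipschitzWith.of_dist_le_mul fun p q => ?_⟩
    have h0 := S.slope_nonneg
    rw [Real.coe_toNNReal _ (by linarith), dist_eq_norm, dist_eq_norm]
    have h1 := S.norm_graph_sub_le hgr.subset p q
    have e1 : ((Φ p - Φ q : Hminus e P.N) : H) = ((p : H) + Φ p) - (q + Φ q) - (p - q : Hplus e P.N) := by
      push_cast; abel
    rw [Submodule.coe_norm, e1]
    refine (norm_sub_le _ _).trans ?_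
    rw [← Submodule.coe_norm]; linarith
  · obtain ⟨K, hK, h⟩ := S.exists_tracking
    -- The tracking estimate was proved for squared norms, hence the square root and the halved
    -- rate.
    refine ⟨√K, P.αm / 2, Real.sqrt_pos.2 hK, half_pos P.αm_pos, fun ξ hξ => ?_⟩
    obtain ⟨η, hη, h1⟩ := h ξ (memHs_neg_one.1 hξ)
    refine ⟨η, hgr ▸ hη, fun t ht => ?_⟩
    rw [normHs_neg_one, normHs_neg_one]
    have h2 : Real.exp (-(P.αm / 2) * t) = √(Real.exp (-(P.αm * t))) := by
      rw [← Real.exp_half]; congr 1; ring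
    rw [h2, ← Real.sqrt_mul hK.le, ← Real.sqrt_mul (by positivity)]
    exact Real.sqrt_le_sqrt (h1 t ht)

section Given

/-- Invariance provides successive preimages under S(1) inside the graph; the flow fills in the
times between integers. -/
theorem exists_graph_past (S : ConeSystem P e F F' α C)
    (hinv : ∀ t, 0 ≤ t → S.flow t '' graphSet e P.N Φ = graphSet e P.N Φ)
    (hξ : ξ ∈ graphSet e P.N Φ) :
    ∃ u, S.Past u ∧ u 0 = ξ ∧ ∀ t ≤ 0, u t ∈ graphSet e P.N Φ := by
  have hs : ∀ η ∈ graphSet e P.N Φ, Summable fun n => (P.lam n)⁻¹ * η n ^ 2 := by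
    rintro _ ⟨p, rfl⟩; exact summable_neg_of_zero P.spec (summable_coeff_sq e _)
  have hpre : ∀ η : graphSet e P.N Φ, ∃ ζ : graphSet e P.N Φ, S.flow 1 ζ = η := fun η => by
    obtain ⟨ζ, h1, h2⟩ := (hinv 1 zero_le_one).superset η.2
    exact ⟨⟨ζ, h1⟩, h2⟩
  choose g hg using hpre
  set x : ℕ → graphSet e P.N Φ := fun k => g^[k] ⟨ξ, hξ⟩ with hx
  have hx1 : ∀ k, S.flow 1 (x (k + 1)) = x k := fun k => by
    simp only [hx, Function.iterate_succ_apply', hg]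
  have hxm : ∀ k, Summable fun n => (P.lam n)⁻¹ * (x k : ℕ → ℝ) n ^ 2 := fun k => hs _ (x k).2
  have hxk : ∀ j k : ℕ, S.flow j (x (k + j)) = x k := fun j => by
    induction j with
    | zero => intro k; rw [Nat.cast_zero]; exact S.flow_zero (hxm _)
    | succ j ih =>
      intro k
      rw [Nat.cast_succ, S.flow_add (hxm _) j.cast_nonneg zero_le_one, ← add_assoc, hx1, ih]
  set u : ℝ → ℕ → ℝ := fun t => S.flow (t + ⌈-t⌉₊) (x ⌈-t⌉₊) with hu
  -- The value at t can be computed from any preimage far enough back, which makes the flow relation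
  -- immediate.
  have hut : ∀ (t : ℝ) (k : ℕ), -t ≤ k → u t = S.flow (t + k) (x k) := fun t k hk => by
    obtain ⟨j, rfl⟩ := Nat.exists_eq_add_of_le (Nat.ceil_le.2 hk)
    have h1 := Nat.le_ceil (-t)
    simp only [hu]
    conv_lhs => rw [← hxk j ⌈-t⌉₊]
    rw [← S.flow_add (hxm _) (by linarith) j.cast_nonneg]
    congr 1; push_cast; ring
  refine ⟨u, ⟨fun t _ => ?_, fun r s hs hrs => ?_⟩, ?_, fun t ht => ?_⟩
  · exact S.flow_mem (hxm _) (by linarith [Nat.le_ceil (-t)])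
  · have h1 := Nat.le_ceil (-r)
    rw [hut (r + s) ⌈-r⌉₊ (by linarith), hut r ⌈-r⌉₊ h1, ← S.flow_add (hxm _) hs (by linarith)]
    congr 1; ring
  · rw [hut 0 0 (by simp)]
    simp only [Nat.cast_zero, add_zero]
    rw [S.flow_zero (hxm 0)]; rfl
  · rw [← hinv (t + ⌈-t⌉₊) (by linarith [Nat.le_ceil (-t)])]
    exact mem_image_of_mem _ (x _).2

theorem exists_graph_minus_le (_S : ConeSystem P e F F' α C) {K : NNReal} (hΦ : LipschitzWith K Φ) :
    ∃ A D : ℝ, 0 ≤ D ∧ ∀ ξ ∈ graphSet e P.N Φ, P.minus ξ ≤ A + D * P.plus ξ := by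
  have p0 := P.spec.zero_pos
  have pN := P.spec.pos P.N
  refine ⟨(P.lam 0)⁻¹ * (2 * ‖Φ 0‖ ^ 2), (P.lam 0)⁻¹ * (2 * (K ^ 2 * P.lam P.N)), by positivity, ?_⟩
  rintro _ ⟨p, rfl⟩
  simp only
  rw [ConeParams.minus_congr (η := coeff e (Φ p : H)) fun n hn => coeff_add_of_le _ _ hn,
    ConeParams.plus_congr (η := coeff e (p : H)) fun n hn => coeff_add_of_lt _ _ hn]
  refine (ConeParams.minus_coeff_le _).trans ?_
  have h1 : ‖Φ p‖ ≤ ‖Φ 0‖ + K * ‖p‖ := by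
    have := hΦ.dist_le_mul p 0
    rw [dist_eq_norm, dist_zero_right] at this
    linarith [norm_le_norm_add_norm_sub (Φ 0) (Φ p), norm_sub_rev (Φ 0) (Φ p)]
  have h2 := ConeParams.norm_sq_le_plus p
  have h3 : ‖Φ p‖ ^ 2 ≤ 2 * ‖Φ 0‖ ^ 2 + 2 * (K ^ 2 * (P.lam P.N * P.plus (coeff e (p : H)))) := by
    calc ‖Φ p‖ ^ 2 ≤ (‖Φ 0‖ + K * ‖p‖) ^ 2 := pow_le_pow_left₀ (norm_nonneg _) h1 2
      _ ≤ 2 * ‖Φ 0‖ ^ 2 + 2 * (K ^ 2 * ‖p‖ ^ 2) := by nlinarith [sq_nonneg (‖Φ 0‖ - K * ‖p‖)]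
      _ ≤ _ := by gcongr; exact h2
  rw [← Submodule.coe_norm]
  have := mul_le_mul_of_nonneg_left h3 (inv_nonneg.2 p0.le)
  linarith

/-- On a Lipschitz graph the high modes are at most affine in the low modes. Going back by T, the
low modes grow no faster than e^{(2+κ)xT}, with x the square of `lam (N - 1)`; returning, the high
modes are damped by e^{-(2-κ)yT}, with y the square of `lam N`. The gap makes the damping win as T →
∞, leaving only the absorbing radius. -/
theorem graph_subset_manifold (S : ConeSystem P e F F' α C) (hN : 1 ≤ P.N) {K : NNReal}
    (hinv : ∀ t, 0 ≤ t → S.flow t '' graphSet e P.N Φ = graphSet e P.N Φ)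
    (hΦ : LipschitzWith K Φ) : graphSet e P.N Φ ⊆ S.manifold := by
  intro ξ hξ
  obtain ⟨u, hu, rfl, hg⟩ := S.exists_graph_past hinv hξ
  obtain ⟨A, D, hD, hAD⟩ := S.exists_graph_minus_le hΦ
  have hgap := S.gap hN
  have pa := P.spec.pos (P.N - 1)
  have pb := P.spec.pos P.N
  have p0 := P.spec.zero_pos
  set x := P.lam (P.N - 1) ^ 2 with hx
  set y := P.lam P.N ^ 2 with hy
  have hx0 : 0 < x := by positivity
  have hxy : x < y := pow_lt_pow_left₀ hgap pa.le two_ne_zero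
  -- With this κ the difference of the two rates is exactly y - x > 0.
  set κ := (y - x) / (y + x) with hκ
  have hκ0 : 0 < κ := div_pos (by linarith) (by linarith)
  have hκ2 : κ < 2 := by rw [hκ, div_lt_iff₀ (by linarith)]; linarith
  have hκe : (2 - κ) * y - (2 + κ) * x = y - x := by
    have : κ * (y + x) = y - x := by rw [hκ, div_mul_cancel₀]; linarith
    linarith
  set B₁ := κ⁻¹ * ((P.lam 0)⁻¹ * C ^ 2) / ((2 - κ) * y) with hB₁
  set B₂ := κ⁻¹ * ((P.lam 0)⁻¹ * C ^ 2) / ((2 + κ) * x) with hB₂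
  refine ⟨u, ⟨hu, B₁, fun t ht => ?_⟩, rfl⟩
  have key : ∀ T : ℝ, 0 ≤ T → P.minus (u t) ≤ Real.exp (-((2 - κ) * y * T)) * A +
      Real.exp (-((y - x) * T)) * (D * (P.plus (u t) + B₂)) + B₁ := fun T hT => by
    have hs := hu.isSolution (a := t - T) (b := t) (by linarith) ht
    have h1 := S.minus_le (by linarith) hs hκ0 hκ2
    have h2 := S.plus_le (by linarith) hs hκ0
    have h3 := hAD _ (hg (t - T) (by linarith))
    rw [sub_sub_cancel] at h1 h2
    have h4 : Real.exp (-((y - x) * T)) =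
        Real.exp (-((2 - κ) * y * T)) * Real.exp ((2 + κ) * x * T) := by
      rw [← Real.exp_add, ← hκe]; congr 1; ring
    rw [h4]
    have h5 := h3.trans (add_le_add_right (mul_le_mul_of_nonneg_left h2 hD) A)
    have h6 := mul_le_mul_of_nonneg_left h5 (Real.exp_pos (-((2 - κ) * y * T))).le
    linarith
  have hexp : ∀ k : ℝ, 0 < k → Tendsto (fun T => Real.exp (-(k * T))) atTop (𝓝 0) := fun k hk =>
    Real.tendsto_exp_neg_atTop_nhds_zero.comp (tendsto_id.const_mul_atTop hk)
  have hlim := (((hexp ((2 - κ) * y) (mul_pos (by linarith) (by linarith))).mul_const A).add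
    ((hexp (y - x) (by linarith)).mul_const (D * (P.plus (u t) + B₂)))).add_const B₁
  simp only [zero_mul, add_zero, zero_add] at hlim
  exact ge_of_tendsto hlim (eventually_atTop.2 ⟨0, key⟩)

/-- The inclusion is an equality because the graph has a point over every vector of low modes and
the manifold has at most one. -/
theorem graph_eq_manifold (S : ConeSystem P e F F' α C) (hN : 1 ≤ P.N)
    (hΦ : IsInertialManifold e P.lam F P.N Φ) : graphSet e P.N Φ = S.manifold := by
  obtain ⟨K, hK⟩ := hΦ.lipschitz
  have h := S.graph_subset_manifold hN hΦ.invariant hK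
  refine subset_antisymm h fun ξ hξ => ?_
  have h0 : (∑ n ∈ Finset.range P.N, coeff e (toH e ξ) n • e n) ∈ Hplus e P.N :=
    Submodule.sum_mem _ fun n hn => Submodule.smul_mem _ _
      (Submodule.subset_span ⟨n, Finset.mem_range.1 hn, rfl⟩)
  refine ⟨⟨_, h0⟩, S.eq_of_mem_manifold (h (mem_range_self _)) hξ fun n hn => ?_⟩
  refine (coeff_add_of_lt _ _ hn).trans ?_
  rw [coeff_sum_basis, if_pos hn, coeff_toH (S.summable_of_mem_manifold hξ)]

theorem boundedPast_of_isBackwardTrajectory (S : ConeSystem P e F F' α C)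
    (hΦ : graphSet e P.N Φ = S.manifold) {p : Hplus e P.N} {x : ℝ → H}
    (h : IsBackwardTrajectory e P.lam F P.N Φ p x) : S.BoundedPast fun t => coeff e (x t) := by
  obtain ⟨B, hB⟩ := S.exists_minus_bound
  exact ⟨Past.of_isSolution S h.solution, B, fun t ht => hB _ (hΦ ▸ h.on_graph t ht)⟩

theorem exists_isBackwardTrajectory (S : ConeSystem P e F F' α C)
    (hΦ : graphSet e P.N Φ = S.manifold) (p : Hplus e P.N) :
    ∃ x : ℝ → H, IsBackwardTrajectory e P.lam F P.N Φ p x := by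
  obtain ⟨u, hu, h0⟩ := hΦ.subset (mem_range_self p)
  have hc : ∀ t ≤ 0, coeff e (toH e (u t)) = u t := fun t ht => coeff_toH (hu.summable_sq ht)
  refine ⟨fun t => toH e (u t), ⟨fun T hT => ?_, fun t ht => ?_, ?_⟩⟩
  · exact (hu.isSolution (by linarith) le_rfl).congr P.spec S.bound (by linarith) fun t ht =>
      (hc t ht.2).symm
  · rw [hc t ht, hΦ]
    exact ⟨_, hu.shift' ht, by simp⟩
  · apply coeff_injective e
    rw [hc 0 le_rfl, h0]

theorem continuousOn_of_past (S : ConeSystem P e F F' α C) {x : ℝ → H}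
    (h : S.Past fun t => coeff e (x t)) : ContinuousOn x (Iic 0) := by
  intro t ht
  have h1 := (S.orbit (by linarith [mem_Iic.1 ht]) (h.isSolution (a := t - 1) (b := 0)
    (by linarith [mem_Iic.1 ht]) le_rfl)).continuousOn_toH (e := e) (summable_coeff_sq e _)
  simp only [toH_coeff] at h1
  refine (h1 t ⟨by linarith, ht⟩).mono_of_mem_nhdsWithin ?_
  filter_upwards [self_mem_nhdsWithin, mem_nhdsWithin_of_mem_nhds (Ioi_mem_nhds (sub_one_lt t))]
    with s h2 h3 using ⟨le_of_lt h3, h2⟩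

end Given

end ConeSystem

/-! ### Weighted estimates with a variable rate. -/

/-- The integrating factor of the rate `a`, normalized at time zero. -/
noncomputable def weight (a : ℝ → ℝ) (s : ℝ) : ℝ := Real.exp (∫ r in (0 : ℝ)..s, a r)

section Weight

variable {a : ℝ → ℝ} {T M s : ℝ}

theorem weight_pos : 0 < weight a s := Real.exp_pos _

theorem continuousOn_weight (hT : 0 ≤ T) (ha : IntervalIntegrable a volume (-T) 0) :
    ContinuousOn (weight a) (Icc (-T) 0) :=
  ((IsPrimitive.of_intervalIntegral (by linarith) ha
    (right_mem_Icc.2 (by linarith))).exp (by linarith)).continuousOn (by linarith)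

theorem weight_sub_const (ha : IntervalIntegrable a volume (-T) 0) (ε : ℝ) (hs : s ∈ Icc (-T) 0) :
    weight (fun r => a r - ε) s = weight a s * Real.exp (-(ε * s)) := by
  have h := intervalIntegrable_subinterval ha hs.1 hs.2 le_rfl
  rw [weight, weight, ← Real.exp_add, intervalIntegral.integral_sub h.symm intervalIntegrable_const,
    intervalIntegral.integral_const, smul_eq_mul]
  congr 1; ring

theorem exp_le_weight (ha : IntervalIntegrable a volume (-T) 0) (haM : ∀ t, a t ≤ M)
    (hs : s ∈ Icc (-T) 0) : Real.exp (M * s) ≤ weight a s := by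
  have h := intervalIntegrable_subinterval ha hs.1 hs.2 le_rfl
  apply Real.exp_le_exp.2
  rw [intervalIntegral.integral_symm]
  have h2 := intervalIntegral.integral_mono_on hs.2 h (intervalIntegrable_const (c := M))
    fun r _ => haM r
  rw [intervalIntegral.integral_const, smul_eq_mul] at h2
  linarith

end Weight

/-- A perturbation χ of the forcing costs κ‖ξ‖² + κ⁻¹‖χ‖². With κ a fraction of μ, the strong cone
term absorbs the first part. -/
theorem wRate_add_le {lam : ℕ → ℝ} (hl : IsSpectrum lam) {ξ γ χ c : ℕ → ℝ} {κ : ℝ} (hκ : 0 < κ)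
    (hξ : Summable fun n => lam n * ξ n ^ 2) (hγ : Summable fun n => γ n ^ 2)
    (hχ : Summable fun n => χ n ^ 2) (hc : ∀ n, |c n| ≤ 1) :
    wRate lam c ξ (γ + χ) ≤ wRate lam c ξ γ + κ * zeroSq ξ + κ⁻¹ * zeroSq χ := by
  have h0 := summable_zero_of_one hl hξ
  refine hasSum_le (fun n => ?_) (summable_wRate hl hξ (zeroSq_add_le hγ hχ).1 hc).hasSum
    (((summable_wRate hl hξ hγ hc).hasSum.add (h0.hasSum.mul_left κ)).add (hχ.hasSum.mul_left κ⁻¹))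
  have h1 := two_mul_abs_le one_pos hκ (ξ n) (χ n)
  have h2 : -(c n * (χ n * ξ n)) ≤ |χ n * ξ n| := by
    refine (neg_le_abs _).trans ?_
    rw [abs_mul]; exact mul_le_of_le_one_left (abs_nonneg _) (hc n)
  simp only [inv_one, one_mul] at h1
  simp only [Pi.add_apply]
  linarith

namespace ConeParams

variable (P : ConeParams)

/-- The rate gained from the strong cone condition. -/
noncomputable def rate : ℝ := P.μ * P.lam 0 / 4

theorem rate_pos : 0 < P.rate := by
  have := P.μ_pos; have := P.spec.zero_pos; unfold rate; positivity

variable {P} {v g : ℝ → ℕ → ℝ} {a η : ℝ → ℝ} {T : ℝ}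

/-- The rate is lowered by ε = `rate`, chosen so that ε|V| ≤ (μ/4)‖v‖²: half of the available μ/2
pays for the factor e^{-εs} and half remains as dissipation. The initial term drops out because V ≤
0 at -T, and at time 0 only the low modes enter with the wrong sign. -/
theorem weighted_integral_le (h : Orbit P.lam v g (-T) 0) (ha : IntervalIntegrable a volume (-T) 0)
    (hcone : ∀ᵐ t, t ∈ Ioc (-T) 0 →
      wRate P.lam (sg P.N) (v t) (g t) + a t * P.V (v t) ≤ -(P.μ / 2) * zeroSq (v t))
    (hV : P.V (v (-T)) ≤ 0) :
    P.μ / 4 * ∫ s in (-T)..0, weight a s * Real.exp (-(P.rate * s)) * zeroSq (v s) ≤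
      P.plus (v 0) := by
  have hT := h.le
  have hz := h.intervalIntegrable_zeroSq P.spec
  have h1 := (h.isPrimitive_wForm P.spec (abs_sg_le P.N)).gronwall (β := fun r => a r - P.rate)
    (R := fun r => -(P.μ / 4) * zeroSq (v r)) hT (ha.sub intervalIntegrable_const) (hz.const_mul _)
    (by
      filter_upwards [hcone, h.ae_summable_one P.spec] with t h1 h2 hm
      have h3 := summable_zero_of_one P.spec (h2 hm)
      have h4 := (neg_le_abs _).trans (P.abs_V_le (summable_neg_of_zero P.spec h3))
      have h5 := h4.trans (negSq_le_zeroSq P.spec h3)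
      have h6 := mul_le_mul_of_nonneg_left h5 P.rate_pos.le
      have h7 : P.rate * ((P.lam 0)⁻¹ * zeroSq (v t)) = P.μ / 4 * zeroSq (v t) := by
        have := P.spec.zero_pos
        unfold rate; field_simp
      have := h1 hm
      simp only [V] at *
      linarith)
  have h2 : ∫ r in (-T)..0, Real.exp (∫ s in (0 : ℝ)..r, (a s - P.rate)) * (-(P.μ / 4) * zeroSq (v r)) =
      -(P.μ / 4 * ∫ s in (-T)..0, weight a s * Real.exp (-(P.rate * s)) * zeroSq (v s)) := by
    rw [← intervalIntegral.integral_const_mul, ← intervalIntegral.integral_neg]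
    apply intervalIntegral.integral_congr
    intro s hs
    rw [uIcc_of_le hT] at hs
    have := weight_sub_const ha P.rate hs
    simp only [weight] at this ⊢
    rw [this]; ring
  rw [h2] at h1
  have h3 : Real.exp (∫ s in (0 : ℝ)..(-T), (a s - P.rate)) * wForm P.lam (sg P.N) (v (-T)) ≤ 0 :=
    mul_nonpos_of_nonneg_of_nonpos (Real.exp_pos _).le hV
  have h4 := P.V_eq (h.mem_neg P.spec (right_mem_Icc.2 hT))
  have h5 := P.minus_nonneg (ξ := v 0)
  simp only [V] at *
  linarith

variable (P) in
-- Without low modes at 0 one has V ≥ 0 there. Gronwall from s in [-T, -T + 1], now with the rate a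
-- itself, bounds the weighted dissipation near 0 by the weighted state at s plus the error η.
-- Averaging over s and using e^{-εs} ≥ e^{ε(T-1)} on that interval gives the factor e^{-εT};
-- smoothing over [-1, 0] reaches the end point.
theorem exists_endpoint_bound : ∃ K, 0 ≤ K ∧ ∀ (v g : ℝ → ℕ → ℝ) (a η : ℝ → ℝ) (T : ℝ), 2 ≤ T →
    Orbit P.lam v g (-T) 0 → IntervalIntegrable a volume (-T) 0 → (∀ t, a t ≤ P.αp) →
    IntervalIntegrable η volume (-T) 0 → (∀ t, 0 ≤ η t) →
    (∀ᵐ t, t ∈ Ioc (-T) 0 → wRate P.lam (sg P.N) (v t) (g t) + a t * P.V (v t) ≤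
      -(P.μ / 2) * zeroSq (v t) + 2 / P.μ * η t) →
    (∀ᵐ t, t ∈ Ioc (-T) 0 → zeroSq (g t) ≤ 2 * P.L ^ 2 * zeroSq (v t) + 2 * η t) →
    P.plus (v 0) = 0 →
    zeroSq (v 0) ≤ K * (Real.exp (-(P.rate * T)) *
      (∫ s in (-T)..0, weight a s * Real.exp (-(P.rate * s)) * zeroSq (v s)) +
      ∫ s in (-T)..0, weight a s * η s) := by
  have p0 := P.spec.zero_pos
  have hμ := P.μ_pos
  set A := (P.lam 0)⁻¹ * Real.exp P.rate with hA
  have hA0 : 0 ≤ A := by positivity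
  refine ⟨Real.exp P.αp * ((1 + P.L ^ 2) * (2 / P.μ * (A + 2 / P.μ)) + 1), by positivity, ?_⟩
  intro v g a η T hT h ha haM hη hη0 hcone hg hp
  have hT0 : -T ≤ 0 := by linarith
  have hz := h.intervalIntegrable_zeroSq P.spec
  have hw := continuousOn_weight (a := a) (by linarith) ha
  have hwz : IntervalIntegrable (fun s => weight a s * zeroSq (v s)) volume (-T) 0 :=
    hz.continuousOn_mul (by rwa [uIcc_of_le hT0])
  have hwη : IntervalIntegrable (fun s => weight a s * η s) volume (-T) 0 :=
    hη.continuousOn_mul (by rwa [uIcc_of_le hT0])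
  have hwe : IntervalIntegrable (fun s => weight a s * Real.exp (-(P.rate * s)) * zeroSq (v s))
      volume (-T) 0 := by
    refine hz.continuousOn_mul ?_
    rw [uIcc_of_le hT0]
    exact hw.mul (by fun_prop)
  set I := ∫ s in (-T)..0, weight a s * Real.exp (-(P.rate * s)) * zeroSq (v s) with hI
  set J := ∫ s in (-T)..0, weight a s * η s with hJ
  have hJ0 : 0 ≤ J := intervalIntegral.integral_nonneg hT0 fun s _ =>
    mul_nonneg weight_pos.le (hη0 s)
  have hI0 : 0 ≤ I := intervalIntegral.integral_nonneg hT0 fun s _ =>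
    mul_nonneg (mul_nonneg weight_pos.le (Real.exp_pos _).le) (zeroSq_nonneg _)
  set X := ∫ s in (-1 : ℝ)..0, weight a s * zeroSq (v s) with hX
  have hV0 : 0 ≤ P.V (v 0) := by
    rw [P.V_eq (h.mem_neg P.spec (right_mem_Icc.2 hT0)), hp]
    simpa using P.minus_nonneg (ξ := v 0)
  have key : ∀ᵐ s, s ∈ Ioc (-T) (-T + 1) → P.μ / 2 * X - 2 / P.μ * J ≤
      A * Real.exp (-(P.rate * T)) * (weight a s * Real.exp (-(P.rate * s)) * zeroSq (v s)) := by
    filter_upwards [h.ae_summable_one P.spec] with s hs hm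
    have hs0 : s ≤ 0 := by linarith [hm.2]
    have h1 := (h.mono P.spec hm.1.le hs0 le_rfl).isPrimitive_wForm P.spec (abs_sg_le P.N)
    have h2 := h1.gronwall (β := a) (R := fun t => -(P.μ / 2) * zeroSq (v t) + 2 / P.μ * η t) hs0
      (intervalIntegrable_subinterval ha hm.1.le hs0 le_rfl)
      (((intervalIntegrable_subinterval hz hm.1.le hs0 le_rfl).const_mul _).add
        ((intervalIntegrable_subinterval hη hm.1.le hs0 le_rfl).const_mul _)) (by
      filter_upwards [hcone] with t ht htm using ht ⟨hm.1.trans htm.1, htm.2⟩)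
    have h3 : ∫ r in s..0, Real.exp (∫ q in (0 : ℝ)..r, a q) *
        (-(P.μ / 2) * zeroSq (v r) + 2 / P.μ * η r) =
        -(P.μ / 2) * (∫ r in s..0, weight a r * zeroSq (v r)) +
          2 / P.μ * ∫ r in s..0, weight a r * η r := by
      rw [← intervalIntegral.integral_const_mul, ← intervalIntegral.integral_const_mul,
        ← intervalIntegral.integral_add
          ((intervalIntegrable_subinterval hwz hm.1.le hs0 le_rfl).const_mul _)
          ((intervalIntegrable_subinterval hwη hm.1.le hs0 le_rfl).const_mul _)]
      apply intervalIntegral.integral_congr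
      intro r _
      simp only [weight]; ring
    rw [h3] at h2
    -- The assumption T ≥ 2 places [-1, 0] to the right of every such s.
    have h4 := integral_mono_subinterval (c := -1) (d := 0) (by linarith [hm.2] : s ≤ -1) (by norm_num)
      le_rfl (intervalIntegrable_subinterval hwz hm.1.le hs0 le_rfl)
      (ae_of_all _ fun t _ => mul_nonneg weight_pos.le (zeroSq_nonneg (v t)))
    have h5 := integral_mono_subinterval hm.1.le hs0 le_rfl hwη
      (ae_of_all _ fun t _ => mul_nonneg weight_pos.le (hη0 t))
    have h6 := summable_zero_of_one P.spec (hs ⟨hm.1, hs0⟩)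
    have h7 := ((le_abs_self _).trans (P.abs_V_le (summable_neg_of_zero P.spec h6))).trans
      (negSq_le_zeroSq P.spec h6)
    have h8 : Real.exp (∫ q in (0 : ℝ)..s, a q) * P.V (v s) ≤
        A * Real.exp (-(P.rate * T)) * (weight a s * Real.exp (-(P.rate * s)) * zeroSq (v s)) := by
      have e1 : 1 ≤ Real.exp P.rate * Real.exp (-(P.rate * T)) * Real.exp (-(P.rate * s)) := by
        rw [← Real.exp_add, ← Real.exp_add]
        apply Real.one_le_exp
        have := mul_nonneg P.rate_pos.le (by linarith [hm.2] : 0 ≤ -T + 1 - s)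
        linarith
      have e2 : 0 ≤ weight a s * ((P.lam 0)⁻¹ * zeroSq (v s)) :=
        mul_nonneg weight_pos.le (mul_nonneg (inv_nonneg.2 p0.le) (zeroSq_nonneg _))
      calc _ ≤ weight a s * ((P.lam 0)⁻¹ * zeroSq (v s)) :=
            mul_le_mul_of_nonneg_left h7 weight_pos.le
        _ ≤ Real.exp P.rate * Real.exp (-(P.rate * T)) * Real.exp (-(P.rate * s)) *
            (weight a s * ((P.lam 0)⁻¹ * zeroSq (v s))) := le_mul_of_one_le_left e2 e1
        _ = _ := by rw [hA]; ring
    have h9 : P.μ / 2 * X ≤ P.μ / 2 * ∫ r in s..0, weight a r * zeroSq (v r) :=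
      mul_le_mul_of_nonneg_left h4 (by positivity)
    have h10 : 2 / P.μ * (∫ r in s..0, weight a r * η r) ≤ 2 / P.μ * J :=
      mul_le_mul_of_nonneg_left h5 (by positivity)
    simp only [V] at *
    linarith
  have hXI : P.μ / 2 * X - 2 / P.μ * J ≤ A * Real.exp (-(P.rate * T)) * I := by
    have h1 := integral_mono_of_ae_Ioc (a := -T) (b := -T + 1) (by linarith) intervalIntegrable_const
      ((intervalIntegrable_subinterval hwe le_rfl (by linarith : -T ≤ -T + 1)
        (by linarith)).const_mul _) key
    rw [intervalIntegral.integral_const, intervalIntegral.integral_const_mul, smul_eq_mul,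
      show -T + 1 - -T = (1 : ℝ) by ring, one_mul] at h1
    have h2 := integral_mono_subinterval le_rfl (by linarith : -T ≤ -T + 1) (by linarith) hwe
      (ae_of_all _ fun t _ => mul_nonneg (mul_nonneg weight_pos.le (Real.exp_pos _).le)
        (zeroSq_nonneg (v t)))
    exact h1.trans (mul_le_mul_of_nonneg_left h2 (by positivity))
  have h1' : (-T : ℝ) ≤ -1 := by linarith
  have hsm := (h.mono P.spec h1' (by norm_num : (-1 : ℝ) ≤ 0) le_rfl).smoothing P.spec (by norm_num)
  have hz1 := intervalIntegrable_subinterval hz h1' (by norm_num : (-1 : ℝ) ≤ 0) le_rfl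
  have hη1 := intervalIntegrable_subinterval hη h1' (by norm_num : (-1 : ℝ) ≤ 0) le_rfl
  have hwz1 := intervalIntegrable_subinterval hwz h1' (by norm_num : (-1 : ℝ) ≤ 0) le_rfl
  have hwη1 := intervalIntegrable_subinterval hwη h1' (by norm_num : (-1 : ℝ) ≤ 0) le_rfl
  have hgz : ∫ r in (-1 : ℝ)..0, zeroSq (g r) ≤
      2 * P.L ^ 2 * (∫ r in (-1 : ℝ)..0, zeroSq (v r)) + 2 * ∫ r in (-1 : ℝ)..0, η r := by
    rw [← intervalIntegral.integral_const_mul, ← intervalIntegral.integral_const_mul,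
      ← intervalIntegral.integral_add (hz1.const_mul _) (hη1.const_mul _)]
    refine integral_mono_of_ae_Ioc (by norm_num) (intervalIntegrable_subinterval
      h.intervalIntegrable_forcing h1' (by norm_num) le_rfl)
      ((hz1.const_mul _).add (hη1.const_mul _)) ?_
    filter_upwards [hg] with t ht hm using ht ⟨by linarith [hm.1], hm.2⟩
  -- Near the end point the weight is at least e^{-α₊} and can be removed.
  have hwl : ∀ s ∈ Icc (-1 : ℝ) 0, 1 ≤ Real.exp P.αp * weight a s := fun s hs => by
    have h1 := exp_le_weight ha haM (s := s) ⟨by linarith [hs.1], hs.2⟩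
    have h2 : Real.exp (-P.αp) ≤ Real.exp (P.αp * s) :=
      Real.exp_le_exp.2 (by nlinarith [P.αp_pos, hs.1])
    calc (1 : ℝ) = Real.exp P.αp * Real.exp (-P.αp) := by rw [← Real.exp_add]; simp
      _ ≤ _ := by gcongr; exact h2.trans h1
  have hzX : ∫ r in (-1 : ℝ)..0, zeroSq (v r) ≤ Real.exp P.αp * X := by
    rw [hX, ← intervalIntegral.integral_const_mul]
    refine intervalIntegral.integral_mono_on (by norm_num) hz1 (hwz1.const_mul _) fun s hs => ?_
    rw [← mul_assoc]
    exact le_mul_of_one_le_left (zeroSq_nonneg _) (hwl s hs)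
  have hηJ : ∫ r in (-1 : ℝ)..0, η r ≤ Real.exp P.αp * J := by
    have h2 : ∫ r in (-1 : ℝ)..0, η r ≤ Real.exp P.αp * ∫ r in (-1 : ℝ)..0, weight a r * η r := by
      rw [← intervalIntegral.integral_const_mul]
      refine intervalIntegral.integral_mono_on (by norm_num) hη1 (hwη1.const_mul _) fun s hs => ?_
      rw [← mul_assoc]
      exact le_mul_of_one_le_left (hη0 s) (hwl s hs)
    refine h2.trans (mul_le_mul_of_nonneg_left ?_ (Real.exp_pos _).le)
    exact integral_mono_subinterval h1' (by norm_num) le_rfl hwη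
      (ae_of_all _ fun t _ => mul_nonneg weight_pos.le (hη0 t))
  have e1 := hsm.2
  rw [show (0 : ℝ) - -1 = 1 by ring, one_mul, one_mul] at e1
  set E := Real.exp (-(P.rate * T))
  have hE : 0 ≤ E := (Real.exp_pos _).le
  have e2 : X ≤ 2 / P.μ * (A * (E * I) + 2 / P.μ * J) := by
    have : X = 2 / P.μ * (P.μ / 2 * X) := by field_simp
    rw [this]
    exact mul_le_mul_of_nonneg_left (by linarith) (by positivity)
  have e3 : X ≤ 2 / P.μ * (A + 2 / P.μ) * (E * I + J) := by
    refine e2.trans ?_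
    have : 0 ≤ E * I := mul_nonneg hE hI0
    have c1 : 0 ≤ 2 / P.μ * A * J := by positivity
    have c2 : 0 ≤ 2 / P.μ * (2 / P.μ) * (E * I) := by positivity
    linarith
  have e4 : zeroSq (v 0) ≤ Real.exp P.αp * ((1 + P.L ^ 2) * X + J) := by
    have := mul_le_mul_of_nonneg_left hzX (by positivity : 0 ≤ 1 + P.L ^ 2)
    linarith
  refine e4.trans ?_
  rw [mul_assoc]
  refine mul_le_mul_of_nonneg_left ?_ (Real.exp_pos _).le
  have e5 := mul_le_mul_of_nonneg_left e3 (by positivity : 0 ≤ 1 + P.L ^ 2)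
  have : 0 ≤ E * I := mul_nonneg hE hI0
  linarith

end ConeParams

/-! ### The boundary value problem for the equation of variations. -/

/-- Solutions of the equation of variations along `x`. -/
def VarOrbit {H : Type*} [NormedAddCommGroup H] [InnerProductSpace ℝ H] (lam : ℕ → ℝ)
    (e : HilbertBasis ℕ ℝ H) (F' : H → H →L[ℝ] H) (x : ℝ → H) (v : ℝ → ℕ → ℝ) (a b : ℝ) : Prop :=
  Orbit lam v (fun t => coeff e (F' (x t) (toH e (v t)))) a b

/-- Solutions of the equation of variations on `[-T,0]` with low modes `p` at the end and without
high modes at the start. -/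
structure IsBVP {H : Type*} [NormedAddCommGroup H] [InnerProductSpace ℝ H] (lam : ℕ → ℝ) (N : ℕ)
    (e : HilbertBasis ℕ ℝ H) (F' : H → H →L[ℝ] H) (x : ℝ → H) (p : ℕ → ℝ) (T : ℝ)
    (w : ℝ → ℕ → ℝ) : Prop where
  orbit : VarOrbit lam e F' x w (-T) 0
  low : ∀ n < N, w 0 n = p n
  high : ∀ n, N ≤ n → w (-T) n = 0

section Basic

variable {H : Type*} [NormedAddCommGroup H] [InnerProductSpace ℝ H] {lam : ℕ → ℝ} {N : ℕ}
  {e : HilbertBasis ℕ ℝ H} {F' : H → H →L[ℝ] H} {x : ℝ → H} {v w : ℝ → ℕ → ℝ} {a b : ℝ}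

theorem VarOrbit.lin (hl : IsSpectrum lam) (hv : VarOrbit lam e F' x v a b)
    (hw : VarOrbit lam e F' x w a b) (c d : ℝ) :
    VarOrbit lam e F' x (fun t n => c * v t n + d * w t n) a b := by
  refine (Orbit.lin hl hv hw c d).congr_forcing fun n => ?_
  filter_upwards [hv.ae_summable_one hl, hw.ae_summable_one hl] with t h1 h2 hm
  have s1 := summable_zero_of_one hl (h1 hm)
  have s2 := summable_zero_of_one hl (h2 hm)
  have e1 : (fun n => c * v t n + d * w t n) = coeff e (c • toH e (v t) + d • toH e (w t)) := by
    rw [coeff_add, coeff_smul, coeff_smul, coeff_toH s1, coeff_toH s2]; rfl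
  rw [e1, toH_coeff, map_add, map_smul, map_smul, coeff_add, coeff_smul, coeff_smul]
  rfl

theorem VarOrbit.sub (hl : IsSpectrum lam) (hv : VarOrbit lam e F' x v a b)
    (hw : VarOrbit lam e F' x w a b) : VarOrbit lam e F' x (fun t => v t - w t) a b := by
  have := hv.lin hl hw 1 (-1)
  convert! this using 3
  simp [sub_eq_add_neg]

theorem VarOrbit.mono (hl : IsSpectrum lam) (h : VarOrbit lam e F' x v a b) {s t : ℝ} (hs : a ≤ s)
    (hst : s ≤ t) (ht : t ≤ b) : VarOrbit lam e F' x v s t := Orbit.mono hl h hs hst ht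

theorem IsBVP.lin (hl : IsSpectrum lam) {p q : ℕ → ℝ} {T : ℝ} (hv : IsBVP lam N e F' x p T v)
    (hw : IsBVP lam N e F' x q T w) (c d : ℝ) :
    IsBVP lam N e F' x (c • p + d • q) T (fun t n => c * v t n + d * w t n) :=
  ⟨hv.orbit.lin hl hw.orbit c d, fun n hn => by simp [hv.low n hn, hw.low n hn],
    fun n hn => by simp [hv.high n hn, hw.high n hn]⟩

end Basic

namespace ConeSystem

variable {H : Type*} [NormedAddCommGroup H] [InnerProductSpace ℝ H] [MeasurableSpace H]
  {P : ConeParams} {e : HilbertBasis ℕ ℝ H} {F : H → H} {F' : H → H →L[ℝ] H} {α : H → ℝ} {C : ℝ}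
  {x : ℝ → H} {v w : ℝ → ℕ → ℝ} {p : ℕ → ℝ} {a b s t T R : ℝ}

theorem ae_cone (S : ConeSystem P e F F' α C) (h : VarOrbit P.lam e F' x v a b) :
    ∀ᵐ t, t ∈ Ioc a b → wRate P.lam (sg P.N) (v t) (coeff e (F' (x t) (toH e (v t)))) +
      α (x t) * P.V (v t) ≤ -P.μ * zeroSq (v t) := by
  filter_upwards [h.ae_summable_one P.spec] with t h1 hm
  have s1 := summable_zero_of_one P.spec (h1 hm)
  have := S.cone (x t) (toH e (v t)) (by rw [coeff_toH s1]; exact h1 hm)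
  rwa [coeff_toH s1, norm_toH_sq s1] at this

theorem ae_control (S : ConeSystem P e F F' α C) (h : VarOrbit P.lam e F' x v a b) :
    ∀ᵐ t, t ∈ Ioc a b → zeroSq (coeff e (F' (x t) (toH e (v t)))) ≤ P.L ^ 2 * zeroSq (v t) := by
  filter_upwards [h.ae_summable_one P.spec] with t h1 hm
  have s1 := summable_zero_of_one P.spec (h1 hm)
  rw [zeroSq_coeff, ← norm_toH_sq (e := e) s1, ← mul_pow]
  exact pow_le_pow_left₀ (norm_nonneg _) ((F' (x t)).le_of_opNorm_le (S.deriv _) _) 2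

theorem coneOrbit_var (S : ConeSystem P e F F' α C) (h : VarOrbit P.lam e F' x v a b) :
    ConeOrbit P v (fun t => coeff e (F' (x t) (toH e (v t)))) a b := by
  refine ⟨⟨h, S.ae_control h⟩, ?_⟩
  filter_upwards [S.ae_cone h] with t h1 hm
  refine le_trans (add_le_add_right ?_ _) (h1 hm)
  have h2 := S.α_mem (x t)
  rcases le_total 0 (P.V (v t)) with h3 | h3
  · exact (min_le_left _ _).trans (mul_le_mul_of_nonneg_right h2.1 h3)
  · exact (min_le_right _ _).trans (mul_le_mul_of_nonpos_right h2.2 h3)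

theorem var_unique (S : ConeSystem P e F F' α C) (hv : VarOrbit P.lam e F' x v a b)
    (hw : VarOrbit P.lam e F' x w a b) (h : v a = w a) (ht : t ∈ Icc a b) : v t = w t :=
  sub_eq_zero.1 ((S.coneOrbit_var (hv.sub P.spec hw)).eq_zero (by simp [h]) ht)

theorem V_start_nonpos (h : IsBVP P.lam P.N e F' x p T w) : P.V (w (-T)) ≤ 0 := by
  rw [P.V_eq h.orbit.init, P.minus_eq_zero h.high]
  linarith [P.plus_nonneg (ξ := w (-T))]

section Rate

variable [BorelSpace H]

theorem intervalIntegrable_rate (S : ConeSystem P e F F' α C) (hx : ContinuousOn x (Iic 0))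
    (hT : 0 ≤ T) : IntervalIntegrable (fun t => α (x t)) volume (-T) 0 := by
  rw [intervalIntegrable_iff_integrableOn_Ioc_of_le (by linarith)]
  refine Integrable.mono' (g := fun _ => P.αp) (by simp) ?_ (ae_of_all _ fun t => ?_)
  · exact (S.α_meas.comp_aemeasurable ((hx.mono fun s hs => hs.2).aemeasurable
      measurableSet_Ioc)).aestronglyMeasurable
  · have := S.α_mem (x t)
    rw [Real.norm_eq_abs, abs_of_nonneg (P.αm_pos.le.trans this.1)]; exact this.2

theorem bvp_weighted (S : ConeSystem P e F F' α C) (hx : ContinuousOn x (Iic 0))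
    (h : IsBVP P.lam P.N e F' x p T w) :
    P.μ / 4 * ∫ s in (-T)..0, weight (fun t => α (x t)) s * Real.exp (-(P.rate * s)) * zeroSq (w s) ≤
      P.plus p := by
  have hT : 0 ≤ T := by have := h.orbit.le; linarith
  have := P.weighted_integral_le h.orbit (S.intervalIntegrable_rate hx hT) (by
    filter_upwards [S.ae_cone h.orbit] with t h1 hm
    have := mul_nonneg P.μ_pos.le (zeroSq_nonneg (w t))
    linarith [h1 hm]) (V_start_nonpos h)
  rwa [ConeParams.plus_congr h.low] at this

theorem intervalIntegrable_weighted (S : ConeSystem P e F F' α C) (hx : ContinuousOn x (Iic 0))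
    {g : ℝ → ℕ → ℝ} (h : Orbit P.lam v g (-T) 0) : IntervalIntegrable (fun s =>
      weight (fun t => α (x t)) s * Real.exp (-(P.rate * s)) * zeroSq (v s)) volume (-T) 0 := by
  have hT := h.le
  refine (h.intervalIntegrable_zeroSq P.spec).continuousOn_mul ?_
  rw [uIcc_of_le hT]
  exact (continuousOn_weight (by linarith) (S.intervalIntegrable_rate hx (by linarith))).mul
    (by fun_prop)

theorem weighted_sub_le (S : ConeSystem P e F F' α C) (hx : ContinuousOn x (Iic 0))
    {g g' : ℝ → ℕ → ℝ} (hv : Orbit P.lam v g (-T) 0) (hw : Orbit P.lam w g' (-T) 0) :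
    ∫ s in (-T)..0, weight (fun t => α (x t)) s * Real.exp (-(P.rate * s)) * zeroSq (v s - w s) ≤
      2 * (∫ s in (-T)..0, weight (fun t => α (x t)) s * Real.exp (-(P.rate * s)) * zeroSq (v s)) +
      2 * ∫ s in (-T)..0, weight (fun t => α (x t)) s * Real.exp (-(P.rate * s)) * zeroSq (w s) := by
  have i1 := S.intervalIntegrable_weighted hx hv
  have i2 := S.intervalIntegrable_weighted hx hw
  rw [← intervalIntegral.integral_const_mul, ← intervalIntegral.integral_const_mul,
    ← intervalIntegral.integral_add (i1.const_mul _) (i2.const_mul _)]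
  refine integral_mono_of_ae_Ioc hv.le (S.intervalIntegrable_weighted hx (hv.sub P.spec hw))
    ((i1.const_mul _).add (i2.const_mul _)) ?_
  filter_upwards [hv.ae_summable_one P.spec, hw.ae_summable_one P.spec] with t h1 h2 hm
  have h3 := (zeroSq_sub_le (summable_zero_of_one P.spec (h1 hm))
    (summable_zero_of_one P.spec (h2 hm))).2
  have h4 := mul_le_mul_of_nonneg_left h3
    (mul_nonneg (weight_pos (a := fun t => α (x t)) (s := t)).le (Real.exp_pos (-(P.rate * t))).le)
  linarith

/-- The difference of the two solutions has no low modes at 0, so the endpoint bound with η = 0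
applies on [-T, 0]. Each solution starts in the cone, so both weighted integrals are bounded by the
common low modes. -/
theorem exists_bvp_sub_le (S : ConeSystem P e F F' α C) : ∃ K, 0 ≤ K ∧
    ∀ (x : ℝ → H) (p : ℕ → ℝ) (T R : ℝ) (v w : ℝ → ℕ → ℝ), ContinuousOn x (Iic 0) → 2 ≤ T → T ≤ R →
      IsBVP P.lam P.N e F' x p T v → IsBVP P.lam P.N e F' x p R w →
      zeroSq (w 0 - v 0) ≤ K * Real.exp (-(P.rate * T)) * P.plus p := by
  obtain ⟨K, hK, h⟩ := P.exists_endpoint_bound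
  have hμ := P.μ_pos
  refine ⟨K * (16 / P.μ), by positivity, fun x p T R v w hx hT hTR hv hw => ?_⟩
  have ow := hw.orbit.mono P.spec (by linarith : -R ≤ -T) (by linarith) le_rfl
  have oz := ow.sub P.spec hv.orbit
  have h1 := h _ _ (fun t => α (x t)) (fun _ => 0) T hT oz
    (S.intervalIntegrable_rate hx (by linarith)) (fun t => (S.α_mem _).2) intervalIntegrable_const
    (fun _ => le_rfl) (by
      filter_upwards [S.ae_cone oz] with t h1 hm
      have := mul_nonneg P.μ_pos.le (zeroSq_nonneg (w t - v t))
      linarith [h1 hm]) (by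
      filter_upwards [S.ae_control oz] with t h1 hm
      have := mul_nonneg (sq_nonneg P.L) (zeroSq_nonneg (w t - v t))
      linarith [h1 hm])
    (P.plus_eq_zero (ξ := w 0 - v 0) fun n hn => by simp [hv.low n hn, hw.low n hn])
  simp only [mul_zero, intervalIntegral.integral_zero, add_zero] at h1
  have h2 := S.weighted_sub_le hx ow hv.orbit
  have h3 := S.bvp_weighted hx hv
  have h4 := S.bvp_weighted hx hw
  have h5 := integral_mono_subinterval (by linarith : -R ≤ -T) (by linarith : -T ≤ 0) le_rfl
    (S.intervalIntegrable_weighted hx hw.orbit) (ae_of_all _ fun t _ => mul_nonneg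
      (mul_nonneg weight_pos.le (Real.exp_pos (-(P.rate * t))).le) (zeroSq_nonneg (w t)))
  have h6 : ∫ s in (-T)..0, weight (fun t => α (x t)) s * Real.exp (-(P.rate * s)) *
      zeroSq (w s - v s) ≤ 16 / P.μ * P.plus p := by
    have e1 : ∀ y : ℝ, P.μ / 4 * y ≤ P.plus p → y ≤ 4 / P.μ * P.plus p := fun y hy => by
      have : y = 4 / P.μ * (P.μ / 4 * y) := by field_simp
      rw [this]; exact mul_le_mul_of_nonneg_left hy (by positivity)
    have e2 := e1 _ h3
    have e3 := e1 _ h4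
    have e4 : 16 / P.μ * P.plus p = 4 * (4 / P.μ * P.plus p) := by ring
    linarith
  calc _ ≤ _ := h1
    _ ≤ K * (Real.exp (-(P.rate * T)) * (16 / P.μ * P.plus p)) := by gcongr
    _ = _ := by ring

end Rate

theorem bvp_summable (h : IsBVP P.lam P.N e F' x p T w) (hT : 0 < T) :
    Summable fun n => w 0 n ^ 2 := (Orbit.smoothing P.spec h.orbit (by linarith)).1

/-- The bound does not depend on T and is therefore inherited by the limit operator. -/
theorem bvp_endpoint_le (S : ConeSystem P e F F' α C) (h : IsBVP P.lam P.N e F' x p T w)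
    (hT : 1 ≤ T) : zeroSq (w 0) ≤ (1 + P.L ^ 2) * P.μ⁻¹ * Real.exp P.αp * P.plus p := by
  have hc := S.coneOrbit_var h.orbit
  have h1 := (hc.zeroSq_le_integral (by linarith)).2
  have h2 := (hc.mono'' (s := 0 - 1) (t := 0) (by linarith) (by linarith) le_rfl).integral_le_of_nonpos
    (hc.V_nonpos (V_start_nonpos h) ⟨by linarith, by linarith⟩)
  rw [ConeParams.plus_congr h.low] at h2
  calc _ ≤ _ := h1
    _ ≤ (1 + P.L ^ 2) * (P.μ⁻¹ * Real.exp (P.αp * (0 - (0 - 1))) * P.plus p) := by gcongr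
    _ = _ := by rw [show P.αp * (0 - (0 - 1)) = P.αp by ring]; ring

variable [CompleteSpace H]

/-- The map from low modes at the start to low modes at the end is linear on ℝ^N, so injectivity
suffices. If the final low modes vanish, then V ≥ 0 at the end and, by backward invariance, at the
start; a starting vector without high modes must then be zero. -/
theorem exists_bvp (S : ConeSystem P e F F' α C) (hx : ContinuousOn x (Iic 0)) (hT : 0 < T)
    (p : ℕ → ℝ) : ∃ w, IsBVP P.lam P.N e F' x p T w := by
  -- Clamping at 0 extends the trajectory, continuous only up to time 0, to a continuous curve on
  -- the whole line.
  set y : ℝ → H := fun s => x (min (s - T) 0) with hy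
  have hyc : Continuous y := hx.comp_continuous (by fun_prop) fun s => mem_Iic.2 (min_le_right _ _)
  choose v hvc hv0 hv using fun x₀ : H =>
    exists_variation (e := e) P.spec P.L_pos S.deriv S.deriv_cont hyc x₀
  have hvo : ∀ x₀, VarOrbit P.lam e F' y (fun t => coeff e (v x₀ t)) 0 T := fun x₀ => by
    unfold VarOrbit
    simp only [toH_coeff]; exact hv x₀ T hT.le
  set ι : (Fin P.N → ℝ) → H := fun z => ∑ i, z i • e i with hι
  have hιc : ∀ z n, coeff e (ι z) n = if h : n < P.N then z ⟨n, h⟩ else 0 := fun z n => by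
    simp only [hι, coeff, inner_sum, inner_smul_right, orthonormal_iff_ite.1 e.orthonormal, mul_ite,
      mul_one, mul_zero]
    split_ifs with h
    · rw [Finset.sum_eq_single (⟨n, h⟩ : Fin P.N)]
      · simp
      · intro i _ hi
        rw [if_neg]; rintro rfl; exact hi rfl
      · simp
    · refine Finset.sum_eq_zero fun i _ => if_neg ?_
      rintro rfl; exact h i.2
  have hlin : ∀ (c : ℝ) (z z' : H), coeff e (v (z + c • z') T) =
      fun n => coeff e (v z T) n + c * coeff e (v z' T) n := fun c z z' => by
    have h1 := (hvo z).lin P.spec (hvo z') 1 c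
    have := S.var_unique (hvo (z + c • z')) h1 (by
      simp only [hv0, one_mul, coeff_add, coeff_smul]; rfl) (right_mem_Icc.2 hT.le)
    simpa using this
  set A : (Fin P.N → ℝ) →ₗ[ℝ] (Fin P.N → ℝ) :=
    { toFun := fun z i => coeff e (v (ι z) T) i
      map_add' := fun z z' => by
        have h1 : ι (z + z') = ι z + (1 : ℝ) • ι z' := by
          simp [hι, add_smul, Finset.sum_add_distrib]
        ext i; rw [h1, hlin]; simp
      map_smul' := fun c z => by
        have h1 : ι (c • z) = (0 : H) + c • ι z := by
          simp [hι, mul_smul, Finset.smul_sum]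
        have h0 : coeff e (v 0 T) = 0 := by
          have := hlin (-1) 0 0
          rw [smul_zero, add_zero] at this
          ext n; have := congrFun this n
          simp; linarith
        ext i; rw [h1, hlin, h0]; simp } with hA
  have hinj : Function.Injective A := by
    rw [injective_iff_map_eq_zero]
    intro z hz
    have hz' : ∀ n < P.N, coeff e (v (ι z) T) n = 0 := fun n hn => congrFun hz ⟨n, hn⟩
    have hc := S.coneOrbit_var (hvo (ι z))
    have m0 := hc.mem_neg P.spec (left_mem_Icc.2 hT.le)
    have mT := hc.mem_neg P.spec (right_mem_Icc.2 hT.le)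
    have hVT : 0 ≤ P.V (coeff e (v (ι z) T)) := by
      rw [P.V_eq mT, P.plus_eq_zero hz']
      simpa using P.minus_nonneg (ξ := coeff e (v (ι z) T))
    have hV0 := hc.V_nonneg hVT (left_mem_Icc.2 hT.le)
    have hhigh : ∀ n, P.N ≤ n → coeff e (v (ι z) 0) n = 0 := fun n hn => by
      rw [hv0, hιc, dif_neg (not_lt.2 hn)]
    have hlow : negSq P.lam (coeff e (v (ι z) 0)) ≤ 0 := by
      rw [P.V_eq m0, P.minus_eq_zero hhigh] at hV0
      rw [P.negSq_eq m0, P.minus_eq_zero hhigh]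
      linarith
    have := P.eq_zero_of_negSq m0 hlow
    rw [hv0] at this
    ext i
    have h2 := congrFun this i
    rw [hιc, dif_pos i.2] at h2
    exact h2
  obtain ⟨z, hz⟩ := LinearMap.injective_iff_surjective.1 hinj fun i => p i
  have hs := Orbit.shift (hvo (ι z)) T
  rw [zero_sub, sub_self] at hs
  refine ⟨fun t => coeff e (v (ι z) (t + T)), hs.congr_forcing fun n => ae_of_all _ fun t ht => ?_,
    fun n hn => ?_, fun n hn => ?_⟩
  · simp only [hy, add_sub_cancel_right, min_eq_left ht.2]
  · have h1 : coeff e (v (ι z) T) n = p n := congrFun hz ⟨n, hn⟩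
    rw [← h1, zero_add]
  · simp only [neg_add_cancel, hv0]
    rw [hιc, dif_neg (not_lt.2 hn)]

end ConeSystem

/-! ### Linearization along a trajectory and the nonlinear remainder. -/

/-- Measured in units of ρ the distance n is at most √b ≤ 1. In the surplus factor n^{2δ} the power
of ρ supplies the small constant m², and the rest is at most b^σ since σ ≤ δ. -/
theorem remainder_sq_le {CF δ σ ρ m n b : ℝ} (hCF : 0 ≤ CF) (hρ : 0 < ρ) (hm : CF * ρ ^ δ ≤ m)
    (hn : 0 ≤ n) (hnb : n ^ 2 ≤ ρ ^ 2 * b) (hb : b ≤ 1) (hσ : 0 < σ) (hσδ : σ ≤ δ) :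
    (CF * n ^ (1 + δ)) ^ 2 ≤ m ^ 2 * b ^ σ * n ^ 2 := by
  set j := n / ρ with hj
  have hj0 : 0 ≤ j := by positivity
  have hnj : n = ρ * j := by rw [hj]; field_simp
  have hjb : j ^ 2 ≤ b := by
    rw [hnj, mul_pow] at hnb
    exact le_of_mul_le_mul_left hnb (by positivity)
  have hj1 : j ≤ 1 := (sq_le_one_iff₀ hj0).1 (hjb.trans hb)
  have hjδ : j ^ δ ≤ j ^ σ := by
    rcases hj0.eq_or_lt with h0 | h0
    · rw [← h0, Real.zero_rpow (by linarith), Real.zero_rpow hσ.ne']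
    · exact Real.rpow_le_rpow_of_exponent_ge h0 hj1 hσδ
  have h1 : (j ^ δ) ^ 2 ≤ b ^ σ := by
    calc (j ^ δ) ^ 2 ≤ (j ^ σ) ^ 2 := pow_le_pow_left₀ (Real.rpow_nonneg hj0 _) hjδ 2
      _ = (j ^ 2) ^ σ := by
        rw [← Real.rpow_natCast, ← Real.rpow_natCast, ← Real.rpow_mul hj0, ← Real.rpow_mul hj0,
          mul_comm]
      _ ≤ b ^ σ := Real.rpow_le_rpow (sq_nonneg _) hjb hσ.le
  have h2 : CF * n ^ (1 + δ) = CF * ρ ^ δ * j ^ δ * n := by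
    rw [Real.rpow_add_of_nonneg hn zero_le_one (by linarith), Real.rpow_one]
    conv_lhs => rw [hnj, Real.mul_rpow hρ.le hj0]
    conv_rhs => rw [hnj]
    ring
  have h3 : (CF * ρ ^ δ) ^ 2 ≤ m ^ 2 :=
    pow_le_pow_left₀ (mul_nonneg hCF (Real.rpow_nonneg hρ.le _)) hm 2
  rw [h2, mul_pow, mul_pow]
  gcongr

namespace ConeSystem

variable {H : Type*} [NormedAddCommGroup H] [InnerProductSpace ℝ H] [MeasurableSpace H]
  {P : ConeParams} {e : HilbertBasis ℕ ℝ H} {F : H → H} {F' : H → H →L[ℝ] H} {α : H → ℝ} {C : ℝ}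
  {x y : ℝ → H} {v w : ℝ → ℕ → ℝ} {p : ℕ → ℝ} {a b s t T R : ℝ} [BorelSpace H] [CompleteSpace H]

/-- `D` describes the limits of the solutions of the boundary value problems along `x`. -/
def IsLinearization (P : ConeParams) (e : HilbertBasis ℕ ℝ H) (F' : H → H →L[ℝ] H) (x : ℝ → H) (K : ℝ)
    (D : Hplus e P.N →L[ℝ] Hminus e P.N) : Prop :=
  ∀ (p : Hplus e P.N) (T : ℝ) (w : ℝ → ℕ → ℝ), 2 ≤ T → IsBVP P.lam P.N e F' x (coeff e (p : H)) T w →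
    ‖toH e (w 0) - (p + D p)‖ ^ 2 ≤ K * Real.exp (-(P.rate * T)) * ‖p‖ ^ 2

theorem exists_linearization (S : ConeSystem P e F F' α C) : ∃ K, 0 ≤ K ∧
    ∀ x : ℝ → H, ContinuousOn x (Iic 0) → ∃ D : Hplus e P.N →L[ℝ] Hminus e P.N,
      ‖D‖ ≤ S.slope + 1 ∧ IsLinearization P e F' x K D := by
  obtain ⟨K₁, hK₁, hsub⟩ := S.exists_bvp_sub_le
  have p0 := P.spec.zero_pos
  have hμ := P.μ_pos
  refine ⟨K₁ * (P.lam 0)⁻¹, by positivity, fun x hx => ?_⟩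
  set K := K₁ * (P.lam 0)⁻¹ with hK
  have hK0 : 0 ≤ K := by positivity
  have hk0 : ∀ k : ℕ, (0 : ℝ) < k + 2 := fun k => by positivity
  -- The lengths k + 2 keep every problem in the range T ≥ 2 of the comparison estimate.
  choose ω hω using fun (p : Hplus e P.N) (k : ℕ) => S.exists_bvp hx (hk0 k) (coeff e (p : H))
  have hdist : ∀ (p : Hplus e P.N) (T R : ℝ) (v w : ℝ → ℕ → ℝ), 2 ≤ T → T ≤ R →
      IsBVP P.lam P.N e F' x (coeff e (p : H)) T v → IsBVP P.lam P.N e F' x (coeff e (p : H)) R w →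
      ‖toH e (v 0) - toH e (w 0)‖ ^ 2 ≤ K * Real.exp (-(P.rate * T)) * ‖p‖ ^ 2 := by
    intro p T R v w hT hTR hv hw
    have sv := bvp_summable hv (by linarith)
    have sw := bvp_summable hw (by linarith)
    rw [norm_sub_rev, ← toH_sub sw sv, norm_toH_sq (zeroSq_sub_le sw sv).1]
    calc _ ≤ K₁ * Real.exp (-(P.rate * T)) * P.plus (coeff e (p : H)) := hsub x _ T R v w hx hT hTR hv hw
      _ ≤ K₁ * Real.exp (-(P.rate * T)) * ((P.lam 0)⁻¹ * ‖(p : H)‖ ^ 2) := by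
        have := ConeParams.plus_coeff_le (P := P) (e := e) (p : H)
        gcongr
      _ = _ := by rw [hK, Submodule.coe_norm]; ring
  have hexp : Tendsto (fun k : ℕ => Real.exp (-(P.rate * (k + 2)))) atTop (𝓝 0) := by
    have h1 : Tendsto (fun k : ℕ => P.rate * ((k : ℝ) + 2)) atTop atTop :=
      (tendsto_atTop_add_const_right _ _ tendsto_natCast_atTop_atTop).const_mul_atTop P.rate_pos
    exact Real.tendsto_exp_neg_atTop_nhds_zero.comp h1
  have hlim : ∀ p : Hplus e P.N, ∃ W, Tendsto (fun k => toH e (ω p k 0)) atTop (𝓝 W) := fun p => by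
    refine cauchySeq_tendsto_of_complete (cauchySeq_of_le_tendsto_0'
      (fun k : ℕ => √(K * Real.exp (-(P.rate * (k + 2))) * ‖p‖ ^ 2)) (fun n m hnm => ?_) ?_)
    · rw [dist_eq_norm]
      apply Real.le_sqrt_of_sq_le
      have : (n : ℝ) ≤ m := by exact_mod_cast hnm
      exact hdist p _ (m + 2) _ _ (by linarith [n.cast_nonneg (α := ℝ)]) (by linarith) (hω p n) (hω p m)
    · have := (Real.continuous_sqrt.tendsto _).comp ((hexp.const_mul K).mul_const (‖p‖ ^ 2))
      rw [mul_zero, zero_mul, Real.sqrt_zero] at this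
      exact this
  choose W hW using hlim
  have hkey : ∀ (p : Hplus e P.N) (T : ℝ) (w : ℝ → ℕ → ℝ), 2 ≤ T →
      IsBVP P.lam P.N e F' x (coeff e (p : H)) T w →
      ‖toH e (w 0) - W p‖ ^ 2 ≤ K * Real.exp (-(P.rate * T)) * ‖p‖ ^ 2 := fun p T w hT hw => by
    refine le_of_tendsto (((hW p).const_sub (toH e (w 0))).norm.pow 2) ?_
    filter_upwards [tendsto_natCast_atTop_atTop.eventually_ge_atTop T] with k hk
    exact hdist p T (k + 2) _ _ hT (by linarith) hw (hω p k)
  -- Combinations of solutions solve the problem with the combined data, and any solutions of that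
  -- problem have the same limit.
  have hlin : ∀ (c d : ℝ) (p q : Hplus e P.N), W (c • p + d • q) = c • W p + d • W q := by
    intro c d p q
    have h1 := ((hW p).const_smul c).add ((hW q).const_smul d)
    refine (tendsto_nhds_unique h1 ?_).symm
    rw [tendsto_iff_norm_sub_tendsto_zero]
    have h2 := (Real.continuous_sqrt.tendsto _).comp
      ((hexp.const_mul K).mul_const (‖c • p + d • q‖ ^ 2))
    rw [mul_zero, zero_mul, Real.sqrt_zero] at h2
    refine squeeze_zero (fun _ => norm_nonneg _) (fun k => ?_) h2
    apply Real.le_sqrt_of_sq_le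
    have hb := (hω p k).lin P.spec (hω q k) c d
    have hb' : IsBVP P.lam P.N e F' x (coeff e ((c • p + d • q : Hplus e P.N) : H)) (k + 2)
        (fun t n => c * ω p k t n + d * ω q k t n) := by
      rw [Submodule.coe_add, Submodule.coe_smul, Submodule.coe_smul, coeff_add, coeff_smul, coeff_smul]
      exact hb
    have h3 := hkey _ _ _ (by linarith [k.cast_nonneg (α := ℝ)]) hb'
    have h4 : toH e (fun n => c * ω p k 0 n + d * ω q k 0 n) =
        c • toH e (ω p k 0) + d • toH e (ω q k 0) := by
      apply coeff_injective e
      rw [coeff_toH (bvp_summable hb (hk0 k)), coeff_add, coeff_smul, coeff_smul,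
        coeff_toH (bvp_summable (hω p k) (hk0 k)), coeff_toH (bvp_summable (hω q k) (hk0 k))]
      rfl
    rw [h4] at h3
    exact h3
  have hlow : ∀ p : Hplus e P.N, W p - p ∈ Hminus e P.N := fun p => mem_Hminus_iff.2 fun n hn => by
    rw [coeff_sub, Pi.sub_apply, sub_eq_zero]
    refine tendsto_nhds_unique (((continuous_coeff e n).tendsto _).comp (hW p))
      (tendsto_const_nhds.congr fun k => ?_)
    rw [Function.comp, coeff_toH (bvp_summable (hω p k) (hk0 k)), (hω p k).low n hn]
  have hbd : ∀ p : Hplus e P.N, ‖W p‖ ≤ S.slope * ‖p‖ := fun p => by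
    refine le_of_tendsto (hW p).norm (Eventually.of_forall fun k => ?_)
    refine (le_abs_self _).trans
      (abs_le_of_sq_le_sq ?_ (mul_nonneg S.slope_nonneg (norm_nonneg _)))
    rw [norm_toH_sq (bvp_summable (hω p k) (hk0 k)), mul_pow, S.slope_sq]
    refine (S.bvp_endpoint_le (hω p k) (by linarith [k.cast_nonneg (α := ℝ)])).trans ?_
    have := ConeParams.plus_coeff_le (P := P) (e := e) (p : H)
    rw [mul_assoc _ (P.lam 0)⁻¹, Submodule.coe_norm]
    gcongr
  set D₀ : Hplus e P.N →ₗ[ℝ] Hminus e P.N :=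
    { toFun := fun p => ⟨W p - p, hlow p⟩
      map_add' := fun p q => by
        have := hlin 1 1 p q
        simp only [one_smul] at this
        ext; push_cast; rw [this]; abel
      map_smul' := fun c p => by
        have := hlin c 0 p 0
        simp only [zero_smul, add_zero] at this
        ext; push_cast; rw [this, smul_sub]; rfl } with hD₀
  have hD₀n : ∀ p, ‖D₀ p‖ ≤ (S.slope + 1) * ‖p‖ := fun p => by
    have h1 : ‖D₀ p‖ = ‖W p - p‖ := rfl
    have h2 := norm_sub_le (W p) p
    rw [h1]
    have := hbd p
    rw [← Submodule.coe_norm] at h2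
    linarith
  refine ⟨D₀.mkContinuous _ hD₀n, D₀.mkContinuous_norm_le (by linarith [S.slope_nonneg]) _, ?_⟩
  intro p T w hT hw
  have : (p : H) + (D₀.mkContinuous _ hD₀n p : Hminus e P.N) = W p := by
    rw [LinearMap.mkContinuous_apply]
    simp [hD₀]
  rw [this]
  exact hkey p T w hT hw

theorem slope_pos (S : ConeSystem P e F F' α C) : 0 < S.slope := by
  have := P.spec.zero_pos
  have := P.μ_pos
  exact Real.sqrt_pos.2 (by positivity)

/-- Estimate of the difference of two trajectories and its linearization, for trajectories that stay
close on `[-T,0]`. -/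
theorem exists_near_estimate (S : ConeSystem P e F F' α C) : ∃ K, 0 ≤ K ∧
    ∀ (δ CF σ ρ q T : ℝ) (x y : ℝ → H) (r : Hplus e P.N) (w : ℝ → ℕ → ℝ), 0 ≤ CF → 0 < ρ →
      CF * ρ ^ δ ≤ P.μ / 4 → 0 < σ → σ ≤ δ → σ * P.αp ≤ P.rate → 2 ≤ T →
      Real.exp (-(P.αp * T)) = q → ρ ^ 2 * q = S.slope ^ 2 * ‖r‖ ^ 2 →
      (∀ u₁ u₂ : H, ‖F u₁ - F u₂ - F' u₁ (u₁ - u₂)‖ ≤ CF * ‖u₁ - u₂‖ ^ (1 + δ)) →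
      S.BoundedPast (fun t => coeff e (x t)) → S.BoundedPast (fun t => coeff e (y t)) →
      (∀ n < P.N, coeff e (x 0 - y 0) n = coeff e (r : H) n) →
      IsBVP P.lam P.N e F' x (coeff e (r : H)) T w →
      ‖x 0 - y 0 - toH e (w 0)‖ ^ 2 ≤ K * q ^ σ * ‖r‖ ^ 2 := by
  obtain ⟨K, hK, hend⟩ := P.exists_endpoint_bound
  have p0 := P.spec.zero_pos
  have hμ := P.μ_pos
  refine ⟨K * ((16 / P.μ + P.μ / 4) * (P.lam 0)⁻¹), by positivity, ?_⟩
  intro δ CF σ ρ q T x y r w hCF hρ hCFρ hσ hσδ hσε hT hTq hq hF hx hy hr hw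
  have hT0 : -T ≤ 0 := by linarith
  have hq0 : 0 < q := hTq ▸ Real.exp_pos _
  have hxc := S.continuousOn_of_past hx.toPast
  have hyc := S.continuousOn_of_past hy.toPast
  -- The Taylor remainder of F: the difference x - y solves (2) along x with h as additional
  -- forcing.
  set h : ℝ → H := fun t => F (x t) - F (y t) - F' (x t) (x t - y t) with hh
  have hFc : Continuous F := (LipschitzWith.of_dist_le_mul (K := ⟨P.L, P.L_pos.le⟩) fun x y => by
    rw [dist_eq_norm, dist_eq_norm]; exact S.lip x y).continuous
  have hhc : ContinuousOn h (Iic 0) :=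
    ((hFc.comp_continuousOn hxc).sub (hFc.comp_continuousOn hyc)).sub
      ((S.deriv_cont.comp_continuousOn hxc).clm_apply (hxc.sub hyc))
  have ov : Orbit P.lam (fun t => coeff e (x t) - coeff e (y t))
      (fun t => coeff e (F (x t)) - coeff e (F (y t))) (-T) 0 := by
    have := (hx.coneOrbit hy hT0 le_rfl).toControlledOrbit.toOrbit
    simpa only [toH_coeff] using this
  have hg : ∀ t, coeff e (F (x t)) - coeff e (F (y t)) =
      coeff e (F' (x t) (x t - y t)) + coeff e (h t) := fun t => by
    rw [← coeff_sub, ← coeff_add]; congr 1; simp only [hh]; abel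
  have hvr : P.plus (coeff e (x 0) - coeff e (y 0)) ≤ (P.lam 0)⁻¹ * ‖r‖ ^ 2 := by
    rw [← coeff_sub, ConeParams.plus_congr hr]; exact ConeParams.plus_coeff_le (r : H)
  -- The relation between ρ, q and r normalizes the backward growth so that the bound reaches ρ²
  -- exactly at t = -T.
  have hv : ∀ t ∈ Icc (-T) 0, ‖x t - y t‖ ^ 2 ≤ ρ ^ 2 * (q * Real.exp (-(P.αp * t))) := fun t ht => by
    have h1 := hx.zeroSq_le hy ht.2
    rw [← coeff_sub, zeroSq_coeff] at h1
    refine h1.trans ?_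
    rw [← mul_assoc, hq, S.slope_sq,
      show P.αp * (-t + 1) = P.αp + -(P.αp * t) by ring, Real.exp_add]
    calc _ ≤ (1 + P.L ^ 2) * P.μ⁻¹ * (Real.exp P.αp * Real.exp (-(P.αp * t))) *
          ((P.lam 0)⁻¹ * ‖r‖ ^ 2) := by gcongr
      _ = _ := by ring
  have hb1 : ∀ t ∈ Icc (-T) 0, q * Real.exp (-(P.αp * t)) ≤ 1 := fun t ht => by
    rw [← hTq, ← Real.exp_add, Real.exp_le_one_iff]
    nlinarith [P.αp_pos, ht.1]
  have hrem : ∀ t ∈ Icc (-T) 0, ‖h t‖ ^ 2 ≤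
      (P.μ / 4) ^ 2 * (q * Real.exp (-(P.αp * t))) ^ σ * ‖x t - y t‖ ^ 2 := fun t ht =>
    (pow_le_pow_left₀ (norm_nonneg _) (hF _ _) 2).trans
      (remainder_sq_le hCF hρ hCFρ (norm_nonneg _) (hv t ht) (hb1 t ht) hσ hσδ)
  -- The form used for absorption: with Young parameter μ/4 the remainder costs half of μ.
  have hrem1 : ∀ t ∈ Icc (-T) 0, ‖h t‖ ^ 2 ≤ (P.μ / 4) ^ 2 * ‖x t - y t‖ ^ 2 := fun t ht => by
    refine (hrem t ht).trans ?_
    have := Real.rpow_le_one (by positivity) (hb1 t ht) hσ.le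
    have : (P.μ / 4) ^ 2 * (q * Real.exp (-(P.αp * t))) ^ σ ≤ (P.μ / 4) ^ 2 :=
      mul_le_of_le_one_right (by positivity) this
    gcongr
  -- The form that extracts the gain q^σ: because σα₊ ≤ ε, the growth of the distance into the past
  -- is covered by the factor e^{-εt} of the weighted integral.
  have hrem2 : ∀ t ∈ Icc (-T) 0, ‖h t‖ ^ 2 ≤
      (P.μ / 4) ^ 2 * q ^ σ * (Real.exp (-(P.rate * t)) * ‖x t - y t‖ ^ 2) := fun t ht => by
    refine (hrem t ht).trans ?_
    have h1 : (q * Real.exp (-(P.αp * t))) ^ σ ≤ q ^ σ * Real.exp (-(P.rate * t)) := by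
      rw [Real.mul_rpow hq0.le (Real.exp_pos _).le, ← Real.exp_mul]
      refine mul_le_mul_of_nonneg_left (Real.exp_le_exp.2 ?_) (Real.rpow_nonneg hq0.le _)
      nlinarith [ht.2]
    calc _ ≤ (P.μ / 4) ^ 2 * (q ^ σ * Real.exp (-(P.rate * t))) * ‖x t - y t‖ ^ 2 := by gcongr
      _ = _ := by ring
  have ha := S.intervalIntegrable_rate hxc (T := T) (by linarith)
  set θ : ℝ → ℝ := fun s => weight (fun t => α (x t)) s * Real.exp (-(P.rate * s)) with hθ
  have hIv : ∫ s in (-T)..0, θ s * zeroSq (coeff e (x s) - coeff e (y s)) ≤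
      4 / P.μ * ((P.lam 0)⁻¹ * ‖r‖ ^ 2) := by
    have h1 := P.weighted_integral_le ov ha (by
      filter_upwards [ov.ae_summable_one P.spec] with t h1 hm
      have s1 := h1 hm
      have h2 := wRate_add_le P.spec (κ := P.μ / 4) (by positivity) s1
        (summable_coeff_sq e (F' (x t) (x t - y t))) (summable_coeff_sq e (h t)) (abs_sg_le P.N)
      rw [← coeff_sub] at s1 h2 ⊢
      have h3 := S.cone (x t) (x t - y t) s1
      have h4 := mul_le_mul_of_nonneg_left (hrem1 t ⟨hm.1.le, hm.2⟩)
        (by positivity : 0 ≤ (P.μ / 4)⁻¹)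
      have h5 : (P.μ / 4)⁻¹ * ((P.μ / 4) ^ 2 * ‖x t - y t‖ ^ 2) = P.μ / 4 * ‖x t - y t‖ ^ 2 := by
        field_simp
      rw [zeroSq_coeff, zeroSq_coeff] at h2
      rw [hg, zeroSq_coeff]
      linarith) (hx.V_nonpos hy hT0)
    have h2 := h1.trans hvr
    have : ∀ X : ℝ, X = 4 / P.μ * (P.μ / 4 * X) := fun X => by field_simp
    rw [this (∫ s in (-T)..0, _)]
    exact mul_le_mul_of_nonneg_left h2 (by positivity)
  have hIw : ∫ s in (-T)..0, θ s * zeroSq (w s) ≤ 4 / P.μ * ((P.lam 0)⁻¹ * ‖r‖ ^ 2) := by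
    have h2 := (S.bvp_weighted hxc hw).trans (ConeParams.plus_coeff_le (r : H))
    have : ∀ X : ℝ, X = 4 / P.μ * (P.μ / 4 * X) := fun X => by field_simp
    rw [this (∫ s in (-T)..0, _)]
    exact mul_le_mul_of_nonneg_left h2 (by positivity)
  have hIz := S.weighted_sub_le hxc ov hw.orbit
  have oz := ov.sub P.spec hw.orbit
  have hηi : IntervalIntegrable (fun t => ‖h t‖ ^ 2) volume (-T) 0 := by
    apply ContinuousOn.intervalIntegrable
    rw [uIcc_of_le hT0]
    exact (hhc.mono fun s hs => hs.2).norm.pow 2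
  -- The difference of x - y and w solves (2) with forcing h and has no low modes at 0, as the
  -- endpoint bound requires.
  have hgz : ∀ᵐ t, t ∈ Ioc (-T) 0 → (Summable fun n => P.lam n *
      (coeff e (x t) - coeff e (y t) - w t) n ^ 2) ∧
      coeff e (F (x t)) - coeff e (F (y t)) - coeff e (F' (x t) (toH e (w t))) =
      coeff e (F' (x t) (toH e (coeff e (x t) - coeff e (y t) - w t))) + coeff e (h t) := by
    filter_upwards [oz.ae_summable_one P.spec, hw.orbit.ae_summable_one P.spec] with t h1 h2 hm
    refine ⟨h1 hm, ?_⟩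
    rw [← coeff_sub e (x t), toH_sub (summable_coeff_sq e _) (summable_zero_of_one P.spec (h2 hm)),
      toH_coeff, hg, map_sub (F' (x t)) (x t - y t), coeff_sub _ (F' (x t) (x t - y t))]
    abel
  have hz := hend _ _ (fun t => α (x t)) (fun t => ‖h t‖ ^ 2) T hT oz ha (fun t => (S.α_mem _).2) hηi
    (fun t => sq_nonneg _) (by
      filter_upwards [hgz] with t h1 hm
      obtain ⟨s1, h1⟩ := h1 hm
      have s0 := summable_zero_of_one P.spec s1
      have h2 := wRate_add_le P.spec (κ := P.μ / 2) (by positivity) s1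
        (summable_coeff_sq e (F' (x t) (toH e (coeff e (x t) - coeff e (y t) - w t))))
        (summable_coeff_sq e (h t)) (abs_sg_le P.N)
      have h3 := S.cone (x t) (toH e (coeff e (x t) - coeff e (y t) - w t))
        (by rw [coeff_toH s0]; exact s1)
      rw [coeff_toH s0, norm_toH_sq s0] at h3
      rw [h1]
      rw [zeroSq_coeff, inv_div] at h2
      linarith) (by
      filter_upwards [hgz] with t h1 hm
      obtain ⟨s1, h1⟩ := h1 hm
      have s0 := summable_zero_of_one P.spec s1
      rw [h1]
      refine (zeroSq_add_le (summable_coeff_sq e _) (summable_coeff_sq e _)).2.trans ?_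
      rw [zeroSq_coeff, zeroSq_coeff, ← norm_toH_sq (e := e) s0]
      have h4 := pow_le_pow_left₀ (norm_nonneg _) ((F' (x t)).le_of_opNorm_le (S.deriv _)
        (toH e (coeff e (x t) - coeff e (y t) - w t))) 2
      rw [mul_pow] at h4
      linarith)
    (P.plus_eq_zero (ξ := coeff e (x 0) - coeff e (y 0) - w 0) fun n hn => by
      have := hr n hn
      rw [coeff_sub] at this
      rw [Pi.sub_apply, this, hw.low n hn, sub_self])
  have hwη : ∫ s in (-T)..0, weight (fun t => α (x t)) s * ‖h s‖ ^ 2 ≤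
      (P.μ / 4) ^ 2 * q ^ σ * ∫ s in (-T)..0, θ s * zeroSq (coeff e (x s) - coeff e (y s)) := by
    rw [← intervalIntegral.integral_const_mul]
    refine intervalIntegral.integral_mono_on hT0 (hηi.continuousOn_mul ?_)
      ((S.intervalIntegrable_weighted hxc ov).const_mul _) fun s hs => ?_
    · rw [uIcc_of_le hT0]; exact continuousOn_weight (by linarith) ha
    · have h1 := mul_le_mul_of_nonneg_left (hrem2 s hs)
        (weight_pos (a := fun t => α (x t)) (s := s)).le
      rw [← coeff_sub, zeroSq_coeff]
      refine h1.trans (le_of_eq ?_)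
      simp only [hθ]; ring
  have hE : Real.exp (-(P.rate * T)) ≤ q ^ σ := by
    rw [← hTq, ← Real.exp_mul]
    apply Real.exp_le_exp.2
    nlinarith
  have sw := bvp_summable hw (by linarith)
  have sv := summable_coeff_sq e (x 0 - y 0)
  have e1 : ‖x 0 - y 0 - toH e (w 0)‖ ^ 2 = zeroSq (coeff e (x 0) - coeff e (y 0) - w 0) := by
    rw [← coeff_sub, ← norm_toH_sq (e := e) (zeroSq_sub_le sv sw).1, toH_sub sv sw, toH_coeff]
  rw [e1]
  refine hz.trans ?_
  rw [mul_assoc, mul_assoc]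
  refine mul_le_mul_of_nonneg_left ?_ hK
  set Y := (P.lam 0)⁻¹ * ‖r‖ ^ 2 with hY
  have hY0 : 0 ≤ Y := by positivity
  have hqσ : 0 ≤ q ^ σ := Real.rpow_nonneg hq0.le _
  have f1 : ∫ s in (-T)..0, weight (fun t => α (x t)) s * Real.exp (-(P.rate * s)) *
      zeroSq (coeff e (x s) - coeff e (y s) - w s) ≤ 16 / P.μ * Y := by
    refine hIz.trans ?_
    have : 16 / P.μ * Y = 2 * (4 / P.μ * Y) + 2 * (4 / P.μ * Y) := by ring
    rw [this]
    exact add_le_add (mul_le_mul_of_nonneg_left hIv zero_le_two)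
      (mul_le_mul_of_nonneg_left hIw zero_le_two)
  have f2 : Real.exp (-(P.rate * T)) * (∫ s in (-T)..0, weight (fun t => α (x t)) s *
      Real.exp (-(P.rate * s)) * zeroSq (coeff e (x s) - coeff e (y s) - w s)) ≤
      q ^ σ * (16 / P.μ * Y) :=
    (mul_le_mul_of_nonneg_left f1 (Real.exp_pos _).le).trans
      (mul_le_mul_of_nonneg_right hE (by positivity))
  have f3 : ∫ s in (-T)..0, weight (fun t => α (x t)) s * ‖h s‖ ^ 2 ≤ q ^ σ * (P.μ / 4 * Y) := by
    refine hwη.trans ((mul_le_mul_of_nonneg_left hIv (by positivity)).trans (le_of_eq ?_))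
    field_simp
  calc _ ≤ q ^ σ * (16 / P.μ * Y) + q ^ σ * (P.μ / 4 * Y) := add_le_add f2 f3
    _ = _ := by rw [hY]; ring

end ConeSystem

/-! ### The Hölder estimate and the derivative of the manifold. -/

theorem sq_mul_rpow_eq {n σ : ℝ} (hn : 0 ≤ n) (hσ : 0 < σ) :
    (n ^ (1 + σ)) ^ 2 = (n ^ 2) ^ σ * n ^ 2 := by
  rw [Real.rpow_add_of_nonneg hn zero_le_one hσ.le, Real.rpow_one, mul_pow, ← Real.rpow_natCast,
    ← Real.rpow_natCast, ← Real.rpow_mul hn, ← Real.rpow_mul hn, mul_comm σ, mul_comm]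

theorem hasFDerivAt_of_holder {E G : Type*} [NormedAddCommGroup E] [NormedSpace ℝ E]
    [NormedAddCommGroup G] [NormedSpace ℝ G] {f : E → G} {D : E →L[ℝ] G} {p : E} {K σ : ℝ}
    (hσ : 0 < σ) (h : ∀ q, ‖f p - f q - D (p - q)‖ ≤ K * ‖p - q‖ ^ (1 + σ)) : HasFDerivAt f D p := by
  rw [hasFDerivAt_iff_tendsto]
  have h1 : Tendsto (fun q => K * ‖p - q‖ ^ σ) (𝓝 p) (𝓝 0) := by
    have : Tendsto (fun q => ‖p - q‖) (𝓝 p) (𝓝 0) := by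
      have : Continuous fun q : E => ‖p - q‖ := by fun_prop
      simpa using this.tendsto p
    have h2 := (this.rpow_const (Or.inr hσ.le)).const_mul K
    rwa [Real.zero_rpow hσ.ne', mul_zero] at h2
  refine squeeze_zero (fun q => by positivity) (fun q => ?_) h1
  have e1 : ‖f q - f p - D (q - p)‖ = ‖f p - f q - D (p - q)‖ := by
    rw [← norm_neg]; congr 1; rw [map_sub, map_sub]; abel
  rw [e1, norm_sub_rev q p]
  rcases (norm_nonneg (p - q)).eq_or_lt with h0 | h0
  · have := h q
    rw [← h0, Real.zero_rpow (by linarith), mul_zero] at this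
    have h2 := le_antisymm this (norm_nonneg _)
    rw [h2, mul_zero, ← h0, Real.zero_rpow hσ.ne', mul_zero]
  · rw [inv_mul_le_iff₀ h0]
    refine (h q).trans (le_of_eq ?_)
    rw [Real.rpow_add h0, Real.rpow_one]; ring

theorem normHs_coeff_le {H : Type*} [NormedAddCommGroup H] [InnerProductSpace ℝ H] {lam : ℕ → ℝ}
    (hl : IsSpectrum lam) (e : HilbertBasis ℕ ℝ H) (x : H) :
    normHs lam (-1) (coeff e x) ≤ √(lam 0)⁻¹ * ‖x‖ := by
  have h := negSq_le_zeroSq hl (summable_coeff_sq e x)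
  rw [zeroSq_coeff] at h
  rw [normHs_neg_one, Real.sqrt_le_iff, mul_pow, Real.sq_sqrt (inv_nonneg.2 hl.zero_pos.le)]
  exact ⟨by positivity, h⟩

section Problem

variable {H : Type*} [NormedAddCommGroup H] [InnerProductSpace ℝ H] {lam : ℕ → ℝ} {N : ℕ}
  {e : HilbertBasis ℕ ℝ H} {F' : H → H →L[ℝ] H} {x y : ℝ → H} {T : ℝ} {w : ℝ → ℕ → ℝ}

theorem IsBVP.congr {p : ℕ → ℝ} (h : IsBVP lam N e F' x p T w) (hxy : ∀ t ≤ 0, x t = y t) :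
    IsBVP lam N e F' y p T w :=
  ⟨Orbit.congr_forcing h.orbit fun n => ae_of_all _ fun t ht => by rw [hxy t ht.2], h.low, h.high⟩

theorem IsBVP.solves (hl : IsSpectrum lam) {p : Hplus e N} (h : IsBVP lam N e F' x (coeff e (p : H)) T w) :
    SolvesVariationBVP e lam F' N x p T w := by
  refine ⟨Orbit.isEnergySolution hl h.orbit, ?_, ?_⟩
  · ext n
    unfold projP
    split_ifs with hn
    · exact h.low n hn
    · rw [mem_Hplus_iff.1 p.2 n (not_lt.1 hn)]
  · ext n
    unfold projQ
    split_ifs with hn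
    · rfl
    · exact h.high n (not_lt.1 hn)

theorem SolvesVariationBVP.isBVP (hl : IsSpectrum lam) {L : ℝ} (hF : ∀ x, ‖F' x‖ ≤ L)
    {p : Hplus e N} (hT : 0 < T) (h : SolvesVariationBVP e lam F' N x p T w) :
    IsBVP lam N e F' x (coeff e (p : H)) T w := by
  refine ⟨h.solution.orbit hl (by linarith) hF, fun n hn => ?_, fun n hn => ?_⟩
  · rw [← h.plus_end, projP, if_pos hn]
  · have := congrFun h.minus_start n
    rwa [projQ, if_neg (not_lt.2 hn)] at this

end Problem

namespace ConeSystem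

variable {H : Type*} [NormedAddCommGroup H] [InnerProductSpace ℝ H] [MeasurableSpace H]
  {P : ConeParams} {e : HilbertBasis ℕ ℝ H} {F : H → H} {F' : H → H →L[ℝ] H} {α : H → ℝ} {C : ℝ}
  {x y : ℝ → H} {w : ℝ → ℕ → ℝ} {T : ℝ} [BorelSpace H] [CompleteSpace H]

/-- For small r the time T is chosen with e^{-α₊T} = q proportional to ‖r‖². The nonlinear error and
the distance of the truncated problem from its limit D r are both of order q^σ‖r‖² in the squared
norm. For large r the linear growth of both terms suffices. -/
theorem exists_holder_estimate (S : ConeSystem P e F F' α C) {δ CF : ℝ} (hδ : 0 < δ) (hCF : 0 ≤ CF)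
    (hF : ∀ u₁ u₂ : H, ‖F u₁ - F u₂ - F' u₁ (u₁ - u₂)‖ ≤ CF * ‖u₁ - u₂‖ ^ (1 + δ)) {K₀ : ℝ}
    (hK₀ : 0 ≤ K₀) :
    ∃ σ : ℝ, 0 < σ ∧ ∃ K : ℝ, 0 ≤ K ∧ ∀ (x y : ℝ → H) (r : Hplus e P.N)
      (D : Hplus e P.N →L[ℝ] Hminus e P.N), S.BoundedPast (fun t => coeff e (x t)) →
      S.BoundedPast (fun t => coeff e (y t)) → ‖D‖ ≤ S.slope + 1 → IsLinearization P e F' x K₀ D →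
      (∀ n < P.N, coeff e (x 0 - y 0) n = coeff e (r : H) n) →
      ‖x 0 - y 0 - (r + D r)‖ ≤ K * ‖r‖ ^ (1 + σ) := by
  obtain ⟨K₁, hK₁, hnear⟩ := S.exists_near_estimate
  have hμ := P.μ_pos
  have hαp := P.αp_pos
  have hs := S.slope_pos
  set σ := min δ (P.rate / P.αp) with hσ
  have hσ0 : 0 < σ := lt_min hδ (div_pos P.rate_pos hαp)
  have hσε : σ * P.αp ≤ P.rate := by
    rw [← le_div_iff₀ hαp]; exact min_le_right _ _
  -- The distance below which μ absorbs the Taylor remainder; the summand 1 covers the case CF = 0.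
  set ρ := (P.μ / (4 * (CF + 1))) ^ δ⁻¹ with hρ
  have hρ0 : 0 < ρ := Real.rpow_pos_of_pos (by positivity) _
  have hρδ : CF * ρ ^ δ ≤ P.μ / 4 := by
    rw [hρ, Real.rpow_inv_rpow (by positivity) hδ.ne']
    have : CF * (P.μ / (4 * (CF + 1))) = P.μ / 4 * (CF / (CF + 1)) := by field_simp
    rw [this]
    exact mul_le_of_le_one_right (by positivity) ((div_le_one (by positivity)).2 (by linarith))
  -- The threshold for ‖r‖ that guarantees q ≤ e^{-2α₊}, that is, T ≥ 2.
  set d := ρ * Real.exp (-P.αp) / S.slope with hd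
  have hd0 : 0 < d := by positivity
  set B := 2 * (K₁ + K₀) * ((S.slope / ρ) ^ 2) ^ σ with hB
  have hB0 : 0 ≤ B := by positivity
  set B' := (2 * S.slope + 2) * (d ^ σ)⁻¹ with hB'
  have hB'0 : 0 ≤ B' := by positivity
  refine ⟨σ, hσ0, √B + B', by positivity, fun x y r D hx hy hDn hD hr => ?_⟩
  have hr0 := norm_nonneg r
  have hpow : 0 ≤ ‖r‖ ^ (1 + σ) := Real.rpow_nonneg hr0 _
  have hlip : ‖x 0 - y 0‖ ≤ S.slope * ‖r‖ := by
    have h1 := hx.zeroSq_le hy le_rfl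
    rw [← coeff_sub, zeroSq_coeff, ConeParams.plus_congr hr] at h1
    refine (le_abs_self _).trans (abs_le_of_sq_le_sq (h1.trans ?_) (by positivity))
    rw [mul_pow, S.slope_sq, neg_zero, zero_add, mul_one, mul_assoc _ (P.lam 0)⁻¹]
    have := ConeParams.plus_coeff_le (P := P) (e := e) (r : H)
    rw [Submodule.coe_norm]
    gcongr
  rcases le_or_gt ‖r‖ d with h | h
  · rcases hr0.eq_or_lt with h0 | h0
    · have hr00 : r = 0 := norm_eq_zero.1 h0.symm
      rw [← h0, mul_zero] at hlip
      have : x 0 - y 0 = 0 := norm_eq_zero.1 (le_antisymm hlip (norm_nonneg _))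
      rw [this, hr00]
      simp only [map_zero, Submodule.coe_zero, add_zero, sub_zero, norm_zero]
      rw [Real.zero_rpow (by positivity : 1 + σ ≠ 0), mul_zero]
    set q := (S.slope / ρ) ^ 2 * ‖r‖ ^ 2 with hq
    have hq0 : 0 < q := by positivity
    have hq1 : q ≤ Real.exp (-(P.αp * 2)) := by
      have h1 : S.slope / ρ * ‖r‖ ≤ Real.exp (-P.αp) := by
        rw [hd, le_div_iff₀ hs] at h
        rw [div_mul_eq_mul_div, div_le_iff₀ hρ0]; linarith
      rw [hq, ← mul_pow]
      refine (pow_le_pow_left₀ (by positivity) h1 2).trans (le_of_eq ?_)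
      rw [← Real.exp_nat_mul]; congr 1; push_cast; ring
    set T := -Real.log q / P.αp with hT
    have hTα : P.αp * T = -Real.log q := by rw [hT]; field_simp
    have hTq : Real.exp (-(P.αp * T)) = q := by rw [hTα, neg_neg, Real.exp_log hq0]
    have hT2 : 2 ≤ T := by
      have := (Real.log_le_iff_le_exp hq0).2 hq1
      rw [hT, le_div_iff₀ hαp]; linarith
    obtain ⟨w, hw⟩ := S.exists_bvp (S.continuousOn_of_past hx.toPast) (by linarith : 0 < T)
      (coeff e (r : H))
    have h1 := hnear δ CF σ ρ q T x y r w hCF hρ0 hρδ hσ0 (min_le_left _ _) hσε hT2 hTq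
      (by rw [hq]; field_simp) hF hx hy hr hw
    have h2 := hD r T w hT2 hw
    have h3 : Real.exp (-(P.rate * T)) ≤ q ^ σ := by
      rw [← hTq, ← Real.exp_mul]
      apply Real.exp_le_exp.2
      nlinarith
    have h4 : ‖x 0 - y 0 - (r + D r)‖ ^ 2 ≤ B * (‖r‖ ^ (1 + σ)) ^ 2 := by
      have e1 : x 0 - y 0 - (r + D r) = (x 0 - y 0 - toH e (w 0)) + (toH e (w 0) - (r + D r)) := by
        abel
      have e2 := norm_add_le (x 0 - y 0 - toH e (w 0)) (toH e (w 0) - (r + D r))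
      rw [← e1] at e2
      have e3 : K₀ * Real.exp (-(P.rate * T)) * ‖r‖ ^ 2 ≤ K₀ * q ^ σ * ‖r‖ ^ 2 := by gcongr
      have e4 : q ^ σ = ((S.slope / ρ) ^ 2) ^ σ * (‖r‖ ^ 2) ^ σ :=
        Real.mul_rpow (by positivity) (by positivity)
      rw [sq_mul_rpow_eq hr0 hσ0]
      calc _ ≤ (‖x 0 - y 0 - toH e (w 0)‖ + ‖toH e (w 0) - (r + D r)‖) ^ 2 :=
            pow_le_pow_left₀ (norm_nonneg _) e2 2
        _ ≤ 2 * (K₁ * q ^ σ * ‖r‖ ^ 2) + 2 * (K₀ * q ^ σ * ‖r‖ ^ 2) := by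
          nlinarith [sq_nonneg (‖x 0 - y 0 - toH e (w 0)‖ - ‖toH e (w 0) - (r + D r)‖)]
        _ = _ := by rw [e4, hB]; ring
    have h5 : ‖x 0 - y 0 - (r + D r)‖ ≤ √B * ‖r‖ ^ (1 + σ) := by
      refine (le_abs_self _).trans (abs_le_of_sq_le_sq ?_ (by positivity))
      rw [mul_pow, Real.sq_sqrt hB0]; exact h4
    have := mul_nonneg hB'0 hpow
    linarith
  · have h1 : ‖(r : H) + D r‖ ≤ ‖r‖ + (S.slope + 1) * ‖r‖ :=
      (norm_add_le _ _).trans (add_le_add le_rfl (D.le_of_opNorm_le hDn r))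
    have h2 := norm_sub_le (x 0 - y 0) ((r : H) + D r)
    have h3 : (2 * S.slope + 2) * ‖r‖ ≤ B' * ‖r‖ ^ (1 + σ) := by
      have e1 : 1 ≤ (d ^ σ)⁻¹ * ‖r‖ ^ σ := by
        rw [le_inv_mul_iff₀ (Real.rpow_pos_of_pos hd0 _), mul_one]
        exact Real.rpow_le_rpow hd0.le h.le hσ0.le
      rw [hB', Real.rpow_add_of_nonneg hr0 zero_le_one hσ0.le, Real.rpow_one]
      calc _ ≤ (2 * S.slope + 2) * ‖r‖ * ((d ^ σ)⁻¹ * ‖r‖ ^ σ) :=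
            le_mul_of_one_le_right (by positivity) e1
        _ = _ := by ring
    have := mul_nonneg (Real.sqrt_nonneg B) hpow
    linarith

/-- Two backward trajectories on the manifold with the same end point coincide. -/
theorem backward_unique (S : ConeSystem P e F F' α C) {Φ : Hplus e P.N → Hminus e P.N}
    (hΦ : graphSet e P.N Φ = S.manifold) {p : Hplus e P.N}
    (hx : IsBackwardTrajectory e P.lam F P.N Φ p x) (hy : IsBackwardTrajectory e P.lam F P.N Φ p y)
    {t : ℝ} (ht : t ≤ 0) : x t = y t :=
  coeff_injective e ((S.boundedPast_of_isBackwardTrajectory hΦ hx).eq_of_low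
    (S.boundedPast_of_isBackwardTrajectory hΦ hy) (fun n _ => by rw [hx.endpoint, hy.endpoint]) ht)

theorem tendsto_projQ (S : ConeSystem P e F F' α C) {K : ℝ} {D : Hplus e P.N →L[ℝ] Hminus e P.N}
    (hD : IsLinearization P e F' x K D) (p : Hplus e P.N) {w : ℝ → ℝ → ℕ → ℝ}
    (hw : ∀ T > 0, SolvesVariationBVP e P.lam F' P.N x p T (w T)) :
    Tendsto (fun T => normHs P.lam (-1) (projQ P.N (w T 0) - coeff e (D p : H))) atTop (𝓝 0) := by
  have hexp : Tendsto (fun T : ℝ => Real.exp (-(P.rate * T))) atTop (𝓝 0) :=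
    Real.tendsto_exp_neg_atTop_nhds_zero.comp (tendsto_id.const_mul_atTop P.rate_pos)
  have h0 := ((Real.continuous_sqrt.tendsto _).comp ((hexp.const_mul K).mul_const (‖p‖ ^ 2))).const_mul
    (√(P.lam 0)⁻¹)
  rw [mul_zero, zero_mul, Real.sqrt_zero, mul_zero] at h0
  refine squeeze_zero' (Eventually.of_forall fun T => Real.sqrt_nonneg _) ?_ h0
  filter_upwards [eventually_ge_atTop 2] with T hT
  have hb := (hw T (by linarith)).isBVP P.spec S.deriv (by linarith)
  have h1 := hD p T _ hT hb
  have e1 : projQ P.N (w T 0) - coeff e (D p : H) = coeff e (toH e (w T 0) - (p + D p)) := by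
    rw [coeff_sub, coeff_add, coeff_toH (bvp_summable hb (by linarith)), ← (hw T (by linarith)).plus_end]
    ext n
    simp only [projP, projQ, Pi.sub_apply, Pi.add_apply]
    split_ifs <;> ring
  rw [e1]
  refine (normHs_coeff_le P.spec e _).trans (mul_le_mul_of_nonneg_left ?_ (Real.sqrt_nonneg _))
  exact Real.le_sqrt_of_sq_le h1

end ConeSystem

end CahnHilliard
-- The main theorem.
theorem mainTheorem2 {H : Type*} [NormedAddCommGroup H] [InnerProductSpace ℝ H] [CompleteSpace H]
    [MeasurableSpace H] [BorelSpace H]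
    (A : H →ₗ.[ℝ] H) (hA : CahnHilliard.IsPositiveWithCompactInverse A)
    (e : HilbertBasis ℕ ℝ H) (lam : ℕ → ℝ) (he : CahnHilliard.IsEigenbasis A e lam)
    (N : ℕ) (hN : 1 ≤ N)
    (F : H → H) (F' : H → H →L[ℝ] H) (L : ℝ) (hF : CahnHilliard.IsAdmissible F F' L)
    (hcone : CahnHilliard.StrongCone e lam N F F')
    (δ : ℝ) (hδ : 0 < δ) (CF : ℝ)
    (hFδ : ∀ u₁ u₂ : H, ‖F u₁ - F u₂ - F' u₁ (u₁ - u₂)‖ ≤ CF * ‖u₁ - u₂‖ ^ (1 + δ)) :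
    (∃ Φ : CahnHilliard.Hplus e N → CahnHilliard.Hminus e N,
      CahnHilliard.IsInertialManifold e lam F N Φ) ∧
    ∀ Φ : CahnHilliard.Hplus e N → CahnHilliard.Hminus e N,
      CahnHilliard.IsInertialManifold e lam F N Φ →
      ∃ Φ' : CahnHilliard.Hplus e N → CahnHilliard.Hplus e N →L[ℝ] CahnHilliard.Hminus e N,
        (∀ p, HasFDerivAt Φ (Φ' p) p) ∧
        (∃ ε : ℝ, 0 < ε ∧ ∃ C : ℝ, ∀ p q : CahnHilliard.Hplus e N,
          CahnHilliard.normHs lam (-1)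
              (CahnHilliard.coeff e ((Φ p - Φ q - Φ' p (p - q) : CahnHilliard.Hminus e N) : H))
            ≤ C * ‖p - q‖ ^ (1 + ε)) ∧
        (∀ p : CahnHilliard.Hplus e N,
          (∃ u : ℝ → H, CahnHilliard.IsBackwardTrajectory e lam F N Φ p u) ∧
          ∀ u : ℝ → H, CahnHilliard.IsBackwardTrajectory e lam F N Φ p u →
          ∀ wp : CahnHilliard.Hplus e N,
            (∀ T > 0, ∃ w : ℝ → ℕ → ℝ, CahnHilliard.SolvesVariationBVP e lam F' N u wp T w) ∧
            ∀ w : ℝ → ℝ → ℕ → ℝ,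
              (∀ T > 0, CahnHilliard.SolvesVariationBVP e lam F' N u wp T (w T)) →
              Tendsto (fun T => CahnHilliard.normHs lam (-1)
                  (CahnHilliard.projQ N (w T 0) - CahnHilliard.coeff e (Φ' p wp : H)))
                atTop (𝓝 0)) := by
  -- The sign of CF is not prescribed, so its absolute value is used.
  have hFδ' : ∀ u₁ u₂ : H, ‖F u₁ - F u₂ - F' u₁ (u₁ - u₂)‖ ≤ |CF| * ‖u₁ - u₂‖ ^ (1 + δ) :=
    fun u₁ u₂ => (hFδ u₁ u₂).trans (mul_le_mul_of_nonneg_right (le_abs_self _)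
      (Real.rpow_nonneg (norm_nonneg _) _))
  obtain ⟨P, rfl, rfl, α, C, S⟩ := CahnHilliard.exists_coneSystem
    (CahnHilliard.isSpectrum_of_eigenbasis hA he) N hF hcone
    (CahnHilliard.continuous_deriv hδ (abs_nonneg _) hFδ')
  refine ⟨S.exists_isInertialManifold, fun Φ hΦ => ?_⟩
  have hgr := S.graph_eq_manifold hN hΦ
  choose x hx using S.exists_isBackwardTrajectory hgr
  have hp := fun p => S.boundedPast_of_isBackwardTrajectory hgr (hx p)
  obtain ⟨K₀, hK₀, hlin⟩ := S.exists_linearization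
  choose D hDn hD using fun p => hlin (x p) (S.continuousOn_of_past (hp p).toPast)
  obtain ⟨σ, hσ, K, hK, hest⟩ := S.exists_holder_estimate hδ (abs_nonneg CF) hFδ' hK₀
  have key : ∀ p q, ‖Φ p - Φ q - D p (p - q)‖ ≤ K * ‖p - q‖ ^ (1 + σ) := fun p q => by
    have h := hest (x p) (x q) (p - q) (D p) (hp p) (hp q) (hDn p) (hD p) fun n hn => by
      rw [(hx p).endpoint, (hx q).endpoint, CahnHilliard.coeff_sub, Pi.sub_apply,
        CahnHilliard.coeff_add_of_lt _ _ hn, CahnHilliard.coeff_add_of_lt _ _ hn,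
        Submodule.coe_sub, CahnHilliard.coeff_sub, Pi.sub_apply]
    refine (le_of_eq ?_).trans h
    rw [(hx p).endpoint, (hx q).endpoint, Submodule.coe_norm]
    congr 1
    push_cast
    abel
  refine ⟨D, fun p => CahnHilliard.hasFDerivAt_of_holder hσ (key p),
    ⟨σ, hσ, √(P.lam 0)⁻¹ * K, fun p q => ?_⟩, fun p => ⟨⟨x p, hx p⟩, fun u hu wp => ⟨fun T hT => ?_,
      fun w hw => ?_⟩⟩⟩
  · refine (CahnHilliard.normHs_coeff_le P.spec e _).trans ?_
    rw [mul_assoc]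
    exact mul_le_mul_of_nonneg_left (key p q) (Real.sqrt_nonneg _)
  · obtain ⟨w, hw⟩ := S.exists_bvp (S.continuousOn_of_past
      (S.boundedPast_of_isBackwardTrajectory hgr hu).toPast) hT (CahnHilliard.coeff e (wp : H))
    exact ⟨w, hw.solves P.spec⟩
  · refine S.tendsto_projQ (x := x p) (hD p) wp fun T hT => ?_
    -- The operator was built from one chosen trajectory; uniqueness of backward trajectories on the
    -- manifold transfers the limit formula to u.
    exact (((hw T hT).isBVP P.spec S.deriv hT).congr fun t ht =>
      S.backward_unique hgr hu (hx p) ht).solves P.spec
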